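/- **Conventions.** Logarithms are to base 2. Let $k\le k'$ be positive integers and $\varepsilon\in(0,1)$, and assume throughout that $\varepsilon\ge 2^{-k^{0.001}}$ and that $k$ is at least a sufficiently large constant. Write $\Lambda=\log(k'/\varepsilon)$. For $f:\{\pm1\}^{k'}\to\mathbb R$ and $S\subseteq[k']$ let $\chi_S(x)=\prod_{i\in S}x_i$, $\hat f(S)=\mathbb E_x[f(x)\chi_S(x)]$ for uniform $x$, and for real $L$ let $\mathbf W^{\ge L}[f]=\sum_{|S|\ge L}\hat f(S)^2$. For $I\subseteq[k']$ let $f^I_{\mathrm{ave}}(x)=\mathbb E_y[f(y)\mid y_i=x_i\ \forall i\notin I]$. For $V\subseteq[k']$ and $\rho\in[0,1]$ let $N^V_\rho(x)$ be the law of the random point $y$ with independent coordinates, where $y_i=x_i$ for $i\notin V$, and for $i\in V$, $y_i=x_i$ with probability $\rho$ and $y_i$ is uniform in $\{\pm1\}$ with probability $1-\rho$; let $T^V_\rho f(x)=\mathbb E_{y\sim N^V_\rho(x)}[f(y)]$. Let $\mathrm{SharpNoise}^V_{\ell,\kappa,\Delta}=\sum_{i=0}^{\kappa\Delta}\alpha_iT^V_{\rho^i}$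 with $\rho=1-\frac1{2\ell}$ and $(1-(1-X)^\kappa)^\Delta=\sum_i\alpha_iX^i$. An $M$-bounded randomized algorithm for $g:\{\pm1\}^{k'}\to[-M,M]$ outputs, on each input $x$, a random value in $[-M,M]$ with mean $g(x)$; different calls are independent. **Estimators.** Let $\mathcal A$ be an $M$-bounded randomized algorithm for $g$. * $\mathrm{EstL2}(\mathcal A,M,a,\delta)$: put $N=\lceil1000M^4\log(1/\delta)/a^2\rceil$; draw $N$ independent uniform points; for each of them average $N$ independent runs of $\mathcal A$ and square this average; output the mean of the $N$ squares. * $\textsc{Estimate-Ninf}(\mathcal A,M,U,a,\delta)$: repeat $\lceil1000(|U|!)^4M^4\log(1/\delta)/a^2\rceil$ times independently: draw $|U|$ independent uniform numbers in $[0,1]$, let $y$ be the smallest, and run $\mathrm{EstL2}$ with bound $M$, accuracy $a/(4(|U|!)^2)$ and failure parameter $a/(100M^2(|U|!)^2)$ on the algorithm which, on input $x$, draws $z\sim N^{[k']}_{\sqrt y}(x)$ and outputs $\chi_U(z)\sum_{S\subseteq U}(-1)^{|S|}2^{-|U|}\mathcal A(z^{\oplus S})$, where $z^{\oplus S}$ is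 $z$ with the coordinates in $S$ negated. Output $(|U|!)^2$ times the mean of these estimates. **Refine-Coordinates.** The input is $C\subseteq[k']$, $\varepsilon$, and a $1$-bounded randomized algorithm $\mathcal A$ for $f$. Put $\beta=\max\{|C|,k\}$, $m=\lceil10\beta k^{-2/3}\Lambda^4\rceil$, $\gamma=\lceil k^{1/3}\Lambda^3\rceil$, $\ell=\lceil k^{2/3}\Lambda^3\rceil$, $\kappa=\lceil10\Lambda\rceil$, $\Delta=10$, $M=2^{2\kappa\Delta}+1$, and $N_{\mathrm{rep}}=\lceil\exp(c\,k^{1/3}\Lambda^5)\rceil$, where $c$ is a constant. Start with $\mathcal F=\emptyset$ and repeat the following $N_{\mathrm{rep}}$ times: 1. Draw $i_1,\dots,i_m$ uniformly and independently from $C$, and set $I=\{i_1,\dots,i_m\}$ and $C'=\emptyset$. 2. Loop: (a) Let $h=f^I_{\mathrm{ave}}-\mathrm{SharpNoise}^{C\setminus C'}_{\ell,\kappa,\Delta}f^I_{\mathrm{ave}}$, and let $\mathcal A_h$ be its $M$-bounded randomized algorithm that makes one call for $f^I_{\mathrm{ave}}(x)$ and one for each $T^{C\setminus C'}_{\rho^i}f^I_{\mathrm{ave}}(x)$,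 $0\le i\le\kappa\Delta$, and combines the answers linearly. (A call for $f^I_{\mathrm{ave}}(x)$ rerandomizes the coordinates of $x$ in $I$ uniformly and runs $\mathcal A$; a call for $T^V_{\rho^i}f^I_{\mathrm{ave}}(x)$ is a call for $f^I_{\mathrm{ave}}$ at a point drawn from $N^V_{\rho^i}(x)$.) (b) Let $\hat\sigma^2=\mathrm{EstL2}(\mathcal A_h,M,\varepsilon^2/(10k^2),2^{-k'^2})$. If $\hat\sigma^2\le\varepsilon^2/k^2$, exit the loop. (c) For every $U\subseteq[k']$ with $|U|=\gamma$ compute independently $\lambda_U=\textsc{Estimate-Ninf}\bigl(\mathcal A_h,M,U,(\varepsilon/k')^{10}N_{\mathrm{rep}}^{-1}\binom{k'}{\gamma}^{-2},2^{-k'^2}\binom{k'}{\gamma}^{-1}\bigr)$, and draw $T$ among these sets with probability proportional to $\lambda_U$ ($T=\emptyset$ if all $\lambda_U$ are $0$). (d) If $T\cap C\subseteq C'$, exit the loop. Otherwise replace $C'$ by $C'\cup(T\cap C)$ and repeat the loop. 3. Add $(C',I)$ to $\mathcal F$. The output is $\mathcal F$. **Lemma.** For every sufficiently large constant $c$ there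 are constants $K,d,k_0$, depending only on $c$, such that the following holds for all $k\ge k_0$, all $k'$ and all $\varepsilon\in[2^{-k^{0.001}},1)$. Let $f:\{\pm1\}^{k'}\to[-1,1]$ satisfy $$\mathbf W^{\ge100k\log(k'/\varepsilon)}[f]\le\Bigl(\frac{\varepsilon}{k'}\Bigr)^5,$$ let $\mathcal A$ be a $1$-bounded randomized algorithm for $f$, let $R\subseteq[k']$ have size $k$, and let $C\subseteq[k']$ satisfy $C\cap\overline R\ne\emptyset$. Then with probability at least $1-3/(k')^2$, Refine-Coordinates outputs a collection $\mathcal F$ of at most $2^{k^{1/3}\cdot K\log^d(k'/\varepsilon)}$ pairs $(C',I)$, all with $C',I\subseteq C$, such that at least one pair in $\mathcal F$ satisfies $$I\subseteq\overline R,\qquad|C'\cap\overline R|\le\frac{|C\cap\overline R|}2,\qquad\text{and}\qquad\sum_{\substack{S\subseteq[k']:\\|S\cap C\setminus C'|\ge\kappa\ell}}\widehat{f^I_{\mathrm{ave}}}(S)^2\le\frac{4\varepsilon^2}{k^2}.$$ -/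

import Mathlib

open MeasureTheory ProbabilityTheory

noncomputable section

namespace JuntaTest

/-- The cube `{±1}ⁿ`. -/
abbrev Cube (n : ℕ) : Type := Fin n → ℤˣ

instance signMeasurableSingletonClass : MeasurableSingletonClass ℤˣ :=
  ⟨fun u => ⟨{(u : ℤ)}, measurableSet_singleton _, by ext v; simp [Units.ext_iff]⟩⟩

/-! ### Fourier analysis on the cube -/

/-- The character `χ_S(x) = ∏_{i ∈ S} x_i`. -/
def chi {n : ℕ} (S : Finset (Fin n)) (x : Cube n) : ℝ := ∏ i ∈ S, ((x i : ℤ) : ℝ)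

/-- The Fourier coefficient `E_x [f(x) χ_S(x)]` for uniform `x`. -/
def fourierCoef {n : ℕ} (f : Cube n → ℝ) (S : Finset (Fin n)) : ℝ :=
  (∑ x : Cube n, f x * chi S x) / 2 ^ n

/-- The Fourier weight of `f` on sets of size at least `L`, for a real threshold `L`. -/
def weightGE {n : ℕ} (f : Cube n → ℝ) (L : ℝ) : ℝ :=
  ∑ S : Finset (Fin n) with L ≤ (S.card : ℝ), fourierCoef f S ^ 2

/-- The points that agree with `x` on all the coordinates outside `I`. -/
def fiber {n : ℕ} (I : Finset (Fin n)) (x : Cube n) : Finset (Cube n) :=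
  Finset.univ.filter fun y => ∀ i, i ∉ I → y i = x i

/-- `f` averaged over the coordinates in `I`: the mean of `f(y)` for uniform `y`, conditioned on
`y` agreeing with `x` outside `I`. -/
def aveOver {n : ℕ} (I : Finset (Fin n)) (f : Cube n → ℝ) (x : Cube n) : ℝ :=
  (∑ y ∈ fiber I x, f y) / ((fiber I x).card : ℝ)

/-! ### Randomized algorithms with real outputs

A randomized algorithm `A` on the cube is given by the law `A x` of its output on each input `x`;
separate calls are independent. -/

/-- `A` is an `M`-bounded randomized algorithm for `g`: on each input `x` it outputs a random value
in `[-M, M]` with mean `g x`. -/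
structure IsBoundedRandAlg {n : ℕ} (M : ℝ) (A : Cube n → Measure ℝ) (g : Cube n → ℝ) : Prop where
  isProb : ∀ x, IsProbabilityMeasure (A x)
  bounded : ∀ x, ∀ᵐ y ∂(A x), y ∈ Set.Icc (-M) M
  mean : ∀ x, ∫ y, y ∂(A x) = g x

/-- The noise distribution: independently for each coordinate, `y_i = x_i` if `i ∉ V`; if `i ∈ V`,
then `y_i = x_i` with probability `ρ`, and `y_i` is uniform over `{±1}` with probability `1 - ρ`. -/
def noise {n : ℕ} (ρ : ℝ) (V : Finset (Fin n)) (x : Cube n) : Measure (Cube n) :=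
  Measure.pi fun i =>
    if i ∈ V then
      ENNReal.ofReal ρ • Measure.dirac (x i) + ENNReal.ofReal (1 - ρ) • uniformOn Set.univ
    else Measure.dirac (x i)

/-- Given an algorithm for `g`, the algorithm for `T_ρ^V g`: draw `y` from the noise distribution
around `x`, and run the given algorithm on `y`. -/
def algNoise {n : ℕ} (A : Cube n → Measure ℝ) (ρ : ℝ) (V : Finset (Fin n)) (x : Cube n) :
    Measure ℝ :=
  (noise ρ V x).bind A

/-- Given an algorithm for `g`, the algorithm for `g` averaged over `I`: rerandomize the coordinates
in `I` uniformly, and run the given algorithm. -/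
def algAve {n : ℕ} (A : Cube n → Measure ℝ) (I : Finset (Fin n)) (x : Cube n) : Measure ℝ :=
  (uniformOn (fiber I x : Set (Cube n))).bind A

/-- The coefficient `α_i` in `(1 - (1 - X)^κ)^Δ = ∑_i α_i X^i`, so that
`SharpNoise^V_{ℓ,κ,Δ} = ∑_{i ≤ κΔ} α_i T^V_{ρ^i}` with `ρ = 1 - 1/(2ℓ)`: this operator multiplies
the Fourier coefficient at `S` by `(1 - (1 - ρ^|S ∩ V|)^κ)^Δ`. -/
def sharpCoeff (κ Δ i : ℕ) : ℝ :=
  ((1 - (1 - Polynomial.X) ^ κ) ^ Δ : Polynomial ℝ).coeff i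

/-- Given an algorithm for `g`, the algorithm for `g - SharpNoise^V_{ℓ,κ,Δ} g`: one call for `g`,
one independent call for each `T^V_{ρ^i} g` with `0 ≤ i ≤ κΔ`, and the linear combination of the
answers. -/
def algSharpDiff {n : ℕ} (A : Cube n → Measure ℝ) (ℓ κ Δ : ℕ) (V : Finset (Fin n)) (x : Cube n) :
    Measure ℝ :=
  ((A x).prod
      (Measure.pi fun i : Fin (κ * Δ + 1) =>
        algNoise A ((1 - 1 / (2 * (ℓ : ℝ))) ^ (i : ℕ)) V x)).map
    fun z => z.1 - ∑ i : Fin (κ * Δ + 1), sharpCoeff κ Δ i * z.2 i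

/-- `x` with the coordinates in `S` negated. -/
def flip {n : ℕ} (S : Finset (Fin n)) (x : Cube n) : Cube n :=
  fun i => if i ∈ S then - x i else x i

/-- Given an algorithm for `g`, the algorithm for
`x ↦ χ_U(x) ∑_{S ⊆ U} (-1)^|S| 2^{-|U|} g(x^{⊕S}) = ∑_{S ⊇ U} ĝ(S) χ_{S ∖ U}(x)`,
with one independent call for each `S ⊆ U`. -/
def algDeriv {n : ℕ} (A : Cube n → Measure ℝ) (U : Finset (Fin n)) (x : Cube n) : Measure ℝ :=
  (Measure.pi fun S : U.powerset => A (flip S.1 x)).map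
    fun z => chi U x * ∑ S : U.powerset, (-1) ^ S.1.card / 2 ^ U.card * z S

/-! ### The two estimators -/

/-- The sample size `N = 1000 M⁴ log(1/δ) / a²`, rounded up (accuracy `a`, failure probability
`δ`). -/
def sampleSize (M a δ : ℝ) : ℕ := ⌈1000 * M ^ 4 / a ^ 2 * Real.logb 2 (1 / δ)⌉₊

/-- The law of the estimate of `E_x [g(x)²]` from an `M`-bounded randomized algorithm `A` for `g`,
with accuracy `a` and failure probability `δ`: draw `N` independent uniform points; for each of
them, average `N` independent runs of `A` and square the average; output the mean of the squares. -/
def estimateSq {n : ℕ} (M a δ : ℝ) (A : Cube n → Measure ℝ) : Measure ℝ :=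
  let N : ℕ := sampleSize M a δ
  let one : Measure ℝ :=
    (uniformOn (Set.univ : Set (Cube n))).bind fun x =>
      (Measure.pi fun _ : Fin N => A x).map fun z => ((∑ j, z j) / (N : ℝ)) ^ 2
  (Measure.pi fun _ : Fin N => one).map fun w => (∑ j, w j) / (N : ℝ)

/-- The law of the output of Estimate-Ninf, for a `B`-bounded randomized algorithm `A`, the set `U`,
accuracy `a` and failure probability `δ`. In each of `1000 (|U|!)⁴ B⁴ log(1/δ) / a²` independent
rounds (rounded up) it draws `|U|` uniform numbers in `[0,1]`, lets `y` be the smallest of them,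
and estimates `E_x [(T_{√y} g)(x)²]`, where `g` is the function computed by `algDeriv A U`; it
outputs `(|U|!)²` times the mean of these estimates. -/
def estimateNinf {n : ℕ} (B a δ : ℝ) (A : Cube n → Measure ℝ) (U : Finset (Fin n)) : Measure ℝ :=
  let u : ℝ := (U.card.factorial : ℝ)
  let M : ℕ := ⌈1000 * u ^ 4 * B ^ 4 * (Real.logb 2 (1 / δ) / a ^ 2)⌉₊
  let one : Measure ℝ :=
    (Measure.pi fun _ : Fin U.card => (volume : Measure ℝ).restrict (Set.Icc 0 1)).bind fun r =>
      estimateSq B (a / (4 * u ^ 2)) (a / (100 * B ^ 2 * u ^ 2))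
        (algNoise (algDeriv A U) (√(⨅ j, r j)) Finset.univ)
  (Measure.pi fun _ : Fin M => one).map fun w => u ^ 2 * ((∑ t, w t) / (M : ℝ))

/-- Draw a set of size `s` with probability proportional to the weights `w`. If no weight is
positive, return the empty set. -/
def pickProportional {n s : ℕ} (w : {U : Finset (Fin n) // U.card = s} → ℝ) :
    Measure (Finset (Fin n)) :=
  let total : ENNReal := ∑ U, ENNReal.ofReal (w U)
  if total = 0 then Measure.dirac ∅
  else ∑ U, (ENNReal.ofReal (w U) / total) • Measure.dirac U.1

/-! ### Refine-Coordinates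

Here `n` is the number `k'` of coordinates, and `log` is to base 2. Integer parameters are rounded
up. -/

/-- `log(k'/ε)`. -/
def logRatio (n : ℕ) (ε : ℝ) : ℝ := Real.logb 2 ((n : ℝ) / ε)

/-- `ℓ = k^{2/3} log³(k'/ε)`. -/
def paramEll (k n : ℕ) (ε : ℝ) : ℕ := ⌈(k : ℝ) ^ (2 / 3 : ℝ) * logRatio n ε ^ 3⌉₊

/-- `κ = 10 log(k'/ε)`. -/
def paramKappa (n : ℕ) (ε : ℝ) : ℕ := ⌈10 * logRatio n ε⌉₊

/-- `Δ = 10`. -/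
def paramDelta : ℕ := 10

/-- `γ = k^{1/3} log³(k'/ε)`. -/
def paramGamma (k n : ℕ) (ε : ℝ) : ℕ := ⌈(k : ℝ) ^ (1 / 3 : ℝ) * logRatio n ε ^ 3⌉₊

/-- `m = (10 β / k^{2/3}) log⁴(k'/ε)` with `β = max {|C|, k}`. -/
def paramM (k n : ℕ) (ε : ℝ) (C : Finset (Fin n)) : ℕ :=
  ⌈10 * (max C.card k : ℕ) / (k : ℝ) ^ (2 / 3 : ℝ) * logRatio n ε ^ 4⌉₊

/-- The number `exp(c k^{1/3} log⁵(k'/ε))` of repetitions of the outer loop; `c` is the constant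
hidden in `exp(O(k^{1/3} log⁵(k'/ε)))`. -/
def numReps (c : ℝ) (k n : ℕ) (ε : ℝ) : ℕ :=
  ⌈Real.exp (c * ((k : ℝ) ^ (1 / 3 : ℝ) * logRatio n ε ^ 5))⌉₊

/-- The bound `2^{2κΔ} + 1` on the outputs of the algorithm for `h`. -/
def boundH (n : ℕ) (ε : ℝ) : ℝ := 2 ^ (2 * paramKappa n ε * paramDelta) + 1

/-- The algorithm for `h = f_ave^I - SharpNoise^{C ∖ C'}_{ℓ,κ,Δ} f_ave^I`, with `V = C ∖ C'`. -/
def algH {n : ℕ} (k : ℕ) (ε : ℝ) (A : Cube n → Measure ℝ) (I V : Finset (Fin n)) :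
    Cube n → Measure ℝ :=
  algSharpDiff (algAve A I) (paramEll k n ε) (paramKappa n ε) paramDelta V

/-- The law of the estimate of `E_x [h(x)²]`, with accuracy `ε²/(10k²)` and failure probability
`2^{-k'^2}`. -/
def estimateHSq {n : ℕ} (k : ℕ) (ε : ℝ) (H : Cube n → Measure ℝ) : Measure ℝ :=
  estimateSq (boundH n ε) (ε ^ 2 / (10 * (k : ℝ) ^ 2)) (((2 : ℝ) ^ (n ^ 2))⁻¹) H

/-- The law of the set `T`: for every `U` of size `γ` an independent call of Estimate-Ninf on `h`
gives `λ_U`, and then `U` is drawn with probability proportional to `λ_U`. The accuracy of the calls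
is `(ε/k')^10 · (number of repetitions)⁻¹ · (k' choose γ)⁻²`, and their failure probability is
`2^{-k'^2} (k' choose γ)⁻¹`. -/
def sampleT {n : ℕ} (c : ℝ) (k : ℕ) (ε : ℝ) (H : Cube n → Measure ℝ) :
    Measure (Finset (Fin n)) :=
  let γ : ℕ := paramGamma k n ε
  let a : ℝ :=
    (ε / (n : ℝ)) ^ 10 * ((numReps c k n ε : ℝ))⁻¹ * (((n.choose γ : ℕ) : ℝ) ^ 2)⁻¹
  let δ : ℝ := ((2 : ℝ) ^ (n ^ 2))⁻¹ * ((n.choose γ : ℕ) : ℝ)⁻¹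
  (Measure.pi fun U : {U : Finset (Fin n) // U.card = γ} =>
    estimateNinf (boundH n ε) a δ H U.1).bind pickProportional

/-- The inner loop, started from the set `C'` (written `D`); the result is the law of the set `C'`
on exit. -/
def innerLoop {n : ℕ} (c : ℝ) (k : ℕ) (ε : ℝ) (A : Cube n → Measure ℝ) (C I : Finset (Fin n))
    (D : Finset (Fin n)) : Measure (Finset (Fin n)) :=
  (estimateHSq k ε (algH k ε A I (C \ D))).bind fun σ =>
    if σ ≤ ε ^ 2 / (k : ℝ) ^ 2 then Measure.dirac D
    else
      (sampleT c k ε (algH k ε A I (C \ D))).bind fun T =>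
        if _h : T ∩ C ⊆ D then Measure.dirac D
        else innerLoop c k ε A C I (D ∪ (T ∩ C))
termination_by (C \ D).card
decreasing_by
  apply Finset.card_lt_card
  obtain ⟨a, ha, hD⟩ := Finset.not_subset.mp _h
  refine (Finset.ssubset_iff_of_subset ?_).mpr ⟨a, ?_, ?_⟩
  · exact Finset.sdiff_subset_sdiff (Finset.Subset.refl C) Finset.subset_union_left
  · exact Finset.mem_sdiff.mpr ⟨(Finset.mem_inter.mp ha).2, hD⟩
  · intro hmem
    exact (Finset.mem_sdiff.mp hmem).2 (Finset.mem_union_right _ ha)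

/-- One repetition of the outer loop: draw `i_1, …, i_m` independently and uniformly from `C`, let
`I` be the set of the drawn coordinates, and run the inner loop from the empty set. The result is
the law of the pair `(C', I)`. -/
def oneRep {n : ℕ} (c : ℝ) (k : ℕ) (ε : ℝ) (A : Cube n → Measure ℝ) (C : Finset (Fin n)) :
    Measure (Finset (Fin n) × Finset (Fin n)) :=
  (Measure.pi fun _ : Fin (paramM k n ε C) => uniformOn (C : Set (Fin n))).bind fun i =>
    (innerLoop c k ε A C (Finset.univ.image i) ∅).map fun D => (D, Finset.univ.image i)

/-- The law of the collection of pairs that Refine-Coordinates outputs. -/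
def refineCoordinates {n : ℕ} (c : ℝ) (k : ℕ) (ε : ℝ) (A : Cube n → Measure ℝ)
    (C : Finset (Fin n)) : Measure (Finset (Finset (Fin n) × Finset (Fin n))) :=
  (Measure.pi fun _ : Fin (numReps c k n ε) => oneRep c k ε A C).map
    fun w => Finset.univ.image w

end JuntaTest

end

open JuntaTest

namespace JuntaTest

/-! ### Fourier expansion on the cube -/

section Fourier

variable {n : ℕ}

/-! Write n for k', Λ = log(n/ε), x = ε/n, τ = ε²/k², Q = C ∩ Rᶜ, V = C ∖ C', β = max(|C|, k) and t
= k^{2/3}|Q|/β (`hitThreshold`). It suffices that one repetition finds a good pair with probability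
at least ¼·exp(-42 k^{1/3}Λ⁵) (`oneRep_good`): exp(c k^{1/3}Λ⁵) independent repetitions then rarely
all fail (`pow_numReps_le`), and there are at most as many pairs as repetitions.

The set I. All m draws miss R with probability p = (|Q|/|C|)^m, bounded below in `draws_prob_ge`.
For a fixed S with |S ∩ Q| ≥ t, draws that land in Q all avoid S with conditional probability at
most exp(-mt/|Q|) ≤ exp(-10Λ⁴). Averaging over I kills the coefficient of every set that meets I, so
by Markov, with probability at least p/2, I ⊆ Rᶜ and the surviving weight on such S is at most x⁵
(`draws_good`).

The inner loop for such an I. The operator 1 - SharpNoise is diagonal in the characters; its factor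
is tiny when |S ∩ V| ≤ ℓ and has square at least 1/2 when |S ∩ V| ≥ κℓ. So a small norm of h
certifies the required tail bound (`tailWeight_le`), while a norm that is not small is carried, up
to 3x⁵, by sets S with |S ∩ V| ≥ ℓ, |S| < 100kΛ and |S ∩ Q| < t (`sum_bad_residual_le`). The
normalized influences spread each squared coefficient of h evenly over the γ-subsets of S, so T is
close to a uniform γ-subset of a set S drawn with probability proportional to its squared
coefficient (`sum_ninf_mul`, `lintegral_sampleT_le`). For well placed S, such a T rarely misses V,
and it collects new elements of Q and of C ∩ R in an expected ratio of at most t to ℓ - t. Since |C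
∩ R| ≤ k ≤ β and t/(ℓ - t) ≤ |Q|/(1000β), only a small fraction of Q is collected on average.

This is a supermartingale argument, run as an induction on |C ∖ C'|
(`lintegral_innerLoop_exitCost_le`). The exit cost is 2|C' ∩ Q|/|Q|, plus 1 if the tail is too
heavy. It is at least 1 on every bad exit and its expectation is at most 1/4, so the loop succeeds
with probability at least 3/4 (`innerLoop_good`).

The estimators enter only through their mean absolute errors, which come from variances; no
exponential concentration is needed. Each step loses O(1/n), and there are at most |C| + 1 steps. -/

lemma sign_sq (u : ℤˣ) : ((u : ℤ) : ℝ) * ((u : ℤ) : ℝ) = 1 := by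
  rcases Int.units_eq_one_or u with rfl | rfl <;> simp

lemma chi_mul_self (S : Finset (Fin n)) (x : Cube n) : chi S x * chi S x = 1 := by
  rw [chi, ← Finset.prod_mul_distrib]
  exact Finset.prod_eq_one fun i _ => sign_sq _

lemma abs_chi (S : Finset (Fin n)) (x : Cube n) : |chi S x| = 1 := by
  have h := chi_mul_self S x
  rcases mul_self_eq_one_iff.mp h with h | h <;> simp [h]

/-- The sum over all sets expands ∏(1 + x_i y_i), which vanishes once a single coordinate differs.
Fourier inversion follows directly from this dual orthogonality. -/
lemma sum_chi_mul_chi (x y : Cube n) :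
    ∑ S, chi S x * chi S y = if x = y then (2 : ℝ) ^ n else 0 := by
  have h : ∑ S, chi S x * chi S y = ∏ i, (1 + ((x i : ℤ) : ℝ) * ((y i : ℤ) : ℝ)) := by
    rw [Finset.prod_one_add, Finset.powerset_univ]
    simp only [chi, Finset.prod_mul_distrib]
  rw [h]
  split_ifs with hxy
  · subst hxy
    simp only [sign_sq]
    norm_num
  · obtain ⟨i, hi⟩ := Function.ne_iff.mp hxy
    refine Finset.prod_eq_zero (Finset.mem_univ i) ?_
    rcases Int.units_eq_one_or (x i) with h1 | h1 <;>
      rcases Int.units_eq_one_or (y i) with h2 | h2 <;> simp_all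

/-- The cube has `2 ^ n` points. -/
lemma card_cube : Fintype.card (Cube n) = 2 ^ n := by
  simp [Cube]

lemma fourier_inversion (f : Cube n → ℝ) (x : Cube n) :
    f x = ∑ S, fourierCoef f S * chi S x := by
  have h : ∑ S, fourierCoef f S * chi S x = (∑ y, f y * ∑ S, chi S y * chi S x) / 2 ^ n := by
    simp only [fourierCoef, Finset.mul_sum, Finset.sum_div, div_mul_eq_mul_div, Finset.sum_mul]
    rw [Finset.sum_comm]
    simp only [mul_assoc]
  rw [h]
  simp [sum_chi_mul_chi]

/-- Negating one coordinate of S permutes the cube and flips the sign of the character. -/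
lemma sum_chi_of_nonempty {S : Finset (Fin n)} (hS : S.Nonempty) : ∑ x, chi S x = 0 := by
  obtain ⟨i, hi⟩ := hS
  have h : ∑ x, chi S x = ∑ x, -chi S x := by
    refine Fintype.sum_equiv (Equiv.mulRight (Function.update 1 i (-1) : Cube n)) _ _ fun x => ?_
    simp only [chi, Equiv.coe_mulRight, Pi.mul_apply, Units.val_mul, Int.cast_mul,
      Finset.prod_mul_distrib]
    have : ∏ j ∈ S, (((Function.update (1 : Cube n) i (-1) j : ℤˣ) : ℤ) : ℝ) = -1 := by
      rw [Finset.prod_eq_single_of_mem i hi]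
      · simp
      · intro j _ hj
        simp [hj]
    rw [this]
    ring
  rw [Finset.sum_neg_distrib] at h
  linarith

lemma chi_mul_chi (S T : Finset (Fin n)) (x : Cube n) :
    chi S x * chi T x = chi (symmDiff S T) x := by
  have h1 : chi S x = chi (S \ T) x * chi (S ∩ T) x := by
    rw [chi, chi, chi, ← Finset.prod_union (Finset.disjoint_sdiff_inter S T),
      Finset.sdiff_union_inter]
  have h2 : chi T x = chi (T \ S) x * chi (S ∩ T) x := by
    rw [Finset.inter_comm, chi, chi, chi, ← Finset.prod_union (Finset.disjoint_sdiff_inter T S),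
      Finset.sdiff_union_inter]
  have h3 : chi (symmDiff S T) x = chi (S \ T) x * chi (T \ S) x := by
    rw [symmDiff_def, Finset.sup_eq_union, chi, chi, chi, Finset.prod_union disjoint_sdiff_sdiff]
  have h4 := chi_mul_self (S ∩ T) x
  rw [h1, h2, h3]
  linear_combination chi (S \ T) x * chi (T \ S) x * h4

lemma fourierCoef_chi (S T : Finset (Fin n)) :
    fourierCoef (chi S) T = if S = T then 1 else 0 := by
  have h2 : (2 : ℝ) ^ n ≠ 0 := by positivity
  simp only [fourierCoef, chi_mul_chi]
  split_ifs with h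
  · subst h
    simp [chi, Fintype.card_pi]
  · rw [sum_chi_of_nonempty, zero_div]
    rw [Finset.nonempty_iff_ne_empty]
    exact fun h' => h (symmDiff_eq_bot.mp h')

lemma fourierCoef_sum {ι : Type*} (s : Finset ι) (a : ι → ℝ) (f : ι → Cube n → ℝ)
    (T : Finset (Fin n)) :
    fourierCoef (fun x => ∑ i ∈ s, a i * f i x) T = ∑ i ∈ s, a i * fourierCoef (f i) T := by
  simp only [fourierCoef, Finset.sum_mul, mul_div_assoc', Finset.mul_sum]
  rw [← Finset.sum_div, Finset.sum_comm]
  simp only [mul_assoc]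

/-- The coefficients of an explicit expansion in characters. -/
lemma fourierCoef_of_expansion {f : Cube n → ℝ} {a : Finset (Fin n) → ℝ}
    (h : ∀ x, f x = ∑ S, a S * chi S x) (T : Finset (Fin n)) : fourierCoef f T = a T := by
  have : f = fun x => ∑ S, a S * chi S x := funext h
  rw [this, fourierCoef_sum]
  simp [fourierCoef_chi]

/-- Parseval's identity. -/
lemma parseval (f : Cube n → ℝ) :
    (∑ x, f x ^ 2) / 2 ^ n = ∑ S, fourierCoef f S ^ 2 := by
  have h : ∑ x, f x ^ 2 = ∑ x, ∑ S, fourierCoef f S * (f x * chi S x) := by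
    refine Finset.sum_congr rfl fun x _ => ?_
    rw [sq]
    nth_rewrite 2 [fourier_inversion f x]
    rw [Finset.mul_sum]
    exact Finset.sum_congr rfl fun S _ => by ring
  rw [h, Finset.sum_comm, Finset.sum_div]
  refine Finset.sum_congr rfl fun S _ => ?_
  rw [← Finset.mul_sum, sq, mul_div_assoc, fourierCoef]

lemma sum_fourierCoef_sq_le_one {f : Cube n → ℝ} (hf : ∀ x, f x ∈ Set.Icc (-1 : ℝ) 1) :
    ∑ S, fourierCoef f S ^ 2 ≤ 1 := by
  rw [← parseval, div_le_one (by positivity)]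
  calc ∑ x, f x ^ 2 ≤ ∑ _x : Cube n, (1 : ℝ) :=
        Finset.sum_le_sum fun x _ => by nlinarith [(hf x).1, (hf x).2]
    _ = 2 ^ n := by simp [Fintype.card_pi]

/-! ### Operators that are diagonal in the characters -/

/-- A signed kernel that multiplies every character by a scalar multiplies every function in the
Fourier basis. -/
lemma sum_kernel_mul_eq {w : Cube n → Cube n → ℝ} {a : Finset (Fin n) → ℝ}
    (h : ∀ S x, ∑ y, w x y * chi S y = a S * chi S x) (f : Cube n → ℝ) (x : Cube n) :
    ∑ y, w x y * f y = ∑ S, (a S * fourierCoef f S) * chi S x := by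
  calc ∑ y, w x y * f y = ∑ y, ∑ S, fourierCoef f S * (w x y * chi S y) := by
        refine Finset.sum_congr rfl fun y _ => ?_
        rw [fourier_inversion f y, Finset.mul_sum]
        exact Finset.sum_congr rfl fun S _ => by ring
    _ = ∑ S, (a S * fourierCoef f S) * chi S x := by
        rw [Finset.sum_comm]
        refine Finset.sum_congr rfl fun S _ => ?_
        rw [← Finset.mul_sum, h]
        ring

lemma mem_fiber {I : Finset (Fin n)} {x y : Cube n} :
    y ∈ fiber I x ↔ ∀ i, i ∉ I → y i = x i := by
  simp [fiber]

lemma fiber_nonempty (I : Finset (Fin n)) (x : Cube n) : (fiber I x).Nonempty :=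
  ⟨x, mem_fiber.mpr fun _ _ => rfl⟩

/-- If S meets I, negating a common coordinate permutes the fiber and flips the sign of the
character; otherwise the character is constant on the fiber. -/
lemma aveOver_chi (I S : Finset (Fin n)) (x : Cube n) :
    aveOver I (chi S) x = (if Disjoint S I then 1 else 0) * chi S x := by
  have hc : ((fiber I x).card : ℝ) ≠ 0 := by
    exact_mod_cast (Finset.card_pos.mpr (fiber_nonempty I x)).ne'
  rw [aveOver]
  split_ifs with h
  · have : ∀ y ∈ fiber I x, chi S y = chi S x := fun y hy =>
      Finset.prod_congr rfl fun i hi => by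
        rw [mem_fiber.mp hy i (Finset.disjoint_left.mp h hi)]
    rw [Finset.sum_congr rfl this, Finset.sum_const, nsmul_eq_mul]
    field_simp
  · obtain ⟨i, hiS, hiI⟩ := Finset.not_disjoint_iff.mp h
    have key : ∑ y ∈ fiber I x, chi S y = ∑ y ∈ fiber I x, -chi S y := by
      refine Finset.sum_nbij' (fun y => y * Function.update (1 : Cube n) i (-1))
        (fun y => y * Function.update (1 : Cube n) i (-1)) ?_ ?_ ?_ ?_ ?_
      · intro y hy
        refine mem_fiber.mpr fun j hj => ?_
        have : j ≠ i := fun h => hj (h ▸ hiI)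
        simp [this, mem_fiber.mp hy j hj]
      · intro y hy
        refine mem_fiber.mpr fun j hj => ?_
        have : j ≠ i := fun h => hj (h ▸ hiI)
        simp [this, mem_fiber.mp hy j hj]
      · intro y _
        ext j
        by_cases hj : j = i <;> simp [hj]
      · intro y _
        ext j
        by_cases hj : j = i <;> simp [hj]
      · intro y _
        simp only [chi, Pi.mul_apply, Units.val_mul, Int.cast_mul, Finset.prod_mul_distrib]
        have : ∏ j ∈ S, (((Function.update (1 : Cube n) i (-1) j : ℤˣ) : ℤ) : ℝ) = -1 := by
          rw [Finset.prod_eq_single_of_mem i hiS]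
          · simp
          · intro j _ hj
            simp [hj]
        rw [this]
        ring
    rw [Finset.sum_neg_distrib] at key
    have : ∑ y ∈ fiber I x, chi S y = 0 := by linarith
    rw [this]
    simp

lemma fourierCoef_aveOver (I : Finset (Fin n)) (f : Cube n → ℝ) (S : Finset (Fin n)) :
    fourierCoef (aveOver I f) S = (if Disjoint S I then 1 else 0) * fourierCoef f S := by
  set w : Cube n → Cube n → ℝ := fun x y => if y ∈ fiber I x then ((fiber I x).card : ℝ)⁻¹ else 0
  have hw : ∀ (g : Cube n → ℝ) x, ∑ y, w x y * g y = aveOver I g x := fun g x => by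
    simp only [w, aveOver, ite_mul, zero_mul, Finset.sum_ite_mem, Finset.univ_inter, Finset.sum_div]
    exact Finset.sum_congr rfl fun y _ => by rw [div_eq_inv_mul]
  refine fourierCoef_of_expansion
    (a := fun S => (if Disjoint S I then 1 else 0) * fourierCoef f S) (fun x => ?_) S
  rw [← hw f x]
  exact sum_kernel_mul_eq (fun S x => by rw [hw, aveOver_chi]) f x

lemma chi_flip (S W : Finset (Fin n)) (x : Cube n) :
    chi W (flip S x) = (∏ i ∈ S, if i ∈ W then -1 else 1) * chi W x := by
  have h1 : ∀ i, (((flip S x i : ℤˣ) : ℤ) : ℝ) = (if i ∈ S then -1 else 1) * ((x i : ℤ) : ℝ) := by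
    intro i
    by_cases h : i ∈ S <;> simp [flip, h]
  simp only [chi, h1, Finset.prod_mul_distrib]
  congr 1
  rw [Finset.prod_ite_mem, Finset.prod_ite_mem, Finset.inter_comm]

/-- The function computed by `algDeriv`. -/
noncomputable def deriv (U : Finset (Fin n)) (g : Cube n → ℝ) (x : Cube n) : ℝ :=
  chi U x * ∑ S : U.powerset, (-1) ^ S.1.card / 2 ^ U.card * g (flip S.1 x)

/-- The signed sum factors over U into ∏(1 ± 1), with the plus sign exactly for i ∈ W, so a single
element of U outside W annihilates it. -/
lemma deriv_chi (U W : Finset (Fin n)) (x : Cube n) :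
    deriv U (chi W) x = if U ⊆ W then chi (W \ U) x else 0 := by
  have h1 : ∑ S : U.powerset, (-1 : ℝ) ^ S.1.card / 2 ^ U.card * chi W (flip S.1 x)
      = (∏ i ∈ U, (1 + (if i ∈ W then (1 : ℝ) else -1))) / 2 ^ U.card * chi W x := by
    rw [Finset.prod_one_add, Finset.sum_div, Finset.sum_mul]
    rw [Finset.sum_coe_sort U.powerset
      (fun S => (-1 : ℝ) ^ S.card / 2 ^ U.card * chi W (flip S x))]
    refine Finset.sum_congr rfl fun S _ => ?_
    rw [chi_flip, ← Finset.prod_const, div_mul_eq_mul_div, ← mul_assoc, ← Finset.prod_mul_distrib,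
      div_mul_eq_mul_div]
    congr 3
    funext i
    split_ifs <;> norm_num
  rw [deriv, h1]
  split_ifs with h
  · rw [Finset.prod_congr rfl fun i hi => by rw [if_pos (h hi)], Finset.prod_const]
    norm_num
    rw [chi_mul_chi]
    congr 1
    ext i
    simp only [Finset.mem_symmDiff, Finset.mem_sdiff]
    have := @h i
    tauto
  · obtain ⟨i, hiU, hiW⟩ := Finset.not_subset.mp h
    rw [Finset.prod_eq_zero hiU (by simp [hiW])]
    simp

lemma fourierCoef_deriv (U : Finset (Fin n)) (g : Cube n → ℝ) (T : Finset (Fin n)) :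
    fourierCoef (deriv U g) T = if Disjoint T U then fourierCoef g (T ∪ U) else 0 := by
  have hlin : deriv U g = fun x => ∑ W, fourierCoef g W * deriv U (chi W) x := by
    funext x
    simp only [deriv]
    rw [Finset.sum_congr rfl fun (S : {x // x ∈ U.powerset}) _ => by
      rw [fourier_inversion g (flip S.1 x)]]
    simp only [Finset.mul_sum]
    rw [Finset.sum_comm]
    exact Finset.sum_congr rfl fun W _ => Finset.sum_congr rfl fun S _ => by ring
  rw [hlin, fourierCoef_sum]
  have h1 : ∀ W, fourierCoef (deriv U (chi W)) T = if U ⊆ W ∧ W \ U = T then 1 else 0 := by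
    intro W
    have : deriv U (chi W) = fun x => ∑ i ∈ ({()} : Finset Unit),
        (if U ⊆ W then (1 : ℝ) else 0) * chi (W \ U) x := by
      funext x
      rw [deriv_chi]
      split_ifs <;> simp
    rw [this, fourierCoef_sum _ (fun _ => (if U ⊆ W then (1 : ℝ) else 0)) (fun _ => chi (W \ U))]
    simp only [Finset.sum_singleton, fourierCoef_chi]
    split_ifs <;> simp_all
  simp only [h1, mul_ite, mul_one, mul_zero]
  split_ifs with h
  · rw [Finset.sum_eq_single_of_mem (T ∪ U) (Finset.mem_univ _)]
    · rw [if_pos]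
      exact ⟨Finset.subset_union_right, Finset.union_sdiff_cancel_right h⟩
    · intro W _ hW
      rw [if_neg]
      rintro ⟨h1, h2⟩
      exact hW (by rw [← h2, Finset.sdiff_union_of_subset h1])
  · refine Finset.sum_eq_zero fun W _ => ?_
    rw [if_neg]
    rintro ⟨_, h2⟩
    exact h (h2 ▸ Finset.sdiff_disjoint)

end Fourier

/-! ### Laws of bounded random variables -/

/-- `ν` is the law of a random variable with values in `[-M, M]` and mean `g`. -/
structure BoundedLaw (M : ℝ) (ν : Measure ℝ) (g : ℝ) : Prop where
  isProb : IsProbabilityMeasure ν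
  bounded : ∀ᵐ y ∂ν, y ∈ Set.Icc (-M) M
  mean : ∫ y, y ∂ν = g

lemma IsBoundedRandAlg.law {n : ℕ} {M : ℝ} {A : Cube n → Measure ℝ} {g : Cube n → ℝ}
    (h : IsBoundedRandAlg M A g) (x : Cube n) : BoundedLaw M (A x) (g x) :=
  ⟨h.isProb x, h.bounded x, h.mean x⟩

lemma ae_map_mem_Icc {Ω : Type*} [MeasurableSpace Ω] {P : Measure Ω} {F : Ω → ℝ}
    (hF : Measurable F) {a b : ℝ} :
    (∀ᵐ y ∂P.map F, y ∈ Set.Icc a b) ↔ ∀ᵐ ω ∂P, F ω ∈ Set.Icc a b :=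
  ae_map_iff hF.aemeasurable (p := fun y => y ∈ Set.Icc a b) measurableSet_Icc

namespace BoundedLaw

variable {M g : ℝ} {ν : Measure ℝ}

lemma mono (h : BoundedLaw M ν g) {M' : ℝ} (hM : M ≤ M') : BoundedLaw M' ν g :=
  ⟨h.isProb, h.bounded.mono fun _ hy => ⟨by linarith [hy.1], hy.2.trans hM⟩, h.mean⟩

lemma norm_le (h : BoundedLaw M ν g) : ∀ᵐ y ∂ν, ‖y‖ ≤ M :=
  h.bounded.mono fun _ hy => by rw [Real.norm_eq_abs, abs_le]; exact hy

lemma memLp (h : BoundedLaw M ν g) (p : ENNReal) : MemLp (fun y : ℝ => y) p ν :=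
  have := h.isProb
  MemLp.of_bound measurable_id'.aestronglyMeasurable M h.norm_le

lemma integrable (h : BoundedLaw M ν g) : Integrable (fun y : ℝ => y) ν :=
  memLp_one_iff_integrable.mp (h.memLp 1)

lemma nonneg (h : BoundedLaw M ν g) : 0 ≤ M := by
  have := h.isProb
  obtain ⟨y, hy⟩ := h.norm_le.exists
  exact (norm_nonneg y).trans hy

lemma abs_mean_le (h : BoundedLaw M ν g) : |g| ≤ M := by
  have := h.isProb
  rw [← h.mean, ← Real.norm_eq_abs]
  simpa using norm_integral_le_of_norm_le_const h.norm_le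

/-- Adding `M` makes the integrand nonnegative. The mean is then encoded in a Lebesgue integral,
which passes through `bind` with no integrability condition; `of_lintegral_add` decodes it. -/
lemma lintegral_add (h : BoundedLaw M ν g) :
    ∫⁻ y, ENNReal.ofReal (y + M) ∂ν = ENNReal.ofReal (g + M) := by
  have := h.isProb
  rw [← ofReal_integral_eq_lintegral_ofReal (f := fun y => y + M)
    (h.integrable.add (integrable_const M))]
  · rw [integral_add h.integrable (integrable_const M), h.mean]
    simp
  · exact h.bounded.mono fun y hy => by simpa using by linarith [hy.1]

lemma of_lintegral_add (h1 : IsProbabilityMeasure ν) (h2 : ∀ᵐ y ∂ν, y ∈ Set.Icc (-M) M)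
    (h3 : ∫⁻ y, ENNReal.ofReal (y + M) ∂ν = ENNReal.ofReal (g + M)) (hg : -M ≤ g) :
    BoundedLaw M ν g := by
  have h : BoundedLaw M ν (∫ y, y ∂ν) := ⟨h1, h2, rfl⟩
  have h4 := h.lintegral_add
  rw [h3, ENNReal.ofReal_eq_ofReal_iff (by linarith)
    (by linarith [(abs_le.mp h.abs_mean_le).1])] at h4
  have : g = ∫ y, y ∂ν := by linarith
  rw [this]
  exact h

variable {Ω : Type*} [MeasurableSpace Ω] {P : Measure Ω}

lemma isProb_bind {β : Type*} [MeasurableSpace β] [IsProbabilityMeasure P] {κ : Ω → Measure β}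
    (hκ : AEMeasurable κ P) (h : ∀ᵐ ω ∂P, IsProbabilityMeasure (κ ω)) :
    IsProbabilityMeasure (P.bind κ) := by
  constructor
  rw [Measure.bind_apply MeasurableSet.univ hκ, lintegral_congr_ae (g := fun _ => 1)]
  · simp
  · exact h.mono fun ω hω => measure_univ

lemma integrable_mean [IsProbabilityMeasure P] {κ : Ω → Measure ℝ} (hκ : AEMeasurable κ P)
    {G : Ω → ℝ} (h : ∀ᵐ ω ∂P, BoundedLaw M (κ ω) (G ω)) : Integrable G P := by
  -- Measurability of `G` is recovered from that of `κ`, since `G + M` is the Lebesgue integral of y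
  -- + M against `κ`.
  have hm : AEMeasurable (fun ω => ∫⁻ y, ENNReal.ofReal (y + M) ∂κ ω) P :=
    (Measure.measurable_lintegral (by fun_prop)).comp_aemeasurable hκ
  have hG : AEMeasurable G P := by
    refine (hm.ennreal_toReal.sub_const M).congr ?_
    filter_upwards [h] with ω hω
    rw [hω.lintegral_add, ENNReal.toReal_ofReal (by linarith [(abs_le.mp hω.abs_mean_le).1])]
    ring
  refine Integrable.of_bound hG.aestronglyMeasurable M ?_
  exact h.mono fun ω hω => hω.abs_mean_le

/-- The mixture of bounded laws. -/
lemma bind [IsProbabilityMeasure P] {κ : Ω → Measure ℝ} (hκ : AEMeasurable κ P) {G : Ω → ℝ}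
    (h : ∀ᵐ ω ∂P, BoundedLaw M (κ ω) (G ω)) :
    BoundedLaw M (P.bind κ) (∫ ω, G ω ∂P) := by
  have hGi := integrable_mean hκ h
  have hGM : -M ≤ ∫ ω, G ω ∂P := by
    have := integral_mono_ae (integrable_const (-M)) hGi
      (h.mono fun ω hω => (abs_le.mp hω.abs_mean_le).1)
    simpa using this
  refine of_lintegral_add (isProb_bind hκ (h.mono fun ω hω => hω.isProb)) ?_ ?_ hGM
  · rw [ae_iff]
    have hs : MeasurableSet {a : ℝ | ¬a ∈ Set.Icc (-M) M} := measurableSet_Icc.compl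
    rw [Measure.bind_apply hs hκ, lintegral_congr_ae (g := fun _ => 0)]
    · simp
    · filter_upwards [h] with ω hω
      exact ae_iff.mp hω.bounded
  · rw [Measure.lintegral_bind hκ (by fun_prop), lintegral_congr_ae
      (g := fun ω => ENNReal.ofReal (G ω + M)) (h.mono fun ω hω => hω.lintegral_add),
      ← ofReal_integral_eq_lintegral_ofReal (f := fun ω => G ω + M)
        (hGi.add (integrable_const M)),
      integral_add hGi (integrable_const M)]
    · simp
    · exact h.mono fun ω hω => by
        simpa using by linarith [(abs_le.mp hω.abs_mean_le).1]

/-- The law of `X - Y` for independent bounded `X` and `Y`. -/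
lemma prod_sub {M₁ M₂ g₁ g₂ : ℝ} {μ : Measure ℝ} [IsProbabilityMeasure P] {F : Ω → ℝ}
    (hF : Measurable F) (h₁ : BoundedLaw M₁ μ g₁) (h₂ : BoundedLaw M₂ (P.map F) g₂) :
    BoundedLaw (M₁ + M₂) ((μ.prod P).map fun z => z.1 - F z.2) (g₁ - g₂) := by
  have := h₁.isProb
  have hm : Measurable fun z : ℝ × Ω => z.1 - F z.2 := by fun_prop
  have hq1 : Measure.QuasiMeasurePreserving (Prod.fst : ℝ × Ω → ℝ) (μ.prod P) μ :=
    Measure.quasiMeasurePreserving_fst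
  have hq2 : Measure.QuasiMeasurePreserving (Prod.snd : ℝ × Ω → Ω) (μ.prod P) P :=
    Measure.quasiMeasurePreserving_snd
  have hb : ∀ᵐ ω ∂P, F ω ∈ Set.Icc (-M₂) M₂ := (ae_map_mem_Icc hF).mp h₂.bounded
  have hFi : Integrable F P :=
    (integrable_map_measure measurable_id'.aestronglyMeasurable hF.aemeasurable).mp h₂.integrable
  refine ⟨Measure.isProbabilityMeasure_map hm.aemeasurable, ?_, ?_⟩
  · rw [ae_map_mem_Icc hm]
    filter_upwards [hq1.ae h₁.bounded, hq2.ae hb] with z hz1 hz2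
    exact ⟨by linarith [hz1.1, hz2.2], by linarith [hz1.2, hz2.1]⟩
  · rw [integral_map hm.aemeasurable measurable_id'.aestronglyMeasurable,
      integral_sub (h₁.integrable.comp_fst P) (hFi.comp_snd μ)]
    have e1 : ∫ z, z.1 ∂(μ.prod P) = g₁ := by
      rw [integral_fun_fst (fun y : ℝ => y), h₁.mean]; simp
    have e2 : ∫ z, F z.2 ∂(μ.prod P) = g₂ := by
      rw [integral_fun_snd F, ← h₂.mean, integral_map hF.aemeasurable
        measurable_id'.aestronglyMeasurable]; simp
    rw [e1, e2]

/-- The law of a linear combination of independent bounded random variables. -/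
lemma pi_sum {ι : Type*} [Fintype ι] {ν : ι → Measure ℝ} {M g : ι → ℝ} (c : ι → ℝ)
    (h : ∀ i, BoundedLaw (M i) (ν i) (g i)) :
    BoundedLaw (∑ i, |c i| * M i) ((Measure.pi ν).map fun z => ∑ i, c i * z i)
      (∑ i, c i * g i) := by
  have := fun i => (h i).isProb
  have hm : Measurable fun z : ι → ℝ => ∑ i, c i * z i := by fun_prop
  have hmp := fun i => measurePreserving_eval ν i
  refine ⟨Measure.isProbabilityMeasure_map hm.aemeasurable, ?_, ?_⟩
  · rw [ae_map_mem_Icc hm]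
    have hb : ∀ᵐ z ∂Measure.pi ν, ∀ i, ‖z i‖ ≤ M i :=
      ae_all_iff.mpr fun i => (hmp i).quasiMeasurePreserving.ae (h i).norm_le
    filter_upwards [hb] with z hz
    rw [Set.mem_Icc, ← abs_le]
    refine (Finset.abs_sum_le_sum_abs _ _).trans (Finset.sum_le_sum fun i _ => ?_)
    rw [abs_mul]
    exact mul_le_mul_of_nonneg_left (hz i) (abs_nonneg _)
  · rw [integral_map hm.aemeasurable measurable_id'.aestronglyMeasurable, integral_finsetSum]
    · refine Finset.sum_congr rfl fun i _ => ?_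
      rw [integral_const_mul, integral_comp_eval (μ := ν) (i := i) (f := fun y : ℝ => y)
        measurable_id'.aestronglyMeasurable, (h i).mean]
    · intro i _
      exact ((hmp i).integrable_comp_of_integrable (h i).integrable).const_mul _

/-- The law of the mean of `N` independent samples. -/
noncomputable def avg (N : ℕ) (ν : Measure ℝ) : Measure ℝ :=
  (Measure.pi fun _ : Fin N => ν).map fun z => (∑ j, z j) / (N : ℝ)

lemma avg_law (h : BoundedLaw M ν g) {N : ℕ} (hN : N ≠ 0) : BoundedLaw M (avg N ν) g := by
  have hN' : (N : ℝ) ≠ 0 := by exact_mod_cast hN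
  have := pi_sum (fun _ : Fin N => (N : ℝ)⁻¹) (fun _ => h)
  simp only [Finset.sum_const, Finset.card_univ, Fintype.card_fin, nsmul_eq_mul, abs_inv,
    Nat.abs_cast, mul_inv_cancel_left₀ hN'] at this
  convert this using 2
  rw [avg]
  congr 1
  funext z
  rw [Finset.sum_div]
  simp only [div_eq_inv_mul]

lemma variance_le (h : BoundedLaw M ν g) : Var[fun y : ℝ => y; ν] ≤ M ^ 2 := by
  have := h.isProb
  refine (variance_le_sq_of_bounded h.bounded measurable_id'.aemeasurable).trans_eq ?_
  ring

lemma avg_variance (h : BoundedLaw M ν g) {N : ℕ} (hN : N ≠ 0) :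
    Var[fun y : ℝ => y; avg N ν] ≤ M ^ 2 / N := by
  have := h.isProb
  have hN' : (0 : ℝ) < N := by exact_mod_cast Nat.pos_of_ne_zero hN
  have hm : Measurable fun z : Fin N → ℝ => (∑ j, z j) / (N : ℝ) := by fun_prop
  rw [avg, variance_map measurable_id'.aemeasurable hm.aemeasurable]
  have e : ((fun y : ℝ => y) ∘ fun z : Fin N → ℝ => (∑ j, z j) / (N : ℝ))
      = ∑ j : Fin N, fun z => (fun y : ℝ => (N : ℝ)⁻¹ * y) (z j) := by
    funext z
    simp only [Function.comp, Finset.sum_apply, div_eq_inv_mul, Finset.mul_sum]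
  rw [e, variance_sum_pi (X := fun _ : Fin N => fun y : ℝ => (N : ℝ)⁻¹ * y)
    (fun j => (h.memLp 2).const_mul _)]
  rw [Finset.sum_const, Finset.card_univ, Fintype.card_fin, nsmul_eq_mul,
    variance_const_mul (N : ℝ)⁻¹ (fun y : ℝ => y) ν]
  have := h.variance_le
  rw [le_div_iff₀ hN']
  calc _ = Var[fun y : ℝ => y; ν] := by field_simp
    _ ≤ M ^ 2 := this

/-- Cauchy–Schwarz, in the form that |y - g| has nonnegative variance. -/
lemma lintegral_abs_sub_le_sqrt (h : BoundedLaw M ν g) {v : ℝ}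
    (hv : Var[fun y : ℝ => y; ν] ≤ v) :
    ∫⁻ y, ENNReal.ofReal |y - g| ∂ν ≤ ENNReal.ofReal √v := by
  have := h.isProb
  have hi : Integrable (fun y : ℝ => y - g) ν := h.integrable.sub (integrable_const g)
  rw [← ofReal_integral_eq_lintegral_ofReal hi.abs (ae_of_all _ fun _ => abs_nonneg _)]
  refine ENNReal.ofReal_le_ofReal (Real.le_sqrt_of_sq_le ?_)
  have h2 : MemLp (fun y : ℝ => |y - g|) 2 ν := ((h.memLp 2).sub (memLp_const g)).norm
  have h3 : 0 ≤ Var[fun y : ℝ => |y - g|; ν] := variance_nonneg _ _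
  rw [variance_eq_sub h2] at h3
  rw [variance_eq_integral measurable_id'.aemeasurable, h.mean] at hv
  simp only [Pi.pow_apply, sq_abs] at h3
  linarith

/-- The mean absolute error of the mean of `N` independent samples. -/
lemma avg_error (h : BoundedLaw M ν g) {N : ℕ} (hN : N ≠ 0) :
    ∫⁻ y, ENNReal.ofReal |y - g| ∂(avg N ν) ≤ ENNReal.ofReal (M / √N) := by
  refine ((h.avg_law hN).lintegral_abs_sub_le_sqrt (h.avg_variance hN)).trans_eq ?_
  rw [Real.sqrt_div (sq_nonneg M), Real.sqrt_sq h.nonneg]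

/-- The law of the square of the mean of `N` independent samples: the bias is at most `M² / N`. -/
lemma avg_sq (h : BoundedLaw M ν g) {N : ℕ} (hN : N ≠ 0) :
    ∃ m, BoundedLaw (M ^ 2) ((Measure.pi fun _ : Fin N => ν).map fun z =>
      ((∑ j, z j) / (N : ℝ)) ^ 2) m ∧ |m - g ^ 2| ≤ M ^ 2 / N := by
  have := h.isProb
  have hN' : (0 : ℝ) < N := by exact_mod_cast Nat.pos_of_ne_zero hN
  have ha := h.avg_law hN
  have hp := ha.isProb
  have hm : Measurable fun z : Fin N → ℝ => (∑ j, z j) / (N : ℝ) := by fun_prop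
  have hsq : Measurable fun y : ℝ => y ^ 2 := by fun_prop
  have e : ((Measure.pi fun _ : Fin N => ν).map fun z => ((∑ j, z j) / (N : ℝ)) ^ 2)
      = (avg N ν).map fun y => y ^ 2 := by
    rw [avg, Measure.map_map hsq hm]
    rfl
  refine ⟨∫ y, y ^ 2 ∂(avg N ν), ?_, ?_⟩
  · rw [e]
    refine ⟨Measure.isProbabilityMeasure_map hsq.aemeasurable, ?_, ?_⟩
    · rw [ae_map_mem_Icc hsq]
      filter_upwards [ha.bounded] with y hy
      have := ha.nonneg
      constructor <;> nlinarith [hy.1, hy.2]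
    · rw [integral_map hsq.aemeasurable measurable_id'.aestronglyMeasurable]
  -- The bias of the squared average is exactly the variance of the average.
  · have h2 := variance_eq_sub (ha.memLp 2)
    have h3 := h.avg_variance hN
    have h4 : 0 ≤ Var[fun y : ℝ => y; avg N ν] := variance_nonneg _ _
    simp only [ha.mean, Pi.pow_apply] at h2
    rw [abs_of_nonneg] <;> linarith

end BoundedLaw

/-! ### The randomized algorithms and the functions that they compute -/

section Algorithms

variable {n : ℕ}

lemma integral_uniformOn {α : Type*} [Fintype α] [DecidableEq α] [MeasurableSpace α]
    [MeasurableSingletonClass α] (s : Finset α) (F : α → ℝ) :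
    ∫ x, F x ∂(uniformOn (s : Set α)) = (∑ x ∈ s, F x) / (s.card : ℝ) := by
  rw [integral_fintype Integrable.of_finite, Finset.sum_div]
  have h : ∀ x, (uniformOn (s : Set α)).real {x} = if x ∈ s then ((s.card : ℝ))⁻¹ else 0 := by
    intro x
    rw [Measure.real, ← Finset.coe_singleton, uniformOn_apply_finset]
    split_ifs with hx
    · rw [Finset.inter_singleton_of_mem hx]
      simp
    · rw [Finset.inter_singleton_of_notMem hx]
      simp
  simp only [h, smul_eq_mul, ite_mul, zero_mul, Finset.sum_ite_mem, Finset.univ_inter]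
  exact Finset.sum_congr rfl fun x _ => by rw [div_eq_inv_mul]

lemma isProb_uniformOn {α : Type*} [MeasurableSpace α] [MeasurableSingletonClass α]
    {s : Finset α} (hs : s.Nonempty) : IsProbabilityMeasure (uniformOn (s : Set α)) :=
  isProbabilityMeasure_uniformOn s.finite_toSet (by simpa using hs)

instance isProb_uniformOn_cube : IsProbabilityMeasure (uniformOn (Set.univ : Set (Cube n))) :=
  isProbabilityMeasure_uniformOn Set.finite_univ Set.univ_nonempty

instance isProb_uniformOn_sign : IsProbabilityMeasure (uniformOn (Set.univ : Set ℤˣ)) :=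
  isProbabilityMeasure_uniformOn Set.finite_univ Set.univ_nonempty

lemma integral_uniformOn_cube (F : Cube n → ℝ) :
    ∫ x, F x ∂(uniformOn (Set.univ : Set (Cube n))) = (∑ x, F x) / 2 ^ n := by
  have h := integral_uniformOn (Finset.univ : Finset (Cube n)) F
  rw [Finset.coe_univ] at h
  rw [h, Finset.card_univ, card_cube]
  push_cast
  rfl

/-! #### Noise -/

/-- The law of one coordinate under `noise`. -/
noncomputable def coordNoise (ρ : ℝ) (V : Finset (Fin n)) (x : Cube n) (i : Fin n) : Measure ℤˣ :=
  if i ∈ V then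
    ENNReal.ofReal ρ • Measure.dirac (x i) + ENNReal.ofReal (1 - ρ) • uniformOn Set.univ
  else Measure.dirac (x i)

lemma noise_eq (ρ : ℝ) (V : Finset (Fin n)) (x : Cube n) :
    noise ρ V x = Measure.pi (coordNoise ρ V x) := rfl

lemma isProb_coordNoise {ρ : ℝ} (h0 : 0 ≤ ρ) (h1 : ρ ≤ 1) (V : Finset (Fin n)) (x : Cube n)
    (i : Fin n) : IsProbabilityMeasure (coordNoise ρ V x i) := by
  unfold coordNoise
  split_ifs
  · constructor
    simp only [Measure.add_apply, Measure.smul_apply, measure_univ, smul_eq_mul, mul_one]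
    rw [← ENNReal.ofReal_add h0 (by linarith)]
    simp
  · infer_instance

lemma isProb_noise {ρ : ℝ} (h0 : 0 ≤ ρ) (h1 : ρ ≤ 1) (V : Finset (Fin n)) (x : Cube n) :
    IsProbabilityMeasure (noise ρ V x) := by
  have := isProb_coordNoise h0 h1 V x
  rw [noise_eq]
  infer_instance

lemma integral_coordNoise {ρ : ℝ} (h0 : 0 ≤ ρ) (V : Finset (Fin n)) (x : Cube n)
    (i : Fin n) : ∫ u, ((u : ℤ) : ℝ) ∂(coordNoise ρ V x i)
      = (if i ∈ V then ρ else 1) * ((x i : ℤ) : ℝ) := by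
  unfold coordNoise
  split_ifs
  · rw [integral_add_measure (Integrable.of_finite.smul_measure ENNReal.ofReal_ne_top)
      (Integrable.of_finite.smul_measure ENNReal.ofReal_ne_top), integral_smul_measure,
      integral_smul_measure, integral_dirac]
    have h := integral_uniformOn (Finset.univ : Finset ℤˣ) (fun u => ((u : ℤ) : ℝ))
    rw [Finset.coe_univ] at h
    rw [h]
    have h2 : ∑ u : ℤˣ, ((u : ℤ) : ℝ) = 0 := by
      rw [show (Finset.univ : Finset ℤˣ) = {1, -1} from rfl]
      simp
    rw [h2, ENNReal.toReal_ofReal h0]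
    simp
  · simp

/-- The noise operator `T_ρ^V`. -/
noncomputable def noiseOp (ρ : ℝ) (V : Finset (Fin n)) (g : Cube n → ℝ) (x : Cube n) : ℝ :=
  ∫ y, g y ∂(noise ρ V x)

/-- The coordinates are independent, so the expectation factors. A coordinate in S ∩ V contributes
ρ, because its rerandomized part has mean zero. -/
lemma noiseOp_chi {ρ : ℝ} (h0 : 0 ≤ ρ) (h1 : ρ ≤ 1) (V S : Finset (Fin n)) (x : Cube n) :
    noiseOp ρ V (chi S) x = ρ ^ (S ∩ V).card * chi S x := by
  have := isProb_coordNoise h0 h1 V x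
  have e : ∀ y : Cube n, chi S y = ∏ i, (if i ∈ S then ((y i : ℤ) : ℝ) else 1) := fun y => by
    simp [chi]
  rw [noiseOp, noise_eq]
  simp only [e]
  rw [integral_fintype_prod_eq_prod (fun i (u : ℤˣ) => if i ∈ S then ((u : ℤ) : ℝ) else 1)]
  have e2 : ∀ i, ∫ u, (if i ∈ S then ((u : ℤ) : ℝ) else 1) ∂(coordNoise ρ V x i)
      = (if i ∈ S then (if i ∈ V then ρ else 1) else 1)
        * (if i ∈ S then ((x i : ℤ) : ℝ) else 1) := by
    intro i
    split_ifs with hS hV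
    · rw [integral_coordNoise h0, if_pos hV]
    · rw [integral_coordNoise h0, if_neg hV]
    · simp
  simp only [e2, Finset.prod_mul_distrib]
  congr 1
  rw [Finset.prod_ite_mem, Finset.univ_inter, Finset.prod_ite_mem, Finset.prod_const]

lemma noiseOp_eq_sum {ρ : ℝ} (h0 : 0 ≤ ρ) (h1 : ρ ≤ 1) (V : Finset (Fin n)) (g : Cube n → ℝ)
    (x : Cube n) : noiseOp ρ V g x = ∑ y, (noise ρ V x).real {y} * g y := by
  have := isProb_noise h0 h1 V x
  rw [noiseOp, integral_fintype Integrable.of_finite]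
  rfl

lemma fourierCoef_noiseOp {ρ : ℝ} (h0 : 0 ≤ ρ) (h1 : ρ ≤ 1) (V : Finset (Fin n))
    (g : Cube n → ℝ) (S : Finset (Fin n)) :
    fourierCoef (noiseOp ρ V g) S = ρ ^ (S ∩ V).card * fourierCoef g S := by
  refine fourierCoef_of_expansion (a := fun S => ρ ^ (S ∩ V).card * fourierCoef g S)
    (fun x => ?_) S
  rw [noiseOp_eq_sum h0 h1]
  exact sum_kernel_mul_eq (fun S x => by rw [← noiseOp_eq_sum h0 h1, noiseOp_chi h0 h1]) g x

lemma algNoise_law {M : ℝ} {A : Cube n → Measure ℝ} {g : Cube n → ℝ}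
    (hA : ∀ x, BoundedLaw M (A x) (g x)) {ρ : ℝ} (h0 : 0 ≤ ρ) (h1 : ρ ≤ 1) (V : Finset (Fin n))
    (x : Cube n) : BoundedLaw M (algNoise A ρ V x) (noiseOp ρ V g x) := by
  have := isProb_noise h0 h1 V x
  exact BoundedLaw.bind (Measurable.of_discrete).aemeasurable (ae_of_all _ hA)

lemma algAve_law {M : ℝ} {A : Cube n → Measure ℝ} {g : Cube n → ℝ}
    (hA : ∀ x, BoundedLaw M (A x) (g x)) (I : Finset (Fin n)) (x : Cube n) :
    BoundedLaw M (algAve A I x) (aveOver I g x) := by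
  have := isProb_uniformOn (fiber_nonempty I x)
  rw [aveOver, ← integral_uniformOn]
  exact BoundedLaw.bind (Measurable.of_discrete).aemeasurable (ae_of_all _ hA)

/-! #### Sharp noise -/

/-- Coefficientwise majorants survive products and powers. Hence (1 + (1 + X)^κ)^Δ majorizes the
sharp noise polynomial, and its value at 1 bounds the sum of the |α_i|. -/
lemma abs_coeff_mul_le {p q p' q' : Polynomial ℝ} (h : ∀ i, |p.coeff i| ≤ p'.coeff i)
    (h' : ∀ i, |q.coeff i| ≤ q'.coeff i) (i : ℕ) : |(p * q).coeff i| ≤ (p' * q').coeff i := by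
  rw [Polynomial.coeff_mul, Polynomial.coeff_mul]
  refine (Finset.abs_sum_le_sum_abs _ _).trans (Finset.sum_le_sum fun x _ => ?_)
  rw [abs_mul]
  exact mul_le_mul (h _) (h' _) (abs_nonneg _) ((abs_nonneg _).trans (h _))

lemma abs_coeff_pow_le {p p' : Polynomial ℝ} (h : ∀ i, |p.coeff i| ≤ p'.coeff i) (m i : ℕ) :
    |(p ^ m).coeff i| ≤ (p' ^ m).coeff i := by
  induction m generalizing i with
  | zero =>
    simp only [pow_zero, Polynomial.coeff_one]
    split_ifs <;> simp
  | succ m ih => rw [pow_succ, pow_succ]; exact abs_coeff_mul_le ih h i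

lemma natDegree_sharp (κ Δ : ℕ) :
    ((1 - (1 - Polynomial.X) ^ κ) ^ Δ : Polynomial ℝ).natDegree ≤ κ * Δ := by
  refine Polynomial.natDegree_pow_le.trans ?_
  rw [mul_comm]
  refine Nat.mul_le_mul_right _ ((Polynomial.natDegree_sub_le _ _).trans ?_)
  rw [Polynomial.natDegree_one, Nat.max_le]
  refine ⟨Nat.zero_le _, Polynomial.natDegree_pow_le.trans ?_⟩
  have : (1 - Polynomial.X : Polynomial ℝ).natDegree ≤ 1 :=
    (Polynomial.natDegree_sub_le _ _).trans (by simp)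
  exact (Nat.mul_le_mul_left κ this).trans_eq (mul_one κ)

lemma sum_sharpCoeff (κ Δ : ℕ) (z : ℝ) :
    ∑ i : Fin (κ * Δ + 1), sharpCoeff κ Δ i * z ^ (i : ℕ) = (1 - (1 - z) ^ κ) ^ Δ := by
  have h := Polynomial.eval_eq_sum_range' (Nat.lt_succ_of_le (natDegree_sharp κ Δ)) z
  rw [Fin.sum_univ_eq_sum_range (fun i => sharpCoeff κ Δ i * z ^ i)]
  simp only [sharpCoeff]
  rw [← Nat.succ_eq_add_one, ← h]
  simp

lemma sum_abs_sharpCoeff_le (κ Δ : ℕ) :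
    ∑ i : Fin (κ * Δ + 1), |sharpCoeff κ Δ i| ≤ (1 + 2 ^ κ) ^ Δ := by
  set q : Polynomial ℝ := (1 + (1 + Polynomial.X) ^ κ) ^ Δ with hq
  have h1 : ∀ i, |(1 - Polynomial.X : Polynomial ℝ).coeff i| ≤ (1 + Polynomial.X).coeff i := by
    intro i
    simp only [Polynomial.coeff_sub, Polynomial.coeff_add, Polynomial.coeff_one,
      Polynomial.coeff_X]
    split_ifs <;> norm_num
  have h2 : ∀ i, |(1 - (1 - Polynomial.X) ^ κ : Polynomial ℝ).coeff i|
      ≤ (1 + (1 + Polynomial.X) ^ κ).coeff i := by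
    intro i
    rw [Polynomial.coeff_sub, Polynomial.coeff_add]
    refine (abs_sub _ _).trans (add_le_add ?_ (abs_coeff_pow_le h1 κ i))
    rw [Polynomial.coeff_one]
    split_ifs <;> simp
  have h3 : ∀ i, |sharpCoeff κ Δ i| ≤ q.coeff i := abs_coeff_pow_le h2 Δ
  have hdeg : q.natDegree ≤ κ * Δ := by
    refine Polynomial.natDegree_pow_le.trans ?_
    rw [mul_comm]
    refine Nat.mul_le_mul_right _ ((Polynomial.natDegree_add_le _ _).trans ?_)
    rw [Polynomial.natDegree_one, Nat.max_le]
    refine ⟨Nat.zero_le _, Polynomial.natDegree_pow_le.trans ?_⟩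
    have : (1 + Polynomial.X : Polynomial ℝ).natDegree ≤ 1 :=
      (Polynomial.natDegree_add_le _ _).trans (by simp)
    exact (Nat.mul_le_mul_left κ this).trans_eq (mul_one κ)
  calc ∑ i : Fin (κ * Δ + 1), |sharpCoeff κ Δ i| ≤ ∑ i : Fin (κ * Δ + 1), q.coeff i :=
        Finset.sum_le_sum fun i _ => h3 i
    _ = q.eval 1 := by
        rw [Polynomial.eval_eq_sum_range' (Nat.lt_succ_of_le hdeg) 1,
          Fin.sum_univ_eq_sum_range (fun i => q.coeff i)]
        simp
    _ = (1 + 2 ^ κ) ^ Δ := by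
        rw [hq]
        simp only [Polynomial.eval_pow, Polynomial.eval_add, Polynomial.eval_one,
          Polynomial.eval_X]
        norm_num

/-- The noise rate `ρ = 1 - 1/(2ℓ)`. -/
noncomputable def rate (ℓ : ℕ) : ℝ := 1 - 1 / (2 * (ℓ : ℝ))

lemma rate_nonneg (ℓ : ℕ) : 0 ≤ rate ℓ := by
  rcases Nat.eq_zero_or_pos ℓ with rfl | h
  · simp [rate]
  · have h' : (1 : ℝ) ≤ ℓ := by exact_mod_cast h
    rw [rate, sub_nonneg, div_le_one (by positivity)]
    linarith

lemma rate_le_one (ℓ : ℕ) : rate ℓ ≤ 1 := by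
  rw [rate]
  have : (0 : ℝ) ≤ 1 / (2 * (ℓ : ℝ)) := by positivity
  linarith

/-- The factor by which `1 - SharpNoise` multiplies the Fourier coefficient at `S`, as a function
of `s = |S ∩ V|`. -/
noncomputable def sharpFactor (ℓ κ Δ s : ℕ) : ℝ := 1 - (1 - (1 - rate ℓ ^ s) ^ κ) ^ Δ

/-- The function `g - SharpNoise g`. -/
noncomputable def sharpDiff (ℓ κ Δ : ℕ) (V : Finset (Fin n)) (g : Cube n → ℝ) (x : Cube n) : ℝ :=
  g x - ∑ i : Fin (κ * Δ + 1), sharpCoeff κ Δ i * noiseOp (rate ℓ ^ (i : ℕ)) V g x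

lemma fourierCoef_sub (f g : Cube n → ℝ) (S : Finset (Fin n)) :
    fourierCoef (fun x => f x - g x) S = fourierCoef f S - fourierCoef g S := by
  simp only [fourierCoef, sub_mul, Finset.sum_sub_distrib, sub_div]

/-- With s = |S ∩ V|, the i-th noise operator multiplies by (ρ^s)^i, so the combination evaluates
the defining polynomial at ρ^s. -/
lemma fourierCoef_sharpDiff (ℓ κ Δ : ℕ) (V : Finset (Fin n)) (g : Cube n → ℝ)
    (S : Finset (Fin n)) :
    fourierCoef (sharpDiff ℓ κ Δ V g) S
      = sharpFactor ℓ κ Δ (S ∩ V).card * fourierCoef g S := by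
  have h : sharpDiff ℓ κ Δ V g = fun x => g x - ∑ i : Fin (κ * Δ + 1),
    sharpCoeff κ Δ i * noiseOp (rate ℓ ^ (i : ℕ)) V g x := rfl
  rw [h, fourierCoef_sub, fourierCoef_sum]
  have h2 : ∀ i : Fin (κ * Δ + 1), sharpCoeff κ Δ i
      * fourierCoef (noiseOp (rate ℓ ^ (i : ℕ)) V g) S
      = sharpCoeff κ Δ i * (rate ℓ ^ (S ∩ V).card) ^ (i : ℕ) * fourierCoef g S := by
    intro i
    rw [fourierCoef_noiseOp (pow_nonneg (rate_nonneg ℓ) _)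
      (pow_le_one₀ (rate_nonneg ℓ) (rate_le_one ℓ)), ← mul_assoc, pow_right_comm]
  simp only [h2]
  rw [← Finset.sum_mul, sum_sharpCoeff, sharpFactor]
  ring

lemma algSharpDiff_law {M : ℝ} {A : Cube n → Measure ℝ} {g : Cube n → ℝ}
    (hA : ∀ x, BoundedLaw M (A x) (g x)) (ℓ κ Δ : ℕ) (V : Finset (Fin n)) (x : Cube n) :
    BoundedLaw (M + (1 + 2 ^ κ) ^ Δ * M) (algSharpDiff A ℓ κ Δ V x) (sharpDiff ℓ κ Δ V g x) := by
  have hN : ∀ i : Fin (κ * Δ + 1), BoundedLaw M (algNoise A (rate ℓ ^ (i : ℕ)) V x)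
      (noiseOp (rate ℓ ^ (i : ℕ)) V g x) := fun i =>
    algNoise_law hA (pow_nonneg (rate_nonneg ℓ) _)
      (pow_le_one₀ (rate_nonneg ℓ) (rate_le_one ℓ)) V x
  have := fun i => (hN i).isProb
  have h := (BoundedLaw.pi_sum (fun i : Fin (κ * Δ + 1) => sharpCoeff κ Δ i) hN).mono
    (M' := (1 + 2 ^ κ) ^ Δ * M) (by
      rw [← Finset.sum_mul]
      exact mul_le_mul_of_nonneg_right (sum_abs_sharpCoeff_le κ Δ) (hA x).nonneg)
  exact BoundedLaw.prod_sub (by fun_prop) (hA x) h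

/-! #### Derivatives -/

lemma algDeriv_law {M : ℝ} {A : Cube n → Measure ℝ} {g : Cube n → ℝ}
    (hA : ∀ x, BoundedLaw M (A x) (g x)) (U : Finset (Fin n)) (x : Cube n) :
    BoundedLaw M (algDeriv A U x) (deriv U g x) := by
  have h := BoundedLaw.pi_sum
    (fun S : U.powerset => chi U x * ((-1 : ℝ) ^ S.1.card / 2 ^ U.card))
    (fun S : U.powerset => hA (flip S.1 x))
  have e : ∑ S : U.powerset, |chi U x * ((-1 : ℝ) ^ S.1.card / 2 ^ U.card)| * M = M := by
    simp only [abs_mul, abs_chi, abs_div, abs_pow, abs_neg, abs_one, one_pow]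
    rw [Finset.sum_const, Finset.card_univ, Fintype.card_coe, Finset.card_powerset, nsmul_eq_mul]
    rw [abs_of_pos (by norm_num : (0 : ℝ) < 2)]
    push_cast
    field_simp
  rw [e] at h
  simp only [mul_assoc, ← Finset.mul_sum] at h
  exact h

/-! ### The estimator of the squared norm -/

/-- The mean of `g²` over the cube. -/
noncomputable def meanSq (g : Cube n → ℝ) : ℝ := (∑ x, g x ^ 2) / 2 ^ n

/-- Two errors are kept apart: the bias of squaring an average of N runs, and the fluctuation of the
outer mean of N squares. -/
lemma estimateSq_law {M a δ : ℝ} {A : Cube n → Measure ℝ} {g : Cube n → ℝ}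
    (hA : ∀ x, BoundedLaw M (A x) (g x)) (hN : sampleSize M a δ ≠ 0) :
    ∃ m, BoundedLaw (M ^ 2) (estimateSq M a δ A) m ∧
      |m - meanSq g| ≤ M ^ 2 / sampleSize M a δ ∧
      ∫⁻ y, ENNReal.ofReal |y - m| ∂(estimateSq M a δ A)
        ≤ ENNReal.ofReal (M ^ 2 / √(sampleSize M a δ)) := by
  choose m hm hmb using fun x => (hA x).avg_sq hN
  have h1 : BoundedLaw (M ^ 2) ((uniformOn (Set.univ : Set (Cube n))).bind fun x =>
      (Measure.pi fun _ : Fin (sampleSize M a δ) => A x).map fun z =>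
        ((∑ j, z j) / (sampleSize M a δ : ℝ)) ^ 2) (∫ x, m x ∂(uniformOn Set.univ)) :=
    BoundedLaw.bind (Measurable.of_discrete).aemeasurable (ae_of_all _ hm)
  refine ⟨_, h1.avg_law hN, ?_, h1.avg_error hN⟩
  rw [integral_uniformOn_cube, meanSq, ← sub_div, ← Finset.sum_sub_distrib, abs_div,
    abs_of_pos (by positivity : (0 : ℝ) < 2 ^ n), div_le_iff₀ (by positivity)]
  calc |∑ x, (m x - g x ^ 2)| ≤ ∑ x, |m x - g x ^ 2| := Finset.abs_sum_le_sum_abs _ _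
    _ ≤ ∑ _x : Cube n, M ^ 2 / (sampleSize M a δ : ℝ) := Finset.sum_le_sum fun x _ => hmb x
    _ = M ^ 2 / (sampleSize M a δ : ℝ) * 2 ^ n := by
        rw [Finset.sum_const, Finset.card_univ, card_cube, nsmul_eq_mul]
        push_cast
        ring

/-- The error of `estimateSq` in mean. -/
lemma estimateSq_error {M a δ : ℝ} {A : Cube n → Measure ℝ} {g : Cube n → ℝ}
    (hA : ∀ x, BoundedLaw M (A x) (g x)) (hN : sampleSize M a δ ≠ 0) :
    ∫⁻ y, ENNReal.ofReal |y - meanSq g| ∂(estimateSq M a δ A)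
      ≤ ENNReal.ofReal (M ^ 2 / √(sampleSize M a δ) + M ^ 2 / sampleSize M a δ) := by
  obtain ⟨m, hm, hb, he⟩ := estimateSq_law hA hN
  have := hm.isProb
  calc ∫⁻ y, ENNReal.ofReal |y - meanSq g| ∂(estimateSq M a δ A)
      ≤ ∫⁻ y, (ENNReal.ofReal |y - m| + ENNReal.ofReal |m - meanSq g|) ∂(estimateSq M a δ A) := by
        refine lintegral_mono fun y => ?_
        rw [← ENNReal.ofReal_add (abs_nonneg _) (abs_nonneg _)]
        exact ENNReal.ofReal_le_ofReal (abs_sub_le _ _ _)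
    _ ≤ _ := by
        rw [lintegral_add_right _ measurable_const, lintegral_const, measure_univ, mul_one,
          ENNReal.ofReal_add (by positivity) (by positivity)]
        exact add_le_add he (ENNReal.ofReal_le_ofReal hb)

end Algorithms

/-! ### Measurable dependence of laws on parameters -/

section Measurability

variable {Ω : Type*} [MeasurableSpace Ω]

/-- `estimateNinf` draws its noise rate from a continuous law, so its `bind` needs kernels that
depend measurably on that rate. Boxes form a generating π-system on which this is visible. -/
lemma measurable_pi_measure {ι : Type*} [Fintype ι] {X : ι → Type*} [∀ i, MeasurableSpace (X i)]
    {ν : Ω → ∀ i, Measure (X i)} [∀ ω i, IsProbabilityMeasure (ν ω i)]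
    (h : ∀ i, Measurable fun ω => ν ω i) : Measurable fun ω => Measure.pi (ν ω) := by
  refine Measurable.measure_of_isPiSystem_of_isProbabilityMeasure generateFrom_pi.symm
    isPiSystem_pi ?_
  rintro _ ⟨s, hs, rfl⟩
  simp only [Measure.pi_pi]
  exact Finset.measurable_prod _ fun i _ =>
    (Measure.measurable_coe (hs i (Set.mem_univ i))).comp (h i)

lemma measurable_bind_of_finite {α β : Type*} [Fintype α] [MeasurableSpace α]
    [MeasurableSingletonClass α] [MeasurableSpace β] (m : Measure α) {κ : Ω → α → Measure β}
    (h : ∀ x, Measurable fun ω => κ ω x) : Measurable fun ω => m.bind (κ ω) := by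
  refine Measure.measurable_of_measurable_coe _ fun s hs => ?_
  simp only [Measure.bind_apply hs (Measurable.of_discrete).aemeasurable, lintegral_fintype]
  exact Finset.measurable_fun_sum _ fun x _ =>
    ((Measure.measurable_coe hs).comp (h x)).mul_const _

variable {n : ℕ}

lemma measurable_coordNoise (V : Finset (Fin n)) (x : Cube n) (i : Fin n) :
    Measurable fun ρ : ℝ => coordNoise ρ V x i := by
  refine Measure.measurable_of_measurable_coe _ fun s hs => ?_
  unfold coordNoise
  split_ifs
  · simp only [Measure.add_apply, Measure.smul_apply, smul_eq_mul]
    fun_prop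
  · fun_prop

lemma measurable_noise {ρ : Ω → ℝ} (hρ : Measurable ρ) (h : ∀ ω, 0 ≤ ρ ω ∧ ρ ω ≤ 1)
    (V : Finset (Fin n)) (x : Cube n) : Measurable fun ω => noise (ρ ω) V x := by
  have := fun ω i => isProb_coordNoise (h ω).1 (h ω).2 V x i
  exact measurable_pi_measure (ν := fun ω i => coordNoise (ρ ω) V x i)
    fun i => (measurable_coordNoise V x i).comp hρ

lemma measurable_estimateSq {M a δ : ℝ} {A : Ω → Cube n → Measure ℝ}
    (hp : ∀ ω x, IsProbabilityMeasure (A ω x)) (h : ∀ x, Measurable fun ω => A ω x) :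
    Measurable fun ω => estimateSq M a δ (A ω) := by
  have hm : Measurable fun z : Fin (sampleSize M a δ) → ℝ =>
    ((∑ j, z j) / (sampleSize M a δ : ℝ)) ^ 2 := by fun_prop
  have hm2 : Measurable fun z : Fin (sampleSize M a δ) → ℝ =>
    (∑ j, z j) / (sampleSize M a δ : ℝ) := by fun_prop
  have hp2 : ∀ ω, IsProbabilityMeasure ((uniformOn (Set.univ : Set (Cube n))).bind fun x =>
      (Measure.pi fun _ : Fin (sampleSize M a δ) => A ω x).map fun z =>
        ((∑ j, z j) / (sampleSize M a δ : ℝ)) ^ 2) := fun ω =>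
    BoundedLaw.isProb_bind (Measurable.of_discrete).aemeasurable
      (ae_of_all _ fun x => Measure.isProbabilityMeasure_map hm.aemeasurable)
  refine (Measure.measurable_map _ hm2).comp ?_
  refine measurable_pi_measure (ν := fun ω _ => _) fun _ => ?_
  refine measurable_bind_of_finite _ fun x => ?_
  refine (Measure.measurable_map _ hm).comp ?_
  exact measurable_pi_measure (ν := fun ω _ => A ω x) fun _ => h x

end Measurability

/-! ### The smallest of several uniform numbers -/

section OrderStatistic

lemma integral_pow_mul_one_sub_pow (a b : ℕ) :
    ∫ x in (0 : ℝ)..1, x ^ a * (1 - x) ^ b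
      = (a.factorial * b.factorial : ℝ) / (a + b + 1).factorial := by
  induction b generalizing a with
  | zero =>
    simp only [pow_zero, mul_one, integral_pow, Nat.factorial_zero, Nat.cast_one, add_zero]
    rw [Nat.factorial_succ]
    have : (a.factorial : ℝ) ≠ 0 := by positivity
    push_cast
    field_simp
    norm_num
  | succ b ih =>
    -- The function x^{a+1}(1-x)^{b+1} vanishes at both ends, so integrating its derivative trades a
    -- factor 1 - x for a factor x.
    have hd : ∀ x : ℝ, HasDerivAt (fun x : ℝ => x ^ (a + 1) * (1 - x) ^ (b + 1))
        ((a + 1) * (x ^ a * (1 - x) ^ (b + 1)) - (b + 1) * (x ^ (a + 1) * (1 - x) ^ b)) x := by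
      intro x
      have h1 : HasDerivAt (fun x : ℝ => 1 - x) (-1) x := by
        simpa using (hasDerivAt_id x).const_sub 1
      have h2 := (hasDerivAt_pow (a + 1) x).mul (h1.pow (b + 1))
      refine h2.congr_deriv ?_
      simp only [Nat.add_sub_cancel, Pi.pow_apply]
      push_cast
      ring
    have hi : ∀ p q : ℕ, IntervalIntegrable (fun x : ℝ => x ^ p * (1 - x) ^ q) volume 0 1 :=
      fun p q => (by fun_prop : Continuous fun x : ℝ => x ^ p * (1 - x) ^ q).intervalIntegrable _ _
    have hf := intervalIntegral.integral_eq_sub_of_hasDerivAt (a := 0) (b := 1)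
      (fun x _ => hd x) (((hi a (b + 1)).const_mul _).sub ((hi (a + 1) b).const_mul _))
    rw [intervalIntegral.integral_sub ((hi a (b + 1)).const_mul _) ((hi (a + 1) b).const_mul _),
      intervalIntegral.integral_const_mul, intervalIntegral.integral_const_mul, ih] at hf
    have h0 : ((1 : ℝ) ^ (a + 1) * (1 - 1) ^ (b + 1)) - 0 ^ (a + 1) * (1 - 0) ^ (b + 1) = 0 := by
      norm_num
    rw [h0] at hf
    have ha : (a : ℝ) + 1 ≠ 0 := by positivity
    rw [show a + (b + 1) + 1 = a + 1 + b + 1 by ring]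
    have hF : ((a + 1 + b + 1).factorial : ℝ) ≠ 0 := by positivity
    rw [Nat.factorial_succ a] at hf
    rw [Nat.factorial_succ b]
    push_cast at hf ⊢
    refine mul_left_cancel₀ ha ?_
    rw [sub_eq_zero.mp hf]
    field_simp

/-- The law of `γ` independent uniform numbers in `[0,1]`. -/
noncomputable def unifPi (γ : ℕ) : Measure (Fin γ → ℝ) :=
  Measure.pi fun _ : Fin γ => (volume : Measure ℝ).restrict (Set.Icc 0 1)

instance isProb_unifIcc : IsProbabilityMeasure ((volume : Measure ℝ).restrict (Set.Icc 0 1)) :=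
  ⟨by simp⟩

instance isProb_unifPi (γ : ℕ) : IsProbabilityMeasure (unifPi γ) := by
  unfold unifPi
  infer_instance

lemma ae_unifPi_mem (γ : ℕ) : ∀ᵐ r ∂unifPi γ, ∀ j, r j ∈ Set.Icc (0 : ℝ) 1 :=
  ae_all_iff.mpr fun j =>
    (measurePreserving_eval (fun _ : Fin γ => (volume : Measure ℝ).restrict (Set.Icc 0 1))
      j).quasiMeasurePreserving.ae (ae_restrict_mem measurableSet_Icc)

lemma measurable_iInf_eval (γ : ℕ) : Measurable fun r : Fin γ → ℝ => ⨅ j, r j :=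
  Measurable.iInf fun j => measurable_pi_apply j

lemma iInf_mem_Icc {γ : ℕ} (hγ : γ ≠ 0) {r : Fin γ → ℝ} (h : ∀ j, r j ∈ Set.Icc (0 : ℝ) 1) :
    (⨅ j, r j) ∈ Set.Icc (0 : ℝ) 1 := by
  have : Nonempty (Fin γ) := ⟨⟨0, Nat.pos_of_ne_zero hγ⟩⟩
  refine ⟨le_ciInf fun j => (h j).1, ?_⟩
  exact (ciInf_le (Set.finite_range r).bddBelow this.some).trans (h _).2

lemma unifPi_le_iInf {γ : ℕ} (hγ : γ ≠ 0) {t : ℝ} (ht : 0 ≤ t) :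
    unifPi γ {r | t ≤ ⨅ j, r j} = ENNReal.ofReal (1 - t) ^ γ := by
  have : Nonempty (Fin γ) := ⟨⟨0, Nat.pos_of_ne_zero hγ⟩⟩
  have e : {r : Fin γ → ℝ | t ≤ ⨅ j, r j} = Set.univ.pi fun _ => Set.Ici t := by
    ext r
    simp [le_ciInf_iff (Set.finite_range r).bddBelow, Pi.le_def]
  rw [e, unifPi, Measure.pi_pi]
  have e2 : Set.Ici t ∩ Set.Icc 0 1 = Set.Icc t 1 := by
    ext x
    simp only [Set.mem_inter_iff, Set.mem_Ici, Set.mem_Icc]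
    constructor
    · rintro ⟨h1, _, h2⟩; exact ⟨h1, h2⟩
    · rintro ⟨h1, h2⟩; exact ⟨h1, ht.trans h1, h2⟩
  simp [Measure.restrict_apply measurableSet_Ici, e2]

/-- The moments of the smallest of `γ` independent uniform numbers in `[0,1]`. -/
lemma integral_iInf_pow {γ : ℕ} (hγ : γ ≠ 0) (s : ℕ) :
    ∫ r, (⨅ j, r j) ^ s ∂unifPi γ = ((s + γ).choose γ : ℝ)⁻¹ := by
  -- The layer cake formula needs a positive exponent; it gives s∫ t^{s-1} P(min ≥ t) dt = s∫
  -- t^{s-1}(1-t)^γ dt, a Beta integral. The condition γ ≠ 0 matters, since the infimum of an empty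
  -- family is 0 by default.
  rcases s with _ | a
  · simp
  have hnn : ∀ᵐ r ∂unifPi γ, (0 : ℝ) ≤ ⨅ j, r j :=
    (ae_unifPi_mem γ).mono fun r hr => (iInf_mem_Icc hγ hr).1
  have hm := measurable_iInf_eval γ
  have h1 := lintegral_rpow_eq_lintegral_meas_le_mul (unifPi γ) hnn hm.aemeasurable
    (p := ((a + 1 : ℕ) : ℝ)) (by positivity)
  simp only [Real.rpow_natCast] at h1
  have hI : ∀ p q : ℕ, Continuous fun x : ℝ => x ^ p * (1 - x) ^ q := fun p q => by fun_prop
  have h2 : ∫⁻ t in Set.Ioi (0 : ℝ), unifPi γ {r | t ≤ ⨅ j, r j}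
      * ENNReal.ofReal (t ^ (((a + 1 : ℕ) : ℝ) - 1))
      = ENNReal.ofReal ((a.factorial * γ.factorial : ℝ) / (a + γ + 1).factorial) := by
    rw [← integral_pow_mul_one_sub_pow, intervalIntegral.integral_of_le zero_le_one,
      ofReal_integral_eq_lintegral_ofReal
        ((hI a γ).integrableOn_Icc.mono_set Set.Ioc_subset_Icc_self)]
    · rw [← Set.Ioc_union_Ioi_eq_Ioi (zero_le_one' ℝ), lintegral_union measurableSet_Ioi
        (Set.Ioc_disjoint_Ioi le_rfl)]
      have e1 : ∫⁻ t in Set.Ioi (1 : ℝ), unifPi γ {r | t ≤ ⨅ j, r j}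
          * ENNReal.ofReal (t ^ (((a + 1 : ℕ) : ℝ) - 1)) = 0 := by
        rw [setLIntegral_congr_fun (g := fun _ => 0) measurableSet_Ioi]
        · simp
        · intro t ht
          have ht : 1 < t := ht
          simp only
          rw [unifPi_le_iInf hγ (by linarith), ENNReal.ofReal_of_nonpos (by linarith), zero_pow hγ,
            zero_mul]
      rw [e1, add_zero]
      refine setLIntegral_congr_fun measurableSet_Ioc fun t ht => ?_
      rw [unifPi_le_iInf hγ ht.1.le, ← ENNReal.ofReal_pow (by linarith [ht.2]), mul_comm,
        ← ENNReal.ofReal_mul (by have := ht.1; positivity)]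
      congr 2
      rw [Nat.cast_add, Nat.cast_one, add_sub_cancel_right, Real.rpow_natCast]
    · refine (ae_restrict_mem measurableSet_Ioc).mono fun t ht => ?_
      have h3 : 0 ≤ 1 - t := by linarith [ht.2]
      have h4 := ht.1.le
      simp only [Pi.zero_apply]
      positivity
  rw [h2, ← ENNReal.ofReal_mul (by positivity)] at h1
  rw [integral_eq_lintegral_of_nonneg_ae (hnn.mono fun r hr => pow_nonneg hr _)
    (hm.pow_const _).aestronglyMeasurable, h1, ENNReal.toReal_ofReal (by positivity)]
  have hc : ((a + 1 + γ).choose γ : ℝ) * ((a + 1).factorial * γ.factorial)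
      = (a + 1 + γ).factorial := by
    have := Nat.add_choose_mul_factorial_mul_factorial (a + 1) γ
    push_cast [← this]
    ring
  have hF : ((a + 1 + γ).factorial : ℝ) ≠ 0 := by positivity
  rw [show a + γ + 1 = a + 1 + γ by ring, ← mul_div_assoc, ← mul_assoc, div_eq_iff hF, ← hc,
    Nat.factorial_succ]
  have : ((a + 1 + γ).choose γ : ℝ) ≠ 0 := by
    exact_mod_cast (Nat.choose_pos (Nat.le_add_left γ (a + 1))).ne'
  field_simp
  push_cast
  ring

end OrderStatistic

/-! ### The estimator of the normalized influence -/

section Influence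

variable {n : ℕ}

/-- The quantity that `estimateNinf` estimates. -/
noncomputable def ninf (g : Cube n → ℝ) (U : Finset (Fin n)) : ℝ :=
  (U.card.factorial : ℝ) ^ 2 *
    ∑ S with U ⊆ S, fourierCoef g S ^ 2 / (S.card.choose U.card : ℝ)

lemma ninf_nonneg (g : Cube n → ℝ) (U : Finset (Fin n)) : 0 ≤ ninf g U :=
  mul_nonneg (sq_nonneg _) (Finset.sum_nonneg fun S _ => by positivity)

/-- By Parseval: the sets T disjoint from U correspond to S = T ∪ U, and the rate √y is chosen so
that its square contributes y^{|S|-|U|}. -/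
lemma meanSq_noiseOp_deriv {y : ℝ} (h0 : 0 ≤ y) (h1 : y ≤ 1) (g : Cube n → ℝ)
    (U : Finset (Fin n)) :
    meanSq (noiseOp √y Finset.univ (deriv U g))
      = ∑ S with U ⊆ S, y ^ (S.card - U.card) * fourierCoef g S ^ 2 := by
  have hs : √y ≤ 1 := Real.sqrt_le_one.mpr h1
  rw [meanSq, parseval]
  simp only [fourierCoef_noiseOp (Real.sqrt_nonneg y) hs, fourierCoef_deriv, Finset.inter_univ,
    mul_pow, ← pow_mul, mul_comm _ 2]
  simp only [pow_mul, Real.sq_sqrt h0]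
  rw [← Finset.sum_filter_add_sum_filter_not Finset.univ (fun T => Disjoint T U)]
  rw [Finset.sum_eq_zero (s := Finset.univ.filter fun T => ¬Disjoint T U), add_zero]
  · refine Finset.sum_nbij' (fun T => T ∪ U) (fun S => S \ U) ?_ ?_ ?_ ?_ ?_
    · intro T _
      simp
    · intro S _
      simpa using Finset.sdiff_disjoint
    · intro T hT
      exact Finset.union_sdiff_cancel_right (by simpa using hT)
    · intro S hS
      exact Finset.sdiff_union_of_subset (by simpa using hS)
    · intro T hT
      have hT : Disjoint T U := by simpa using hT
      rw [if_pos hT, Finset.card_union_of_disjoint hT, Nat.add_sub_cancel]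
  · intro T hT
    have hT : ¬Disjoint T U := by simpa using hT
    rw [if_neg hT]
    simp

/-- The moment of order |S| - |U| of the smallest of |U| uniform numbers is 1/(|S| choose |U|),
which is the desired normalization. -/
lemma integral_meanSq_noiseOp_deriv (g : Cube n → ℝ) {U : Finset (Fin n)} (hU : U.card ≠ 0) :
    (U.card.factorial : ℝ) ^ 2 * ∫ r, meanSq (noiseOp √(⨅ j, r j) Finset.univ (deriv U g))
      ∂unifPi U.card = ninf g U := by
  rw [ninf]
  congr 1
  rw [integral_congr_ae (g := fun r => ∑ S with U ⊆ S,
    (⨅ j, r j) ^ (S.card - U.card) * fourierCoef g S ^ 2)]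
  · rw [integral_finsetSum]
    · refine Finset.sum_congr rfl fun S hS => ?_
      have hS : U ⊆ S := by simpa using hS
      rw [integral_mul_const, integral_iInf_pow hU, Nat.sub_add_cancel (Finset.card_le_card hS),
        div_eq_inv_mul]
    · intro S _
      refine Integrable.mul_const (Integrable.of_bound
        ((measurable_iInf_eval _).pow_const _).aestronglyMeasurable 1 ?_) _
      filter_upwards [ae_unifPi_mem U.card] with r hr
      have h := iInf_mem_Icc hU hr
      rw [norm_pow, Real.norm_eq_abs, abs_of_nonneg h.1]
      exact pow_le_one₀ h.1 h.2
  · filter_upwards [ae_unifPi_mem U.card] with r hr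
    have h := iInf_mem_Icc hU hr
    exact meanSq_noiseOp_deriv h.1 h.2 g U

/-- The law of one round of `estimateNinf`. -/
noncomputable def ninfRound (B a' δ' : ℝ) (A : Cube n → Measure ℝ) (U : Finset (Fin n)) :
    Measure ℝ :=
  (unifPi U.card).bind fun r =>
    estimateSq B a' δ' (algNoise (algDeriv A U) (√(⨅ j, r j)) Finset.univ)

lemma ninfRound_law {B a' δ' : ℝ} {A : Cube n → Measure ℝ} {g : Cube n → ℝ}
    (hA : ∀ x, BoundedLaw B (A x) (g x)) {U : Finset (Fin n)} (hU : U.card ≠ 0)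
    (hN : sampleSize B a' δ' ≠ 0) :
    ∃ m, BoundedLaw (B ^ 2) (ninfRound B a' δ' A U) m ∧
      |(U.card.factorial : ℝ) ^ 2 * m - ninf g U|
        ≤ (U.card.factorial : ℝ) ^ 2 * (B ^ 2 / sampleSize B a' δ') := by
  set κ : (Fin U.card → ℝ) → Measure ℝ := fun r =>
    estimateSq B a' δ' (algNoise (algDeriv A U) (√(⨅ j, r j)) Finset.univ)
  set P := unifPi U.card
  -- The minimum lies in [0,1] only almost surely. Clamping it makes the noise a probability measure
  -- for every `r`, so that the kernel is measurable everywhere and agrees with `κ` almost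
  -- everywhere.
  have hρ : ∀ r : Fin U.card → ℝ, 0 ≤ √(max 0 (min 1 (⨅ j, r j))) ∧
      √(max 0 (min 1 (⨅ j, r j))) ≤ 1 := fun r =>
    ⟨Real.sqrt_nonneg _, Real.sqrt_le_one.mpr (by simp)⟩
  have hρm : Measurable fun r : Fin U.card → ℝ => √(max 0 (min 1 (⨅ j, r j))) :=
    (measurable_const.max (measurable_const.min (measurable_iInf_eval _))).sqrt
  have hκm : AEMeasurable κ P := by
    refine ⟨fun r => estimateSq B a' δ'
      (algNoise (algDeriv A U) (√(max 0 (min 1 (⨅ j, r j)))) Finset.univ), ?_, ?_⟩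
    · refine measurable_estimateSq (fun r x =>
        (algNoise_law (algDeriv_law hA U) (hρ r).1 (hρ r).2 _ x).isProb) fun x => ?_
      exact (Measure.measurable_bind' Measurable.of_discrete).comp (measurable_noise hρm hρ _ x)
    · filter_upwards [ae_unifPi_mem U.card] with r hr
      have h := iInf_mem_Icc hU hr
      simp only [κ]
      rw [min_eq_right h.2, max_eq_right h.1]
  have hr : ∀ r : Fin U.card → ℝ, (∀ j, r j ∈ Set.Icc (0 : ℝ) 1) →
      BoundedLaw (B ^ 2) (κ r) (∫ y, y ∂κ r) ∧
      |(∫ y, y ∂κ r) - meanSq (noiseOp √(⨅ j, r j) Finset.univ (deriv U g))|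
        ≤ B ^ 2 / sampleSize B a' δ' := by
    intro r hr
    have h := iInf_mem_Icc hU hr
    obtain ⟨m, h1, h2, _⟩ := estimateSq_law (algNoise_law (algDeriv_law hA U)
      (Real.sqrt_nonneg _) (Real.sqrt_le_one.mpr h.2) Finset.univ) hN
    have : ∫ y, y ∂κ r = m := h1.mean
    rw [this]
    exact ⟨h1, h2⟩
  have hlaw : ∀ᵐ r ∂P, BoundedLaw (B ^ 2) (κ r) (∫ y, y ∂κ r) :=
    (ae_unifPi_mem U.card).mono fun r h => (hr r h).1
  refine ⟨_, BoundedLaw.bind hκm hlaw, ?_⟩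
  have hsq : ∀ᵐ r ∂P, (∑ S with U ⊆ S, (⨅ j, r j) ^ (S.card - U.card) * fourierCoef g S ^ 2)
      = meanSq (noiseOp √(⨅ j, r j) Finset.univ (deriv U g)) := by
    filter_upwards [ae_unifPi_mem U.card] with r hr
    have h := iInf_mem_Icc hU hr
    exact (meanSq_noiseOp_deriv h.1 h.2 g U).symm
  have hi : Integrable (fun r => meanSq (noiseOp √(⨅ j, r j) Finset.univ (deriv U g))) P := by
    have hmeas : AEStronglyMeasurable
        (fun r => meanSq (noiseOp √(⨅ j, r j) Finset.univ (deriv U g))) P := by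
      refine AEStronglyMeasurable.congr ?_ hsq
      exact (Finset.measurable_fun_sum _ fun S _ =>
        ((measurable_iInf_eval _).pow_const _).mul_const _).aestronglyMeasurable
    refine Integrable.of_bound hmeas (B ^ 2 + B ^ 2 / sampleSize B a' δ') ?_
    filter_upwards [ae_unifPi_mem U.card] with r h
    obtain ⟨h1, h2⟩ := hr r h
    have h3 := abs_le.mp h1.abs_mean_le
    have h4 := abs_le.mp h2
    rw [Real.norm_eq_abs, abs_le]
    constructor <;> linarith
  rw [← integral_meanSq_noiseOp_deriv g hU, ← mul_sub, abs_mul, abs_of_nonneg (sq_nonneg _),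
    ← integral_sub (BoundedLaw.integrable_mean hκm hlaw) hi]
  refine mul_le_mul_of_nonneg_left ?_ (sq_nonneg _)
  rw [← Real.norm_eq_abs]
  refine (norm_integral_le_of_norm_le_const
    ((ae_unifPi_mem U.card).mono fun r h => (hr r h).2)).trans_eq ?_
  simp

/-- The number of rounds of `estimateNinf`. -/
noncomputable def ninfRounds (u B a δ : ℝ) : ℕ :=
  ⌈1000 * u ^ 4 * B ^ 4 * (Real.logb 2 (1 / δ) / a ^ 2)⌉₊

lemma estimateNinf_eq (B a δ : ℝ) (A : Cube n → Measure ℝ) (U : Finset (Fin n)) :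
    estimateNinf B a δ A U =
      (BoundedLaw.avg (ninfRounds U.card.factorial B a δ)
        (ninfRound B (a / (4 * (U.card.factorial : ℝ) ^ 2))
          (a / (100 * B ^ 2 * (U.card.factorial : ℝ) ^ 2)) A U)).map
        fun y => (U.card.factorial : ℝ) ^ 2 * y := by
  rw [BoundedLaw.avg, Measure.map_map (by fun_prop) (by fun_prop)]
  rfl

lemma one_le_logb {δ : ℝ} (h0 : 0 < δ) (h1 : δ ≤ 1 / 2) : 1 ≤ Real.logb 2 (1 / δ) := by
  rw [Real.le_logb_iff_rpow_le (by norm_num) (by positivity), Real.rpow_one, le_div_iff₀ h0]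
  linarith

/-- A bound on the mean error inside `estimateNinf` needs no more from the failure parameter than
log(1/δ) ≥ 1. -/
lemma le_sampleSize {M a δ : ℝ} (h0 : 0 < δ) (h1 : δ ≤ 1 / 2) :
    1000 * M ^ 4 / a ^ 2 ≤ sampleSize M a δ := by
  refine le_trans ?_ (Nat.le_ceil _)
  have : 0 ≤ 1000 * M ^ 4 / a ^ 2 := by positivity
  nlinarith [one_le_logb h0 h1]

lemma le_ninfRounds {u B a δ : ℝ} (h0 : 0 < δ) (h1 : δ ≤ 1 / 2) :
    1000 * u ^ 4 * B ^ 4 / a ^ 2 ≤ ninfRounds u B a δ := by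
  refine le_trans ?_ (Nat.le_ceil _)
  have : 0 ≤ 1000 * u ^ 4 * B ^ 4 / a ^ 2 := by positivity
  have h := one_le_logb h0 h1
  calc 1000 * u ^ 4 * B ^ 4 / a ^ 2
      ≤ 1000 * u ^ 4 * B ^ 4 / a ^ 2 * Real.logb 2 (1 / δ) := le_mul_of_one_le_right this h
    _ = _ := by ring

/-- The error of `estimateNinf` in mean. -/
lemma estimateNinf_error {B a δ : ℝ} {A : Cube n → Measure ℝ} {g : Cube n → ℝ}
    (hA : ∀ x, BoundedLaw B (A x) (g x)) {U : Finset (Fin n)} (hU : U.card ≠ 0)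
    (hB : 1 ≤ B) (ha0 : 0 < a) (ha1 : a ≤ 1) (hδ0 : 0 < δ) (hδ1 : δ ≤ 1 / 2) :
    IsProbabilityMeasure (estimateNinf B a δ A U) ∧
      ∫⁻ y, ENNReal.ofReal |y - ninf g U| ∂(estimateNinf B a δ A U) ≤ ENNReal.ofReal a := by
  set u : ℝ := (U.card.factorial : ℝ) with hu
  have hu1 : 1 ≤ u := by
    rw [hu]
    exact_mod_cast Nat.one_le_iff_ne_zero.mpr (Nat.factorial_ne_zero _)
  set a' : ℝ := a / (4 * u ^ 2) with ha'
  set δ' : ℝ := a / (100 * B ^ 2 * u ^ 2) with hδ'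
  have hu2 : 1 ≤ u ^ 2 := one_le_pow₀ hu1
  have hB2 : 1 ≤ B ^ 2 := one_le_pow₀ hB
  have hδ'0 : 0 < δ' := by positivity
  have hδ'1 : δ' ≤ 1 / 2 := by
    rw [hδ', div_le_iff₀ (by positivity)]
    nlinarith [mul_le_mul hB2 hu2 zero_le_one (by positivity)]
  have ha'0 : 0 < a' := by positivity
  have ha'1 : a' ≤ 1 := by
    rw [ha', div_le_one (by positivity)]
    linarith
  have hN1 := le_sampleSize (M := B) (a := a') hδ'0 hδ'1
  have hM1 := le_ninfRounds (u := u) (B := B) (a := a) hδ0 hδ1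
  set N := sampleSize B a' δ' with hN
  set M := ninfRounds u B a δ with hM
  have hNpos : (0 : ℝ) < N := lt_of_lt_of_le (by positivity) hN1
  have hMpos : (0 : ℝ) < M := lt_of_lt_of_le (by positivity) hM1
  have hN0 : N ≠ 0 := by
    intro h
    rw [h] at hNpos
    simp at hNpos
  have hM0 : M ≠ 0 := by
    intro h
    rw [h] at hMpos
    simp at hMpos
  obtain ⟨m, hm1, hm2⟩ := ninfRound_law (δ' := δ') (a' := a') hA hU hN0
  have hp := (hm1.avg_law hM0).isProb
  have hmul : Measurable fun y : ℝ => u ^ 2 * y := by fun_prop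
  rw [estimateNinf_eq]
  refine ⟨Measure.isProbabilityMeasure_map hmul.aemeasurable, ?_⟩
  rw [lintegral_map (by fun_prop) hmul]
  have hbias : B ^ 2 / N ≤ a' / 1000 := by
    rw [div_le_div_iff₀ hNpos (by norm_num)]
    have h1 : B ^ 2 * 1000 ≤ a' * (1000 * B ^ 4 / a' ^ 2) := by
      have e : a' * (1000 * B ^ 4 / a' ^ 2) = 1000 * B ^ 4 / a' := by
        field_simp
      rw [e, le_div_iff₀ ha'0]
      nlinarith [mul_le_mul hB2 hB2 zero_le_one (by positivity)]
    exact h1.trans (mul_le_mul_of_nonneg_left hN1 ha'0.le)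
  have hdev : u ^ 2 * (B ^ 2 / √M) ≤ a / 10 := by
    have h1 : 10 * u ^ 2 * B ^ 2 / a ≤ √M := by
      refine Real.le_sqrt_of_sq_le (le_trans ?_ hM1)
      have e : (10 * u ^ 2 * B ^ 2 / a) ^ 2 = 100 * u ^ 4 * B ^ 4 / a ^ 2 := by
        rw [div_pow]
        ring
      rw [e]
      gcongr
      norm_num
    have hsq : 0 < √(M : ℝ) := Real.sqrt_pos.mpr hMpos
    rw [← mul_div_assoc, div_le_iff₀ hsq]
    rw [div_le_iff₀ ha0] at h1
    linarith
  have e := hm1.avg_error hM0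
  calc ∫⁻ y, ENNReal.ofReal |u ^ 2 * y - ninf g U| ∂(BoundedLaw.avg M (ninfRound B a' δ' A U))
      ≤ ∫⁻ y, (ENNReal.ofReal (u ^ 2) * ENNReal.ofReal |y - m|
          + ENNReal.ofReal |u ^ 2 * m - ninf g U|)
          ∂(BoundedLaw.avg M (ninfRound B a' δ' A U)) := by
        refine lintegral_mono fun y => ?_
        rw [← ENNReal.ofReal_mul (by positivity), ← ENNReal.ofReal_add (by positivity)
          (abs_nonneg _)]
        refine ENNReal.ofReal_le_ofReal ?_
        rw [← abs_of_nonneg (sq_nonneg u), ← abs_mul, mul_sub, abs_of_nonneg (sq_nonneg u)]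
        exact abs_sub_le _ _ _
    _ ≤ ENNReal.ofReal (u ^ 2) * ENNReal.ofReal (B ^ 2 / √M)
          + ENNReal.ofReal (u ^ 2 * (B ^ 2 / N)) := by
        rw [lintegral_add_right _ measurable_const, lintegral_const, measure_univ, mul_one,
          lintegral_const_mul _ (by fun_prop)]
        gcongr
    _ ≤ ENNReal.ofReal a := by
        rw [← ENNReal.ofReal_mul (by positivity), ← ENNReal.ofReal_add (by positivity)
          (by positivity)]
        refine ENNReal.ofReal_le_ofReal ?_
        have h3 : u ^ 2 * (B ^ 2 / N) ≤ u ^ 2 * (a' / 1000) :=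
          mul_le_mul_of_nonneg_left hbias (by positivity)
        have h4 : u ^ 2 * (a' / 1000) = a / 4000 := by
          rw [ha']
          field_simp
          norm_num
        linarith

end Influence

/-! ### Sampling a set with probability proportional to the estimates -/

section Sampling

variable {n s : ℕ}

lemma pickProportional_eq (w : {U : Finset (Fin n) // U.card = s} → ℝ) :
    pickProportional w = if ∑ U, ENNReal.ofReal (w U) = 0 then Measure.dirac ∅
      else ∑ U, (ENNReal.ofReal (w U) / ∑ U, ENNReal.ofReal (w U)) • Measure.dirac U.1 := rfl

lemma measurable_pickProportional :
    Measurable (pickProportional : ({U : Finset (Fin n) // U.card = s} → ℝ) → _) := by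
  refine Measure.measurable_of_measurable_coe _ fun t _ => ?_
  have htot : Measurable fun w : {U : Finset (Fin n) // U.card = s} → ℝ =>
      ∑ U, ENNReal.ofReal (w U) :=
    Finset.measurable_fun_sum _ fun U _ => (measurable_pi_apply U).ennreal_ofReal
  have e : (fun w : {U : Finset (Fin n) // U.card = s} → ℝ => pickProportional w t)
      = fun w => if ∑ U, ENNReal.ofReal (w U) = 0 then Measure.dirac (∅ : Finset (Fin n)) t
        else ∑ U : {U : Finset (Fin n) // U.card = s},
          (ENNReal.ofReal (w U) / ∑ U, ENNReal.ofReal (w U)) * Measure.dirac U.1 t := by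
    funext w
    rw [pickProportional_eq]
    split_ifs
    · rfl
    · simp
  rw [e]
  refine Measurable.ite (htot (measurableSet_singleton 0)) measurable_const ?_
  exact Finset.measurable_fun_sum _ fun U _ =>
    ((measurable_pi_apply U).ennreal_ofReal.div htot).mul_const _

lemma isProb_pickProportional (w : {U : Finset (Fin n) // U.card = s} → ℝ) :
    IsProbabilityMeasure (pickProportional w) := by
  rw [pickProportional_eq]
  split_ifs with h
  · infer_instance
  · constructor
    have hfin : ∑ U, ENNReal.ofReal (w U) ≠ ⊤ := by simp [ENNReal.sum_eq_top]
    simp only [Measure.coe_finsetSum, Finset.sum_apply, Measure.smul_apply, measure_univ,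
      smul_eq_mul, mul_one, ENNReal.div_eq_inv_mul]
    rw [← Finset.mul_sum, ENNReal.inv_mul_cancel h hfin]

/-- Let z and m be the totals of the clipped estimates and of the true weights, and Q the mean of
`J`. In Qm = Qz + Q(m - z), replacing estimates by true weights costs at most BΣ|w - μ| in each
term. The bound is linear in the errors, so it can be integrated from mean absolute errors alone. -/
lemma lintegral_pickProportional_le {w μ : {U : Finset (Fin n) // U.card = s} → ℝ}
    (hμ : ∀ U, 0 ≤ μ U) (hm : 0 < ∑ U, μ U) {J : Finset (Fin n) → ℝ} {B : ℝ}
    (hJ0 : ∀ T, 0 ≤ J T) (hJB : ∀ T, J T ≤ B) :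
    ∫⁻ T, ENNReal.ofReal (J T) ∂(pickProportional w)
      ≤ ENNReal.ofReal ((∑ U, μ U * J U.1) / ∑ U, μ U
        + 2 * B / (∑ U, μ U) * ∑ U, |w U - μ U|) := by
  set m := ∑ U, μ U
  have hB : 0 ≤ B := (hJ0 ∅).trans (hJB ∅)
  -- `ENNReal.ofReal` truncates negative estimates to 0; as μ ≥ 0, this can only reduce the error.
  set v : {U : Finset (Fin n) // U.card = s} → ℝ := fun U => max (w U) 0 with hv
  have hv0 : ∀ U, 0 ≤ v U := fun U => le_max_right _ _
  have hof : ∀ U, ENNReal.ofReal (w U) = ENNReal.ofReal (v U) := fun U => by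
    simp [hv]
  have hvw : ∀ U, |v U - μ U| ≤ |w U - μ U| := by
    intro U
    have := hμ U
    rcases le_total (w U) 0 with h | h
    · simp only [hv, max_eq_right h, zero_sub, abs_neg]
      rw [abs_of_nonneg this, abs_of_nonpos (by linarith)]
      linarith
    · simp only [hv, max_eq_left h, le_refl]
  have hδ : ∑ U, |v U - μ U| ≤ ∑ U, |w U - μ U| := Finset.sum_le_sum fun U _ => hvw U
  set δ := ∑ U, |w U - μ U|
  have hmass : |(∑ U, v U) - m| ≤ δ := by
    rw [← Finset.sum_sub_distrib]
    exact (Finset.abs_sum_le_sum_abs _ _).trans hδ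
  have hmain : 0 ≤ (∑ U, μ U * J U.1) / m :=
    div_nonneg (Finset.sum_nonneg fun U _ => mul_nonneg (hμ U) (hJ0 _)) hm.le
  rw [pickProportional_eq]
  simp only [hof]
  rw [← ENNReal.ofReal_sum_of_nonneg fun U _ => hv0 U]
  split_ifs with h
  -- If every estimate is truncated to 0, then m ≤ δ, so the error term alone is at least `B`.
  · rw [lintegral_dirac]
    refine ENNReal.ofReal_le_ofReal ?_
    have hz : ∑ U, v U = 0 :=
      le_antisymm (ENNReal.ofReal_eq_zero.mp h) (Finset.sum_nonneg fun U _ => hv0 U)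
    rw [hz, zero_sub, abs_neg, abs_of_pos hm] at hmass
    have h1 : B ≤ B / m * δ := by
      rw [div_mul_eq_mul_div, le_div_iff₀ hm]
      exact mul_le_mul_of_nonneg_left hmass hB
    have h2 : 2 * B / m * δ = B / m * δ + B / m * δ := by ring
    rw [h2]
    linarith [hJB ∅]
  · have hpos : 0 < ∑ U, v U := by
      rw [← ENNReal.ofReal_pos]
      exact pos_iff_ne_zero.mpr h
    set z := ∑ U, v U
    rw [lintegral_finsetSum_measure]
    simp only [lintegral_smul_measure, lintegral_dirac, smul_eq_mul]
    have e : ∀ U, ENNReal.ofReal (v U) / ENNReal.ofReal z * ENNReal.ofReal (J U.1)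
        = ENNReal.ofReal (v U / z * J U.1) := fun U => by
      rw [← ENNReal.ofReal_div_of_pos hpos, ← ENNReal.ofReal_mul (div_nonneg (hv0 U) hpos.le)]
    simp only [e]
    rw [← ENNReal.ofReal_sum_of_nonneg fun U _ =>
      mul_nonneg (div_nonneg (hv0 U) hpos.le) (hJ0 _)]
    refine ENNReal.ofReal_le_ofReal ?_
    set Q := ∑ U, v U / z * J U.1 with hQ
    have hQz : Q * z = ∑ U, v U * J U.1 := by
      rw [hQ, Finset.sum_mul]
      exact Finset.sum_congr rfl fun U _ => by field_simp
    have hQ0 : 0 ≤ Q := Finset.sum_nonneg fun U _ =>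
      mul_nonneg (div_nonneg (hv0 U) hpos.le) (hJ0 _)
    have hQB : Q ≤ B := by
      have : Q * z ≤ B * z := by
        rw [hQz, Finset.mul_sum]
        exact Finset.sum_le_sum fun U _ => by
          rw [mul_comm B]
          exact mul_le_mul_of_nonneg_left (hJB _) (hv0 U)
      exact le_of_mul_le_mul_right this hpos
    have h1 : ∑ U, v U * J U.1 ≤ ∑ U, μ U * J U.1 + B * δ := by
      have : ∑ U, v U * J U.1 - ∑ U, μ U * J U.1 ≤ ∑ U, |v U - μ U| * B := by
        rw [← Finset.sum_sub_distrib]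
        refine Finset.sum_le_sum fun U _ => ?_
        rw [← sub_mul]
        exact mul_le_mul (le_abs_self _) (hJB _) (hJ0 _) (abs_nonneg _)
      rw [← Finset.sum_mul] at this
      nlinarith [mul_le_mul_of_nonneg_right hδ hB]
    have h2 : Q * (m - z) ≤ B * δ :=
      calc Q * (m - z) ≤ Q * δ := by
            refine mul_le_mul_of_nonneg_left ?_ hQ0
            linarith [(abs_le.mp hmass).1]
        _ ≤ B * δ := mul_le_mul_of_nonneg_right hQB ((abs_nonneg _).trans hmass)
    have e2 : (∑ U, μ U * J U.1) / m + 2 * B / m * δ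
        = (∑ U, μ U * J U.1 + 2 * B * δ) / m := by
      rw [add_div, div_mul_eq_mul_div]
    rw [e2, le_div_iff₀ hm]
    linarith

/-- The mean of `J` over the subsets of `S` of size `γ`. -/
noncomputable def avgSubsets (γ : ℕ) (S : Finset (Fin n)) (J : Finset (Fin n) → ℝ) : ℝ :=
  (∑ U ∈ S.powersetCard γ, J U) / (S.card.choose γ : ℝ)

/-- Exchanging the sums shows that each squared coefficient is spread evenly over the γ-subsets of
S. Thus sampling U in proportion to `ninf` means drawing S, among the sets of size at least γ, by
Fourier weight and then U uniformly inside S. -/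
lemma sum_ninf_mul (g : Cube n → ℝ) (γ : ℕ) (J : Finset (Fin n) → ℝ) :
    ∑ U : {U : Finset (Fin n) // U.card = γ}, ninf g U.1 * J U.1
      = (γ.factorial : ℝ) ^ 2 * ∑ S, fourierCoef g S ^ 2 * avgSubsets γ S J := by
  have h1 : ∀ U : {U : Finset (Fin n) // U.card = γ}, ninf g U.1 * J U.1
      = (γ.factorial : ℝ) ^ 2 * ∑ S, if U.1 ⊆ S then
        fourierCoef g S ^ 2 / (S.card.choose γ : ℝ) * J U.1 else 0 := by
    intro U
    rw [ninf, U.2, ← Finset.sum_filter, mul_assoc, Finset.sum_mul]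
  simp only [h1]
  rw [← Finset.mul_sum, Finset.sum_comm]
  congr 1
  refine Finset.sum_congr rfl fun S _ => ?_
  rw [avgSubsets, ← mul_div_assoc, mul_div_right_comm, Finset.mul_sum]
  rw [← Finset.sum_subtype (Finset.powersetCard γ Finset.univ) (p := fun U => U.card = γ)
    (f := fun U => if U ⊆ S then fourierCoef g S ^ 2 / (S.card.choose γ : ℝ) * J U else 0)
    (fun U => by simp [Finset.mem_powersetCard]), ← Finset.sum_filter]
  refine Finset.sum_congr ?_ fun _ _ => rfl
  ext U
  simp [Finset.mem_powersetCard, and_comm]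

lemma avgSubsets_const {γ : ℕ} {S : Finset (Fin n)} (h : γ ≤ S.card) (b : ℝ) :
    avgSubsets γ S (fun _ => b) = b := by
  have : (S.card.choose γ : ℝ) ≠ 0 := by exact_mod_cast (Nat.choose_pos h).ne'
  rw [avgSubsets, Finset.sum_const, Finset.card_powersetCard, nsmul_eq_mul]
  field_simp

lemma avgSubsets_of_lt {γ : ℕ} {S : Finset (Fin n)} (h : S.card < γ) (J : Finset (Fin n) → ℝ) :
    avgSubsets γ S J = 0 := by
  rw [avgSubsets, Nat.choose_eq_zero_of_lt h]
  simp

/-- The Fourier weight of `g` on the sets of size at least `γ`. -/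
noncomputable def weightCard (g : Cube n → ℝ) (γ : ℕ) : ℝ :=
  ∑ S with γ ≤ S.card, fourierCoef g S ^ 2

lemma sum_ninf (g : Cube n → ℝ) (γ : ℕ) :
    ∑ U : {U : Finset (Fin n) // U.card = γ}, ninf g U.1
      = (γ.factorial : ℝ) ^ 2 * weightCard g γ := by
  have h := sum_ninf_mul g γ (fun _ => 1)
  simp only [mul_one] at h
  rw [h, weightCard, Finset.sum_filter]
  congr 1
  refine Finset.sum_congr rfl fun S _ => ?_
  split_ifs with hS
  · rw [avgSubsets_const hS, mul_one]
  · rw [avgSubsets_of_lt (not_le.mp hS), mul_zero]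

variable {c : ℝ} {k : ℕ} {ε : ℝ}

lemma one_le_numReps (c : ℝ) (k n : ℕ) (ε : ℝ) : (1 : ℝ) ≤ numReps c k n ε := by
  have h : 0 < numReps c k n ε := Nat.ceil_pos.mpr (Real.exp_pos _)
  exact_mod_cast h

lemma one_le_boundH (n : ℕ) (ε : ℝ) : 1 ≤ boundH n ε := by
  have : (0 : ℝ) < 2 ^ (2 * paramKappa n ε * paramDelta) := by positivity
  rw [boundH]
  linarith

/-- The accuracy of the calls of `estimateNinf`. -/
noncomputable def accT (c : ℝ) (k n : ℕ) (ε : ℝ) : ℝ :=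
  (ε / (n : ℝ)) ^ 10 * ((numReps c k n ε : ℝ))⁻¹ *
    (((n.choose (paramGamma k n ε) : ℕ) : ℝ) ^ 2)⁻¹

/-- The failure probability of the calls of `estimateNinf`. -/
noncomputable def failT (k n : ℕ) (ε : ℝ) : ℝ :=
  ((2 : ℝ) ^ (n ^ 2))⁻¹ * ((n.choose (paramGamma k n ε) : ℕ) : ℝ)⁻¹

lemma sampleT_eq (H : Cube n → Measure ℝ) :
    sampleT c k ε H = (Measure.pi fun U : {U : Finset (Fin n) // U.card = paramGamma k n ε} =>
      estimateNinf (boundH n ε) (accT c k n ε) (failT k n ε) H U.1).bind pickProportional := rfl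

lemma le_one_div_two_pow_sq (hn : n ≠ 0) : ((2 : ℝ) ^ (n ^ 2))⁻¹ ≤ 1 / 2 := by
  rw [one_div]
  refine inv_anti₀ (by norm_num) ?_
  calc (2 : ℝ) = 2 ^ 1 := by norm_num
    _ ≤ 2 ^ (n ^ 2) := pow_le_pow_right₀ (by norm_num) (Nat.one_le_iff_ne_zero.mpr (by positivity))

lemma sampleT_calls {H : Cube n → Measure ℝ} {h : Cube n → ℝ}
    (hH : ∀ x, BoundedLaw (boundH n ε) (H x) (h x)) (hε0 : 0 < ε) (hε1 : ε < 1) (hn : n ≠ 0)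
    (hγ0 : paramGamma k n ε ≠ 0) (U : {U : Finset (Fin n) // U.card = paramGamma k n ε}) :
    IsProbabilityMeasure (estimateNinf (boundH n ε) (accT c k n ε) (failT k n ε) H U.1) ∧
      ∫⁻ y, ENNReal.ofReal |y - ninf h U.1|
        ∂(estimateNinf (boundH n ε) (accT c k n ε) (failT k n ε) H U.1)
        ≤ ENNReal.ofReal (accT c k n ε) := by
  have hγn : paramGamma k n ε ≤ n := by
    rw [← U.2]
    simpa using Finset.card_le_univ U.1
  have hC : (1 : ℝ) ≤ (n.choose (paramGamma k n ε) : ℕ) := by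
    exact_mod_cast Nat.choose_pos hγn
  have hR := one_le_numReps c k n ε
  have hn1 : (1 : ℝ) ≤ n := by exact_mod_cast Nat.one_le_iff_ne_zero.mpr hn
  have hx0 : 0 < ε / n := by positivity
  have hx1 : ε / n ≤ 1 := by
    rw [div_le_one (by positivity)]
    linarith
  refine estimateNinf_error hH (by rw [U.2]; exact hγ0) (one_le_boundH n ε) ?_ ?_ ?_ ?_
  · unfold accT
    positivity
  · unfold accT
    refine mul_le_one₀ (mul_le_one₀ (pow_le_one₀ hx0.le hx1) (by positivity)
      (inv_le_one_of_one_le₀ hR)) (by positivity) (inv_le_one_of_one_le₀ (one_le_pow₀ hC))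
  · unfold failT
    positivity
  · unfold failT
    exact (mul_le_of_le_one_right (by positivity) (inv_le_one_of_one_le₀ hC)).trans
      (le_one_div_two_pow_sq hn)

lemma isProb_sampleT {H : Cube n → Measure ℝ} {h : Cube n → ℝ}
    (hH : ∀ x, BoundedLaw (boundH n ε) (H x) (h x)) (hε0 : 0 < ε) (hε1 : ε < 1) (hn : n ≠ 0)
    (hγ0 : paramGamma k n ε ≠ 0) : IsProbabilityMeasure (sampleT c k ε H) := by
  have := fun U => (sampleT_calls (c := c) (k := k) hH hε0 hε1 hn hγ0 U).1
  rw [sampleT_eq]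
  exact BoundedLaw.isProb_bind measurable_pickProportional.aemeasurable
    (ae_of_all _ isProb_pickProportional)

/-- Under `sampleT` the mean of `J` is close to its mean over a uniformly random subset of size `γ`
of a set that is drawn with probability proportional to its Fourier weight. -/
lemma lintegral_sampleT_le {H : Cube n → Measure ℝ} {h : Cube n → ℝ}
    (hH : ∀ x, BoundedLaw (boundH n ε) (H x) (h x)) (hε0 : 0 < ε) (hε1 : ε < 1) (hn : n ≠ 0)
    (hγ0 : paramGamma k n ε ≠ 0) (hγn : paramGamma k n ε ≤ n)
    (hw : 0 < weightCard h (paramGamma k n ε)) {J : Finset (Fin n) → ℝ} {B : ℝ}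
    (hJ0 : ∀ T, 0 ≤ J T) (hJB : ∀ T, J T ≤ B) :
    ∫⁻ T, ENNReal.ofReal (J T) ∂(sampleT c k ε H)
      ≤ ENNReal.ofReal ((∑ S, fourierCoef h S ^ 2 * avgSubsets (paramGamma k n ε) S J
        + 2 * B * (ε / n) ^ 10) / weightCard h (paramGamma k n ε)) := by
  set γ := paramGamma k n ε
  set W := weightCard h γ
  have hcalls := fun U => sampleT_calls (c := c) (k := k) hH hε0 hε1 hn hγ0 U
  have := fun U => (hcalls U).1
  have hB : 0 ≤ B := (hJ0 ∅).trans (hJB ∅)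
  have hF : (1 : ℝ) ≤ (γ.factorial : ℝ) ^ 2 :=
    one_le_pow₀ (by exact_mod_cast Nat.one_le_iff_ne_zero.mpr (Nat.factorial_ne_zero _))
  have hm : 0 < ∑ U : {U : Finset (Fin n) // U.card = γ}, ninf h U.1 := by
    rw [sum_ninf]
    positivity
  rw [sampleT_eq, Measure.lintegral_bind measurable_pickProportional.aemeasurable
    (Measurable.of_discrete).aemeasurable]
  have hmass : 0 ≤ ∑ U : {U : Finset (Fin n) // U.card = γ}, ninf h U.1 * J U.1 :=
    Finset.sum_nonneg fun U _ => mul_nonneg (ninf_nonneg _ _) (hJ0 _)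
  have hacc : 0 ≤ accT c k n ε := by
    unfold accT
    positivity
  have hn1 : (0 : ℝ) < n := by exact_mod_cast Nat.pos_of_ne_zero hn
  -- There is one call for each of the (n choose γ) sets, and the inverse square in the accuracy
  -- absorbs their number.
  have hsum : (n.choose γ : ℝ) * accT c k n ε ≤ (ε / n) ^ 10 := by
    have hC : (1 : ℝ) ≤ (n.choose γ : ℕ) := by exact_mod_cast Nat.choose_pos hγn
    have hR := one_le_numReps c k n ε
    have e : (n.choose γ : ℝ) * accT c k n ε
        = (ε / n) ^ 10 * ((numReps c k n ε : ℝ)⁻¹ * ((n.choose γ : ℕ) : ℝ)⁻¹) := by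
      have e2 : accT c k n ε = (ε / n) ^ 10 * ((numReps c k n ε : ℝ))⁻¹ *
        (((n.choose γ : ℕ) : ℝ) ^ 2)⁻¹ := rfl
      rw [e2]
      field_simp
    rw [e]
    exact mul_le_of_le_one_right (by positivity) (mul_le_one₀ (inv_le_one_of_one_le₀ hR)
      (by positivity) (inv_le_one_of_one_le₀ hC))
  calc _ ≤ ∫⁻ w, (ENNReal.ofReal ((∑ U : {U : Finset (Fin n) // U.card = γ}, ninf h U.1 * J U.1)
              / ∑ U : {U : Finset (Fin n) // U.card = γ}, ninf h U.1)
            + ENNReal.ofReal (2 * B / ∑ U : {U : Finset (Fin n) // U.card = γ}, ninf h U.1)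
              * ∑ U, ENNReal.ofReal |w U - ninf h U.1|)
            ∂(Measure.pi fun U : {U : Finset (Fin n) // U.card = γ} =>
              estimateNinf (boundH n ε) (accT c k n ε) (failT k n ε) H U.1) := by
        refine lintegral_mono fun w => ?_
        refine (lintegral_pickProportional_le (fun U => ninf_nonneg h U.1) hm hJ0 hJB).trans ?_
        rw [ENNReal.ofReal_add (div_nonneg hmass hm.le) (by positivity),
          ENNReal.ofReal_mul (by positivity),
          ENNReal.ofReal_sum_of_nonneg fun U _ => abs_nonneg _]
    _ ≤ ENNReal.ofReal ((∑ U : {U : Finset (Fin n) // U.card = γ}, ninf h U.1 * J U.1)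
              / ∑ U : {U : Finset (Fin n) // U.card = γ}, ninf h U.1)
            + ENNReal.ofReal (2 * B / ∑ U : {U : Finset (Fin n) // U.card = γ}, ninf h U.1)
              * ENNReal.ofReal ((ε / n) ^ 10) := by
        rw [lintegral_add_left measurable_const, lintegral_const, measure_univ, mul_one,
          lintegral_const_mul _ (Finset.measurable_fun_sum _ fun U _ => by fun_prop),
          lintegral_finsetSum _ fun U _ => by fun_prop]
        gcongr
        refine le_trans (Finset.sum_le_sum fun U _ => ?_) (b := ∑ _U :
          {U : Finset (Fin n) // U.card = γ}, ENNReal.ofReal (accT c k n ε)) ?_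
        · have hmp := measurePreserving_eval (fun U : {U : Finset (Fin n) // U.card = γ} =>
            estimateNinf (boundH n ε) (accT c k n ε) (failT k n ε) H U.1) U
          have := hmp.lintegral_comp (f := fun y => ENNReal.ofReal |y - ninf h U.1|)
            (by fun_prop)
          exact this.trans_le (hcalls U).2
        · rw [Finset.sum_const, Finset.card_univ, nsmul_eq_mul, Fintype.card_finset_len,
            Fintype.card_fin, ← ENNReal.ofReal_natCast, ← ENNReal.ofReal_mul (by positivity)]
          exact ENNReal.ofReal_le_ofReal hsum
    _ ≤ _ := by
        rw [← ENNReal.ofReal_mul (by positivity), ← ENNReal.ofReal_add (div_nonneg hmass hm.le)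
          (by positivity)]
        refine ENNReal.ofReal_le_ofReal ?_
        rw [sum_ninf_mul, sum_ninf, add_div, mul_div_mul_left _ _ (by positivity)]
        refine add_le_add le_rfl ?_
        rw [div_mul_eq_mul_div]
        refine div_le_div_of_nonneg_left (by positivity) hw ?_
        exact le_mul_of_one_le_left hw.le hF

end Sampling

/-! ### Uniformly random subsets of a given size -/

section Subsets

variable {n : ℕ}

lemma avgSubsets_mono {γ : ℕ} {S : Finset (Fin n)} {J J' : Finset (Fin n) → ℝ}
    (h : ∀ U, J U ≤ J' U) : avgSubsets γ S J ≤ avgSubsets γ S J' :=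
  div_le_div_of_nonneg_right (Finset.sum_le_sum fun U _ => h U) (Nat.cast_nonneg _)

lemma avgSubsets_le {γ : ℕ} {S : Finset (Fin n)} (hS : γ ≤ S.card) {J : Finset (Fin n) → ℝ}
    {b : ℝ} (h : ∀ U, J U ≤ b) : avgSubsets γ S J ≤ b :=
  (avgSubsets_mono h).trans_eq (avgSubsets_const hS b)

lemma avgSubsets_add (γ : ℕ) (S : Finset (Fin n)) (J J' : Finset (Fin n) → ℝ) :
    avgSubsets γ S (fun U => J U + J' U) = avgSubsets γ S J + avgSubsets γ S J' := by
  simp only [avgSubsets, Finset.sum_add_distrib, add_div]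

lemma avgSubsets_const_mul (γ : ℕ) (S : Finset (Fin n)) (a : ℝ) (J : Finset (Fin n) → ℝ) :
    avgSubsets γ S (fun U => a * J U) = a * avgSubsets γ S J := by
  simp only [avgSubsets, ← Finset.mul_sum, mul_div_assoc]

lemma card_powersetCard_filter_mem {γ : ℕ} {S : Finset (Fin n)} {i : Fin n} (hi : i ∈ S) :
    S.card * ((S.powersetCard γ).filter fun U => i ∈ U).card = γ * S.card.choose γ := by
  have h1 : (S.powersetCard γ).filter (fun U => i ∉ U) = (S.erase i).powersetCard γ := by
    ext U
    simp only [Finset.mem_filter, Finset.mem_powersetCard, Finset.subset_erase]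
    tauto
  have h2 := Finset.card_filter_add_card_filter_not (s := S.powersetCard γ) (fun U => i ∈ U)
  rw [h1, Finset.card_powersetCard, Finset.card_powersetCard, Finset.card_erase_of_mem hi] at h2
  obtain ⟨s, hs⟩ : ∃ s, S.card = s + 1 :=
    ⟨S.card - 1, (Nat.succ_pred_eq_of_pos (Finset.card_pos.mpr ⟨i, hi⟩)).symm⟩
  rw [hs] at h2 ⊢
  rcases γ with _ | γ
  · simp at h2 ⊢
  · rw [Nat.add_sub_cancel, Nat.choose_succ_succ'] at h2
    have h3 : ((S.powersetCard (γ + 1)).filter fun U => i ∈ U).card = s.choose γ := by omega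
    rw [h3, mul_comm (γ + 1)]
    exact Nat.add_one_mul_choose_eq s γ

/-- The hypergeometric mean, by double counting: each element of S lies in the fraction γ/|S| of its
γ-subsets. -/
lemma avgSubsets_card_inter {γ : ℕ} {S : Finset (Fin n)} (hγ : γ ≤ S.card) (hS : S.card ≠ 0)
    (W : Finset (Fin n)) :
    avgSubsets γ S (fun U => ((U ∩ W).card : ℝ)) = γ * ((S ∩ W).card : ℝ) / S.card := by
  have h1 : ∑ U ∈ S.powersetCard γ, (U ∩ W).card
      = ∑ i ∈ S ∩ W, ((S.powersetCard γ).filter fun U => i ∈ U).card := by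
    simp only [Finset.card_filter]
    rw [Finset.sum_comm]
    refine Finset.sum_congr rfl fun U hU => ?_
    rw [← Finset.card_filter]
    congr 1
    ext i
    have := @(Finset.mem_powersetCard.mp hU).1 i
    simp only [Finset.mem_inter, Finset.mem_filter]
    tauto
  have h2 : S.card * ∑ U ∈ S.powersetCard γ, (U ∩ W).card
      = (S ∩ W).card * (γ * S.card.choose γ) := by
    rw [h1, Finset.mul_sum, Finset.sum_congr rfl fun i hi =>
      card_powersetCard_filter_mem (Finset.mem_inter.mp hi).1, Finset.sum_const, smul_eq_mul]
  have h3 : (S.card : ℝ) * ∑ U ∈ S.powersetCard γ, ((U ∩ W).card : ℝ)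
      = (S ∩ W).card * (γ * S.card.choose γ) := by exact_mod_cast h2
  have hc : (S.card.choose γ : ℝ) ≠ 0 := by exact_mod_cast (Nat.choose_pos hγ).ne'
  have hs : (S.card : ℝ) ≠ 0 := by exact_mod_cast hS
  rw [avgSubsets, div_eq_div_iff hc hs]
  linarith

/-- This is (a choose γ)/(s choose γ) ≤ (a/s)^γ with denominators cleared; each new factor satisfies
(a-γ)/(s-γ) ≤ a/s. -/
lemma choose_mul_pow_le {a s : ℕ} (h : a ≤ s) (γ : ℕ) :
    a.choose γ * s ^ γ ≤ s.choose γ * a ^ γ := by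
  induction γ with
  | zero => simp
  | succ γ ih =>
    refine Nat.le_of_mul_le_mul_right (c := γ + 1) ?_ (Nat.succ_pos γ)
    have h1 : (a - γ) * s ≤ (s - γ) * a := by
      rw [Nat.sub_mul, Nat.sub_mul, mul_comm s a]
      exact Nat.sub_le_sub_left (Nat.mul_le_mul_left γ h) _
    calc a.choose (γ + 1) * s ^ (γ + 1) * (γ + 1)
        = (a.choose (γ + 1) * (γ + 1)) * (s ^ γ * s) := by ring
      _ = (a.choose γ * s ^ γ) * ((a - γ) * s) := by rw [Nat.choose_succ_right_eq]; ring
      _ ≤ (s.choose γ * a ^ γ) * ((s - γ) * a) := Nat.mul_le_mul ih h1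
      _ = (s.choose γ * (s - γ)) * (a ^ γ * a) := by ring
      _ = s.choose (γ + 1) * a ^ (γ + 1) * (γ + 1) := by rw [← Nat.choose_succ_right_eq]; ring

/-- A γ-subset misses V exactly when it lies in S ∖ V, so the probability is a ratio of binomials,
at most (1 - |S ∩ V|/|S|)^γ. -/
lemma avgSubsets_disjoint_le {γ : ℕ} {S : Finset (Fin n)} (hγ : γ ≤ S.card) (hS : S.card ≠ 0)
    (V : Finset (Fin n)) :
    avgSubsets γ S (fun U => if Disjoint U V then 1 else 0)
      ≤ Real.exp (-(γ * ((S ∩ V).card : ℝ) / S.card)) := by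
  have h1 : ∑ U ∈ S.powersetCard γ, (if Disjoint U V then (1 : ℝ) else 0)
      = ((S \ V).card.choose γ : ℝ) := by
    rw [← Finset.sum_filter, Finset.sum_const, nsmul_eq_mul, mul_one, ← Finset.card_powersetCard]
    congr 2
    ext U
    simp only [Finset.mem_filter, Finset.mem_powersetCard, Finset.subset_sdiff]
    tauto
  have hc : (0 : ℝ) < S.card.choose γ := by exact_mod_cast Nat.choose_pos hγ
  have hs : (0 : ℝ) < S.card := by exact_mod_cast Nat.pos_of_ne_zero hS
  have h2 : ((S \ V).card.choose γ : ℝ) * (S.card : ℝ) ^ γ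
      ≤ S.card.choose γ * ((S \ V).card : ℝ) ^ γ := by
    exact_mod_cast choose_mul_pow_le (Finset.card_le_card Finset.sdiff_subset) γ
  have h3 : ((S \ V).card : ℝ) / S.card ≤ Real.exp (-((S ∩ V).card / S.card : ℝ)) := by
    have h4 : ((S \ V).card : ℝ) = S.card - (S ∩ V).card := by
      rw [eq_sub_iff_add_eq]
      exact_mod_cast Finset.card_sdiff_add_card_inter S V
    rw [h4, sub_div, div_self hs.ne']
    have := Real.add_one_le_exp (-((S ∩ V).card / S.card : ℝ))
    linarith
  rw [avgSubsets, h1, div_le_iff₀ hc]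
  have h5 : Real.exp (-(γ * ((S ∩ V).card : ℝ) / S.card))
      = Real.exp (-((S ∩ V).card / S.card : ℝ)) ^ γ := by
    rw [← Real.exp_nat_mul]
    congr 1
    ring
  rw [h5]
  have h6 := pow_le_pow_left₀ (by positivity) h3 γ
  rw [div_pow, div_le_iff₀ (by positivity)] at h6
  have h7 : ((S \ V).card.choose γ : ℝ) * (S.card : ℝ) ^ γ
      ≤ (Real.exp (-((S ∩ V).card / S.card : ℝ)) ^ γ * S.card.choose γ) * (S.card : ℝ) ^ γ := by
    calc _ ≤ _ := h2
      _ ≤ S.card.choose γ * (Real.exp (-((S ∩ V).card / S.card : ℝ)) ^ γ * (S.card : ℝ) ^ γ) :=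
        mul_le_mul_of_nonneg_left h6 hc.le
      _ = _ := by ring
  exact le_of_mul_le_mul_right h7 (by positivity)

end Subsets

/-! ### The factors of the sharp noise operator -/

section Factor

variable {ℓ κ : ℕ}

lemma one_sub_rate_pow_mem (ℓ s : ℕ) : 0 ≤ 1 - rate ℓ ^ s ∧ 1 - rate ℓ ^ s ≤ 1 := by
  have h1 := pow_nonneg (rate_nonneg ℓ) s
  have h2 := pow_le_one₀ (n := s) (rate_nonneg ℓ) (rate_le_one ℓ)
  constructor <;> linarith

lemma sharpFactor_mem (ℓ κ Δ s : ℕ) : 0 ≤ sharpFactor ℓ κ Δ s ∧ sharpFactor ℓ κ Δ s ≤ 1 := by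
  obtain ⟨h1, h2⟩ := one_sub_rate_pow_mem ℓ s
  have h3 := pow_nonneg h1 κ
  have h4 := pow_le_one₀ (n := κ) h1 h2
  have h5 := pow_nonneg (sub_nonneg.mpr h4) Δ
  have h6 := pow_le_one₀ (n := Δ) (sub_nonneg.mpr h4) (by linarith)
  rw [sharpFactor]
  constructor <;> linarith

/-- Bernoulli's inequality twice: 1 - ρ^s ≤ s/(2ℓ) ≤ 1/2, and then 1 - (1 - y)^Δ ≤ Δy with y ≤
2^{-κ}. -/
lemma sharpFactor_le {s : ℕ} (hℓ : ℓ ≠ 0) (hs : s ≤ ℓ) (κ Δ : ℕ) :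
    sharpFactor ℓ κ Δ s ≤ Δ * (1 / 2) ^ κ := by
  obtain ⟨h1, h2⟩ := one_sub_rate_pow_mem ℓ s
  have hℓ' : (0 : ℝ) < ℓ := by exact_mod_cast Nat.pos_of_ne_zero hℓ
  have hs' : (s : ℝ) ≤ ℓ := by exact_mod_cast hs
  have h3 : 1 - rate ℓ ^ s ≤ 1 / 2 := by
    have hb := one_add_mul_le_pow (a := -(1 / (2 * (ℓ : ℝ)))) (by
      have := rate_nonneg ℓ
      rw [rate] at this
      linarith) s
    have e : 1 + -(1 / (2 * (ℓ : ℝ))) = rate ℓ := by rw [rate]; ring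
    rw [e] at hb
    have : s * (1 / (2 * (ℓ : ℝ))) ≤ 1 / 2 := by
      rw [mul_one_div, div_le_div_iff₀ (by positivity) (by norm_num)]
      linarith
    linarith
  have h4 := pow_le_pow_left₀ h1 h3 κ
  have h5 := pow_le_one₀ (n := κ) h1 h2
  have hb := one_add_mul_le_pow (a := -(1 - rate ℓ ^ s) ^ κ) (by linarith) Δ
  rw [← sub_eq_add_neg, mul_neg, ← sub_eq_add_neg] at hb
  have h6 : Δ * (1 - rate ℓ ^ s) ^ κ ≤ Δ * (1 / 2) ^ κ :=
    mul_le_mul_of_nonneg_left h4 (Nat.cast_nonneg _)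
  rw [sharpFactor]
  linarith

/-- Here ρ^s ≤ e^{-κ/2}, so y = (1 - ρ^s)^κ is at least 1 - κe^{-κ/2} ≥ 9/10. The factor is at least
y, and 0.81 exceeds 1/2. -/
lemma half_le_sharpFactor_sq {s Δ : ℕ} (hℓ : ℓ ≠ 0) (hκ : 100 ≤ κ) (hs : κ * ℓ ≤ s)
    (hΔ : Δ ≠ 0) : 1 / 2 ≤ sharpFactor ℓ κ Δ s ^ 2 := by
  obtain ⟨h1, h2⟩ := one_sub_rate_pow_mem ℓ s
  have hℓ' : (0 : ℝ) < ℓ := by exact_mod_cast Nat.pos_of_ne_zero hℓ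
  have hκ' : (100 : ℝ) ≤ κ := by exact_mod_cast hκ
  have hs' : (κ : ℝ) * ℓ ≤ s := by exact_mod_cast hs
  have h3 : rate ℓ ^ s ≤ Real.exp (-(κ / 2 : ℝ)) := by
    have h : rate ℓ ≤ Real.exp (-(1 / (2 * (ℓ : ℝ)))) := by
      have := Real.add_one_le_exp (-(1 / (2 * (ℓ : ℝ))))
      rw [rate]
      linarith
    refine (pow_le_pow_left₀ (rate_nonneg ℓ) h s).trans ?_
    rw [← Real.exp_nat_mul, Real.exp_le_exp]
    have : (κ / 2 : ℝ) ≤ s * (1 / (2 * (ℓ : ℝ))) := by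
      rw [mul_one_div, div_le_div_iff₀ (by norm_num) (by positivity)]
      linarith
    linarith
  have h4 : κ * Real.exp (-(κ / 2 : ℝ)) ≤ 1 / 10 := by
    have h := Real.quadratic_le_exp_of_nonneg (x := (κ / 2 : ℝ)) (by positivity)
    rw [Real.exp_neg, ← div_eq_mul_inv, div_le_div_iff₀ (Real.exp_pos _) (by norm_num)]
    nlinarith
  have hb := one_add_mul_le_pow (a := -(rate ℓ ^ s)) (by linarith) κ
  rw [← sub_eq_add_neg] at hb
  have h5 : κ * rate ℓ ^ s ≤ κ * Real.exp (-(κ / 2 : ℝ)) :=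
    mul_le_mul_of_nonneg_left h3 (Nat.cast_nonneg _)
  set y := (1 - rate ℓ ^ s) ^ κ with hy
  have hy1 : 9 / 10 ≤ y := by linarith
  have hy2 : y ≤ 1 := pow_le_one₀ h1 h2
  have h6 : (1 - y) ^ Δ ≤ 1 - y := pow_le_of_le_one (by linarith) (by linarith) hΔ
  have h7 : y ≤ sharpFactor ℓ κ Δ s := by
    rw [sharpFactor]
    linarith
  nlinarith

end Factor

/-! ### Size of the parameters -/

section Parameters

/-- The range of parameters. -/
structure Regime (k n : ℕ) (ε : ℝ) : Prop where
  le_k : 2 ^ 100 ≤ k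
  k_le : k ≤ n
  eps_pos : 0 < ε
  eps_lt : ε < 1

lemma le_paramKappa (n : ℕ) (ε : ℝ) : 10 * logRatio n ε ≤ paramKappa n ε := Nat.le_ceil _

lemma le_paramEll (k n : ℕ) (ε : ℝ) : (k : ℝ) ^ (2 / 3 : ℝ) * logRatio n ε ^ 3 ≤ paramEll k n ε := Nat.le_ceil _

lemma le_paramGamma (k n : ℕ) (ε : ℝ) : (k : ℝ) ^ (1 / 3 : ℝ) * logRatio n ε ^ 3 ≤ paramGamma k n ε := Nat.le_ceil _

namespace Regime

variable {k n : ℕ} {ε : ℝ}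

lemma k_large (h : Regime k n ε) : (2 : ℝ) ^ 100 ≤ k := by exact_mod_cast h.le_k

lemma k_pos (h : Regime k n ε) : (0 : ℝ) < k := lt_of_lt_of_le (by positivity) h.k_large

lemma k_le_real (h : Regime k n ε) : (k : ℝ) ≤ n := by exact_mod_cast h.k_le

lemma n_pos (h : Regime k n ε) : (0 : ℝ) < n := h.k_pos.trans_le h.k_le_real

lemma n_ne (h : Regime k n ε) : n ≠ 0 := by
  have := h.n_pos
  rintro rfl
  simp at this

lemma ratio_pos (h : Regime k n ε) : 0 < (n : ℝ) / ε := div_pos h.n_pos h.eps_pos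

lemma n_le_ratio (h : Regime k n ε) : (n : ℝ) ≤ n / ε := by
  rw [le_div_iff₀ h.eps_pos]
  nlinarith [h.n_pos, h.eps_lt]

lemma two_rpow_logRatio (h : Regime k n ε) : (2 : ℝ) ^ logRatio n ε = n / ε :=
  Real.rpow_logb (by norm_num) (by norm_num) h.ratio_pos

lemma logRatio_ge (h : Regime k n ε) : 100 ≤ logRatio n ε := by
  rw [logRatio, Real.le_logb_iff_rpow_le (by norm_num) h.ratio_pos]
  have := h.k_large
  have h2 := h.k_le_real.trans h.n_le_ratio
  rw [show (100 : ℝ) = ((100 : ℕ) : ℝ) by norm_num, Real.rpow_natCast]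
  linarith

lemma log_n_le (h : Regime k n ε) : Real.log n ≤ logRatio n ε := by
  have h1 : Real.log n ≤ Real.log (n / ε) := Real.log_le_log h.n_pos h.n_le_ratio
  have h0 : 0 ≤ Real.log (n / ε) := by
    refine Real.log_nonneg ?_
    have : (1 : ℝ) ≤ n := by exact_mod_cast Nat.one_le_iff_ne_zero.mpr h.n_ne
    linarith [h.n_le_ratio]
  refine h1.trans ?_
  rw [logRatio, Real.logb, le_div_iff₀ (Real.log_pos (by norm_num))]
  have : Real.log 2 ≤ 1 := by linarith [Real.log_two_lt_d9]
  exact mul_le_of_le_one_right h0 this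

lemma x_pos (h : Regime k n ε) : 0 < ε / n := div_pos h.eps_pos h.n_pos

lemma x_le (h : Regime k n ε) : ε / n ≤ 1 / 100 := by
  rw [div_le_div_iff₀ h.n_pos (by norm_num)]
  have h1 := h.k_large
  have h2 := h.k_le_real
  have h3 : (100 : ℝ) ≤ 2 ^ 100 := by norm_num
  linarith [h.eps_lt]

lemma kappa_ge_nat (h : Regime k n ε) : 100 ≤ paramKappa n ε := by
  have h1 := le_paramKappa n ε
  have h2 := h.logRatio_ge
  have : (100 : ℝ) ≤ paramKappa n ε := by linarith
  exact_mod_cast this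

lemma half_pow_kappa_le (h : Regime k n ε) : (1 / 2 : ℝ) ^ paramKappa n ε ≤ (ε / n) ^ 10 := by
  have e : ε / n = (2 : ℝ) ^ (-logRatio n ε) := by
    rw [Real.rpow_neg (by norm_num), h.two_rpow_logRatio, inv_div]
  rw [e, ← Real.rpow_natCast (2 ^ (-logRatio n ε)), ← Real.rpow_mul (by norm_num), one_div,
    ← Real.rpow_natCast, Real.inv_rpow (by norm_num), ← Real.rpow_neg (by norm_num)]
  refine Real.rpow_le_rpow_of_exponent_le (by norm_num) ?_
  have := le_paramKappa n ε
  push_cast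
  linarith

lemma one_le_rpow (h : Regime k n ε) {p : ℝ} (hp : 0 ≤ p) : 1 ≤ (k : ℝ) ^ p :=
  Real.one_le_rpow (by have := h.le_k; exact_mod_cast (by omega : 1 ≤ k)) hp

lemma ell_ne (h : Regime k n ε) : paramEll k n ε ≠ 0 := by
  have h0 := h.logRatio_ge
  have h1 := h.one_le_rpow (p := 2 / 3) (by norm_num)
  refine (Nat.ceil_pos.mpr ?_).ne'
  positivity

lemma gamma_ne (h : Regime k n ε) : paramGamma k n ε ≠ 0 := by
  have h0 := h.logRatio_ge
  have h1 := h.one_le_rpow (p := 1 / 3) (by norm_num)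
  refine (Nat.ceil_pos.mpr ?_).ne'
  positivity

lemma gamma_le_ell (h : Regime k n ε) : paramGamma k n ε ≤ paramEll k n ε := by
  have h0 := h.logRatio_ge
  refine Nat.ceil_le_ceil (mul_le_mul_of_nonneg_right ?_ (by positivity))
  refine Real.rpow_le_rpow_of_exponent_le ?_ (by norm_num)
  have := h.le_k
  exact_mod_cast (by omega : 1 ≤ k)

lemma rpow_mul_rpow (h : Regime k n ε) : (k : ℝ) ^ (1 / 3 : ℝ) * (k : ℝ) ^ (2 / 3 : ℝ) = k := by
  rw [← Real.rpow_add h.k_pos]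
  norm_num

/-- A set that meets `V` in at least `ℓ` elements and has fewer than `100 k Λ` elements is
unlikely to have a random subset of size `γ` disjoint from `V`. -/
lemma exp_neg_le (h : Regime k n ε) {v s : ℕ} (hv : paramEll k n ε ≤ v) (hs : s ≠ 0)
    (hs' : (s : ℝ) < 100 * k * logRatio n ε) :
    Real.exp (-(paramGamma k n ε * (v : ℝ) / s)) ≤ 1 / (n : ℝ) ^ 2 := by
  have h0 := h.logRatio_ge
  set Λ := logRatio n ε
  have hs0 : (0 : ℝ) < s := by exact_mod_cast Nat.pos_of_ne_zero hs
  have hv' : (k : ℝ) ^ (2 / 3 : ℝ) * Λ ^ 3 ≤ v :=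
    (le_paramEll k n ε).trans (by exact_mod_cast hv)
  -- From γv ≥ kΛ⁶ and s < 100kΛ the exponent is at least Λ⁵/100, which Λ ≥ 100 makes at least 2Λ ≥
  -- 2 ln n.
  have h1 : (k : ℝ) * Λ ^ 6 ≤ paramGamma k n ε * (v : ℝ) := by
    calc (k : ℝ) * Λ ^ 6
        = ((k : ℝ) ^ (1 / 3 : ℝ) * Λ ^ 3) * ((k : ℝ) ^ (2 / 3 : ℝ) * Λ ^ 3) := by
          nth_rewrite 1 [← h.rpow_mul_rpow]
          ring
      _ ≤ _ := mul_le_mul (le_paramGamma k n ε) hv' (by positivity) (by positivity)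
  have h2 : 2 * Λ ≤ paramGamma k n ε * (v : ℝ) / s := by
    rw [le_div_iff₀ hs0]
    refine le_trans ?_ h1
    have hk := h.k_pos
    have h4 : (100 : ℝ) ^ 4 ≤ Λ ^ 4 := pow_le_pow_left₀ (by norm_num) h0 4
    calc 2 * Λ * s ≤ 2 * Λ * (100 * k * Λ) := by
          exact mul_le_mul_of_nonneg_left hs'.le (by positivity)
      _ = (k * Λ ^ 2) * 200 := by ring
      _ ≤ (k * Λ ^ 2) * Λ ^ 4 := mul_le_mul_of_nonneg_left (by linarith) (by positivity)
      _ = k * Λ ^ 6 := by ring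
  have h3 : 1 / (n : ℝ) ^ 2 = Real.exp (-(2 * Real.log n)) := by
    rw [Real.exp_neg, one_div, two_mul, Real.exp_add, Real.exp_log h.n_pos, sq]
  rw [h3, Real.exp_le_exp]
  linarith [h.log_n_le]

end Regime

end Parameters

/-! ### One step of the inner loop -/

section Step

variable {n k : ℕ} {ε : ℝ}

/-- The function `h` of the inner loop, with `V = C ∖ C'`. -/
noncomputable def residual (k : ℕ) (ε : ℝ) (f : Cube n → ℝ) (I V : Finset (Fin n)) :
    Cube n → ℝ :=
  sharpDiff (paramEll k n ε) (paramKappa n ε) paramDelta V (aveOver I f)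

lemma algH_law (h : Regime k n ε) {f : Cube n → ℝ} {A : Cube n → Measure ℝ}
    (hA : ∀ x, BoundedLaw 1 (A x) (f x)) (I V : Finset (Fin n)) (x : Cube n) :
    BoundedLaw (boundH n ε) (algH k ε A I V x) (residual k ε f I V x) := by
  refine (algSharpDiff_law (algAve_law hA I) _ _ _ V x).mono ?_
  have h1 : (2 : ℝ) ≤ 2 ^ paramKappa n ε := by
    calc (2 : ℝ) = 2 ^ 1 := by norm_num
      _ ≤ 2 ^ paramKappa n ε :=
        pow_le_pow_right₀ (by norm_num) (by have := h.kappa_ge_nat; omega)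
  have h2 : (1 : ℝ) + 2 ^ paramKappa n ε ≤ 2 ^ (2 * paramKappa n ε) := by
    rw [two_mul, pow_add]
    nlinarith
  have h3 := pow_le_pow_left₀ (by positivity) h2 paramDelta
  rw [← pow_mul] at h3
  rw [boundH]
  linarith

lemma fourierCoef_residual_sq_le (k : ℕ) (ε : ℝ) (f : Cube n → ℝ) (I V S : Finset (Fin n)) :
    fourierCoef (residual k ε f I V) S ^ 2 ≤ fourierCoef (aveOver I f) S ^ 2 := by
  rw [residual, fourierCoef_sharpDiff, mul_pow]
  obtain ⟨h1, h2⟩ := sharpFactor_mem (paramEll k n ε) (paramKappa n ε) paramDelta (S ∩ V).card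
  exact mul_le_of_le_one_left (sq_nonneg _) (pow_le_one₀ h1 h2)

lemma fourierCoef_aveOver_sq_le (f : Cube n → ℝ) (I S : Finset (Fin n)) :
    fourierCoef (aveOver I f) S ^ 2 ≤ fourierCoef f S ^ 2 := by
  rw [fourierCoef_aveOver]
  split_ifs
  · rw [one_mul]
  · rw [zero_mul, zero_pow two_ne_zero]
    exact sq_nonneg _

/-- This is what κ ≥ 10Λ is for: the sharp factor is at most 10·2^{-κ} ≤ 10(ε/n)^10 on these sets,
while the total weight of `f` is at most 1. -/
lemma sum_low_residual_le (h : Regime k n ε) {f : Cube n → ℝ}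
    (hf : ∀ x, f x ∈ Set.Icc (-1 : ℝ) 1) (I V : Finset (Fin n)) :
    ∑ S with (S ∩ V).card < paramEll k n ε, fourierCoef (residual k ε f I V) S ^ 2
      ≤ (ε / n) ^ 5 := by
  have hx0 := h.x_pos
  have hx1 := h.x_le
  calc ∑ S with (S ∩ V).card < paramEll k n ε, fourierCoef (residual k ε f I V) S ^ 2
      ≤ ∑ S with (S ∩ V).card < paramEll k n ε, (10 * (ε / n) ^ 10) ^ 2 * fourierCoef f S ^ 2 := by
        refine Finset.sum_le_sum fun S hS => ?_
        have hS : (S ∩ V).card < paramEll k n ε := by simpa using hS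
        rw [residual, fourierCoef_sharpDiff, mul_pow]
        have h1 := (sharpFactor_mem (paramEll k n ε) (paramKappa n ε) paramDelta (S ∩ V).card).1
        have h2 := sharpFactor_le h.ell_ne hS.le (paramKappa n ε) paramDelta
        have h3 : (paramDelta : ℝ) * (1 / 2) ^ paramKappa n ε ≤ 10 * (ε / n) ^ 10 := by
          have : (paramDelta : ℝ) = 10 := by norm_num [paramDelta]
          rw [this]
          linarith [h.half_pow_kappa_le]
        exact mul_le_mul (pow_le_pow_left₀ h1 (h2.trans h3) 2) (fourierCoef_aveOver_sq_le f I S)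
          (sq_nonneg _) (sq_nonneg _)
    _ ≤ ∑ S, (10 * (ε / n) ^ 10) ^ 2 * fourierCoef f S ^ 2 :=
        Finset.sum_le_sum_of_subset_of_nonneg (Finset.filter_subset _ _)
          fun S _ _ => mul_nonneg (sq_nonneg _) (sq_nonneg _)
    _ ≤ (10 * (ε / n) ^ 10) ^ 2 := by
        rw [← Finset.mul_sum]
        exact mul_le_of_le_one_right (sq_nonneg _) (sum_fourierCoef_sq_le_one hf)
    _ ≤ (ε / n) ^ 5 := by
        have e : (10 * (ε / n) ^ 10) ^ 2 = (ε / n) ^ 5 * ((ε / n) ^ 14 * (100 * (ε / n))) := by ring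
        rw [e]
        refine mul_le_of_le_one_right (by positivity) (mul_le_one₀ (pow_le_one₀ hx0.le ?_)
          (by positivity) ?_) <;> linarith

/-- The Fourier weight of `h` on the sets that are not well placed. -/
lemma sum_bad_residual_le (h : Regime k n ε) {f : Cube n → ℝ}
    (hf : ∀ x, f x ∈ Set.Icc (-1 : ℝ) 1)
    (hfw : weightGE f (100 * (k : ℝ) * logRatio n ε) ≤ (ε / n) ^ 5) (I V Q : Finset (Fin n))
    {t : ℝ} (hω : ∑ S with t ≤ ((S ∩ Q).card : ℝ), fourierCoef (aveOver I f) S ^ 2 ≤ (ε / n) ^ 5) :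
    ∑ S with ¬(paramEll k n ε ≤ (S ∩ V).card ∧ (S.card : ℝ) < 100 * k * logRatio n ε ∧
      ((S ∩ Q).card : ℝ) < t), fourierCoef (residual k ε f I V) S ^ 2 ≤ 3 * (ε / n) ^ 5 := by
  have h1 := sum_low_residual_le h hf I V
  rw [weightGE] at hfw
  rw [Finset.sum_filter] at h1 hfw hω ⊢
  calc _ ≤ ∑ S, ((if (S ∩ V).card < paramEll k n ε then
            fourierCoef (residual k ε f I V) S ^ 2 else 0)
          + (if 100 * k * logRatio n ε ≤ (S.card : ℝ) then fourierCoef f S ^ 2 else 0)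
          + (if t ≤ ((S ∩ Q).card : ℝ) then fourierCoef (aveOver I f) S ^ 2 else 0)) := by
        refine Finset.sum_le_sum fun S _ => ?_
        have e1 := fourierCoef_residual_sq_le k ε f I V S
        have e2 := fourierCoef_aveOver_sq_le f I S
        have e3 := sq_nonneg (fourierCoef (residual k ε f I V) S)
        by_cases c1 : (S ∩ V).card < paramEll k n ε
        · rw [if_pos c1, if_pos (fun hc => absurd hc.1 (not_le.mpr c1))]
          have e4 : 0 ≤ (if 100 * k * logRatio n ε ≤ (S.card : ℝ) then fourierCoef f S ^ 2
            else 0) := by split_ifs <;> positivity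
          have e5 : 0 ≤ (if t ≤ ((S ∩ Q).card : ℝ) then fourierCoef (aveOver I f) S ^ 2
            else 0) := by split_ifs <;> positivity
          linarith
        · rw [if_neg c1]
          by_cases c2 : 100 * k * logRatio n ε ≤ (S.card : ℝ)
          · rw [if_pos c2]
            have e5 : 0 ≤ (if t ≤ ((S ∩ Q).card : ℝ) then fourierCoef (aveOver I f) S ^ 2
              else 0) := by split_ifs <;> positivity
            split_ifs <;> linarith
          · rw [if_neg c2]
            by_cases c3 : t ≤ ((S ∩ Q).card : ℝ)
            · rw [if_pos c3]
              split_ifs <;> linarith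
            · rw [if_neg c3, if_neg]
              · simp
              · exact not_not.mpr ⟨not_lt.mp c1, not_le.mp c2, not_le.mp c3⟩
    _ ≤ 3 * (ε / n) ^ 5 := by
        rw [Finset.sum_add_distrib, Finset.sum_add_distrib]
        linarith

lemma threshold_ge (h : Regime k n ε) : (ε / n) ^ 2 ≤ ε ^ 2 / (k : ℝ) ^ 2 := by
  rw [div_pow]
  exact div_le_div_of_nonneg_left (sq_nonneg _) (by have := h.k_pos; positivity)
    (pow_le_pow_left₀ h.k_pos.le h.k_le_real 2)

/-- Sets smaller than γ ≤ ℓ meet V in fewer than ℓ elements, so their weight is negligible. The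
result bounds below the normalizing weight by which the sampling errors are divided. -/
lemma weightCard_residual_ge (h : Regime k n ε) {f : Cube n → ℝ}
    (hf : ∀ x, f x ∈ Set.Icc (-1 : ℝ) 1) (I V : Finset (Fin n))
    (hnorm : ε ^ 2 / (k : ℝ) ^ 2 / 2 < meanSq (residual k ε f I V)) :
    2 / 5 * (ε ^ 2 / (k : ℝ) ^ 2) ≤ weightCard (residual k ε f I V) (paramGamma k n ε) := by
  have h1 := sum_low_residual_le h hf I V
  have hx0 := h.x_pos
  have hx1 := h.x_le
  have h2 := threshold_ge h
  rw [meanSq, parseval, ← Finset.sum_filter_add_sum_filter_not Finset.univ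
    (fun S => paramGamma k n ε ≤ S.card)] at hnorm
  have h3 : ∑ S with ¬paramGamma k n ε ≤ S.card, fourierCoef (residual k ε f I V) S ^ 2
      ≤ ∑ S with (S ∩ V).card < paramEll k n ε, fourierCoef (residual k ε f I V) S ^ 2 := by
    refine Finset.sum_le_sum_of_subset_of_nonneg (fun S hS => ?_) fun _ _ _ => sq_nonneg _
    simp only [Finset.mem_filter, Finset.mem_univ, true_and, not_le] at hS ⊢
    exact (Finset.card_le_card Finset.inter_subset_left).trans_lt (hS.trans_le h.gamma_le_ell)
  have h4 : (ε / n) ^ 5 ≤ 1 / 10 * (ε / n) ^ 2 := by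
    have e : (ε / n) ^ 5 = (ε / n) ^ 2 * ((ε / n) ^ 2 * (ε / n)) := by ring
    rw [e, mul_comm]
    refine mul_le_mul_of_nonneg_right ?_ (by positivity)
    have : (ε / n) ^ 2 ≤ 1 := pow_le_one₀ hx0.le (by linarith)
    nlinarith
  rw [weightCard]
  linarith

/-- The mean of a function that is at most a supermartingale difference, up to the error
probability of the step. -/
lemma lintegral_sampleT_residual_le (h : Regime k n ε) {c : ℝ} {f : Cube n → ℝ}
    {A : Cube n → Measure ℝ} (hA : ∀ x, BoundedLaw 1 (A x) (f x))
    (hf : ∀ x, f x ∈ Set.Icc (-1 : ℝ) 1)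
    (hfw : weightGE f (100 * (k : ℝ) * logRatio n ε) ≤ (ε / n) ^ 5)
    {I V Q Q' P' : Finset (Fin n)} {t : ℝ}
    (hω : ∑ S with t ≤ ((S ∩ Q).card : ℝ), fourierCoef (aveOver I f) S ^ 2 ≤ (ε / n) ^ 5)
    (hQ : Q' ⊆ Q) (hV : ∀ S, (S ∩ V).card = (S ∩ Q').card + (S ∩ P').card)
    (hnorm : ε ^ 2 / (k : ℝ) ^ 2 / 2 < meanSq (residual k ε f I V))
    {J : Finset (Fin n) → ℝ} {a θ₁ θ₂ : ℝ} (ha : 0 ≤ a) (hθ₁ : 0 ≤ θ₁) (hθ₂ : 0 ≤ θ₂)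
    (hθ : θ₁ * t ≤ θ₂ * (paramEll k n ε - t)) (hJ0 : ∀ T, 0 ≤ J T) (hJ3 : ∀ T, J T ≤ 3)
    (hJ : ∀ T, J T ≤ a + (if Disjoint T V then 1 else 0) + θ₁ * (T ∩ Q').card
      - θ₂ * (T ∩ P').card) :
    ∫⁻ T, ENNReal.ofReal (J T) ∂(sampleT c k ε (algH k ε A I V))
      ≤ ENNReal.ofReal (a + 2 / (n : ℝ) ^ 2) := by
  set g := residual k ε f I V
  set γ := paramGamma k n ε with hγ
  have hn := h.n_pos
  have hx0 := h.x_pos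
  have hx1 := h.x_le
  have hk := h.k_pos
  have hτ := threshold_ge h
  set τ := ε ^ 2 / (k : ℝ) ^ 2
  have hτ0 : 0 < τ := lt_of_lt_of_le (by positivity) hτ
  have hw' := weightCard_residual_ge h hf I V hnorm
  have hw : 0 < weightCard g γ := lt_of_lt_of_le (by positivity) hw'
  -- For γ > n no set would have size at least γ, and the weight just bounded below would be zero.
  have hγn : γ ≤ n := by
    by_contra hc
    have : weightCard g γ = 0 := by
      refine Finset.sum_eq_zero fun S hS => ?_
      have h1 : γ ≤ S.card := by simpa using hS
      have h2 : S.card ≤ n := by simpa using Finset.card_le_univ S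
      omega
    linarith
  refine (lintegral_sampleT_le (algH_law h hA I V) h.eps_pos h.eps_lt h.n_ne h.gamma_ne hγn hw
    hJ0 hJ3).trans (ENNReal.ofReal_le_ofReal ?_)
  rw [div_le_iff₀ hw]
  have hbad := sum_bad_residual_le h hf hfw I V Q hω
  -- On a well placed S the two drift terms cancel by `hθ`, and missing V costs at most 1/n². On the
  -- other sets only J ≤ 3 is used.
  have key : ∑ S, fourierCoef g S ^ 2 * avgSubsets γ S J
      ≤ (a + 1 / (n : ℝ) ^ 2) * weightCard g γ + 3 * (3 * (ε / n) ^ 5) := by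
    refine le_trans ?_ (add_le_add le_rfl (mul_le_mul_of_nonneg_left hbad (by norm_num)))
    rw [weightCard, Finset.mul_sum, Finset.mul_sum, Finset.sum_filter, Finset.sum_filter,
      ← Finset.sum_add_distrib]
    refine Finset.sum_le_sum fun S _ => ?_
    have hsq := sq_nonneg (fourierCoef g S)
    by_cases hS : γ ≤ S.card
    swap
    · rw [avgSubsets_of_lt (not_le.mp hS), if_neg hS, mul_zero]
      split_ifs <;> positivity
    rw [if_pos hS]
    split_ifs with hgood
    swap
    · have : avgSubsets γ S J ≤ 3 := avgSubsets_le hS hJ3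
      have h1 : 0 ≤ (a + 1 / (n : ℝ) ^ 2) * fourierCoef g S ^ 2 := by positivity
      nlinarith [mul_le_mul_of_nonneg_left this hsq]
    · obtain ⟨g1, g2, g3⟩ := hgood
      have hs0 : S.card ≠ 0 := by
        have := h.gamma_ne
        omega
      have hs0' : (0 : ℝ) < S.card := by exact_mod_cast Nat.pos_of_ne_zero hs0
      have e1 : avgSubsets γ S J ≤ a + avgSubsets γ S (fun U => if Disjoint U V then 1 else 0)
          + θ₁ * (γ * (S ∩ Q').card / S.card) - θ₂ * (γ * (S ∩ P').card / S.card) := by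
        refine (avgSubsets_mono hJ).trans_eq ?_
        rw [← avgSubsets_card_inter hS hs0, ← avgSubsets_card_inter hS hs0,
          ← avgSubsets_const_mul, ← avgSubsets_const_mul, ← avgSubsets_const hS a,
          ← avgSubsets_add, ← avgSubsets_add]
        simp only [sub_eq_add_neg, ← neg_one_mul (avgSubsets _ _ _)]
        rw [← avgSubsets_const_mul, ← avgSubsets_add]
        simp only [neg_one_mul, avgSubsets_const hS a]
      have e2 := avgSubsets_disjoint_le hS hs0 V
      have e3 := h.exp_neg_le g1 hs0 g2
      have e4 : θ₁ * ((S ∩ Q').card : ℝ) ≤ θ₂ * (S ∩ P').card := by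
        have i1 : ((S ∩ Q').card : ℝ) ≤ t := by
          have : (S ∩ Q').card ≤ (S ∩ Q).card :=
            Finset.card_le_card (Finset.inter_subset_inter_left hQ)
          have : ((S ∩ Q').card : ℝ) ≤ (S ∩ Q).card := by exact_mod_cast this
          linarith
        have i2 : (paramEll k n ε : ℝ) - t ≤ (S ∩ P').card := by
          rw [hV S] at g1
          have : (paramEll k n ε : ℝ) ≤ (S ∩ Q').card + (S ∩ P').card := by exact_mod_cast g1
          linarith
        calc θ₁ * ((S ∩ Q').card : ℝ) ≤ θ₁ * t := mul_le_mul_of_nonneg_left i1 hθ₁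
          _ ≤ _ := hθ
          _ ≤ _ := mul_le_mul_of_nonneg_left i2 hθ₂
      have e5 : θ₁ * (γ * (S ∩ Q').card / S.card) ≤ θ₂ * (γ * (S ∩ P').card / S.card) := by
        have : 0 ≤ (γ : ℝ) / S.card := by positivity
        calc θ₁ * (γ * (S ∩ Q').card / S.card) = γ / S.card * (θ₁ * ((S ∩ Q').card : ℝ)) := by ring
          _ ≤ γ / S.card * (θ₂ * (S ∩ P').card) := mul_le_mul_of_nonneg_left e4 this
          _ = _ := by ring
      have e6 : avgSubsets γ S J ≤ a + 1 / (n : ℝ) ^ 2 := by linarith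
      rw [add_zero, mul_comm]
      exact mul_le_mul_of_nonneg_right e6 hsq
  -- With x = ε/n, the bad sets cost 9x⁵ and the estimation errors 2·3·x^10. Since the weight is at
  -- least (2/5)x² and x² ≤ 1/n², both fit into the second 1/n².
  have hx5 : 9 * (ε / n) ^ 5 + 6 * (ε / n) ^ 10 ≤ 1 / (n : ℝ) ^ 2 * weightCard g γ := by
    have i1 : (ε / n) ^ 10 ≤ 1 / 6 * (ε / n) ^ 5 := by
      have e : (ε / n) ^ 10 = (ε / n) ^ 4 * (ε / n) * (ε / n) ^ 5 := by ring
      rw [e]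
      refine mul_le_mul_of_nonneg_right ?_ (by positivity)
      have : (ε / n) ^ 4 ≤ 1 := pow_le_one₀ hx0.le (by linarith)
      nlinarith
    have i2 : (ε / n) ^ 5 ≤ 1 / 100 * (1 / (n : ℝ) ^ 2) * (ε / n) ^ 2 := by
      have e : (ε / n) ^ 5 = (ε / n) * (ε / n) ^ 2 * (ε / n) ^ 2 := by ring
      rw [e]
      refine mul_le_mul_of_nonneg_right (mul_le_mul hx1 ?_ (sq_nonneg _) (by norm_num))
        (by positivity)
      rw [div_pow]
      exact div_le_div_of_nonneg_right (pow_le_one₀ h.eps_pos.le h.eps_lt.le) (by positivity)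
    have i3 : 1 / (n : ℝ) ^ 2 * (2 / 5 * (ε / n) ^ 2) ≤ 1 / (n : ℝ) ^ 2 * weightCard g γ :=
      mul_le_mul_of_nonneg_left (by linarith) (by positivity)
    have i4 : 0 ≤ 1 / (n : ℝ) ^ 2 * (ε / n) ^ 2 := by positivity
    nlinarith
  have e : (a + 2 / (n : ℝ) ^ 2) * weightCard g γ = (a + 1 / (n : ℝ) ^ 2) * weightCard g γ
      + 1 / (n : ℝ) ^ 2 * weightCard g γ := by ring
  rw [e]
  linarith

/-- The estimate of the squared norm of `h` is rarely off by half of the threshold. -/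
lemma estimateHSq_far_le (h : Regime k n ε) {f : Cube n → ℝ} {A : Cube n → Measure ℝ}
    (hA : ∀ x, BoundedLaw 1 (A x) (f x)) (I V : Finset (Fin n)) :
    IsProbabilityMeasure (estimateHSq k ε (algH k ε A I V)) ∧
    estimateHSq k ε (algH k ε A I V)
      {σ | ε ^ 2 / (k : ℝ) ^ 2 / 2 ≤ |σ - meanSq (residual k ε f I V)|}
      ≤ ENNReal.ofReal (1 / (150 * n)) := by
  set B := boundH n ε with hB
  have hB1 : 1 ≤ B := one_le_boundH n ε
  have hB2 : 1 ≤ B ^ 2 := one_le_pow₀ hB1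
  have hk := h.k_pos
  have hε := h.eps_pos
  have hn1 : (1 : ℝ) ≤ n := by exact_mod_cast Nat.one_le_iff_ne_zero.mpr h.n_ne
  set a : ℝ := ε ^ 2 / (10 * (k : ℝ) ^ 2) with ha
  have ha0 : 0 < a := by positivity
  have ha1 : a ≤ 1 := by
    rw [ha, div_le_one (by positivity)]
    have : (1 : ℝ) ≤ (k : ℝ) ^ 2 := by
      have := h.k_large
      exact one_le_pow₀ (by linarith [show (1 : ℝ) ≤ 2 ^ 100 by norm_num])
    have : ε ^ 2 ≤ 1 := pow_le_one₀ hε.le h.eps_lt.le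
    linarith
  -- The failure parameter 2^{-n²} puts a factor n² into the sample size. The mean error is then
  -- O(a/n), and Markov's inequality is enough.
  have hN : 1000 * B ^ 4 / a ^ 2 * (n : ℝ) ^ 2 ≤ sampleSize B a (((2 : ℝ) ^ (n ^ 2))⁻¹) := by
    refine le_trans (le_of_eq ?_) (Nat.le_ceil _)
    rw [one_div, inv_inv, Real.logb_pow, Real.logb_self_eq_one (by norm_num)]
    push_cast
    ring
  set N := sampleSize B a (((2 : ℝ) ^ (n ^ 2))⁻¹) with hNdef
  have hNpos : (0 : ℝ) < N := lt_of_lt_of_le (by positivity) hN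
  have hN0 : N ≠ 0 := by
    intro h0
    rw [h0] at hNpos
    simp at hNpos
  have hlaw := algH_law h hA I V
  have herr := estimateSq_error hlaw hN0
  obtain ⟨m, hm, -, -⟩ := estimateSq_law hlaw hN0
  refine ⟨hm.isProb, ?_⟩
  -- The constant 31 comes from 31² ≤ 1000, and later 1/31 + 1/1000 ≤ 1/30 is used.
  have e1 : B ^ 2 / √N ≤ a / (31 * n) := by
    have h1 : 31 * n * B ^ 2 / a ≤ √N := by
      refine Real.le_sqrt_of_sq_le (le_trans ?_ hN)
      have e : (31 * n * B ^ 2 / a) ^ 2 = 961 * B ^ 4 / a ^ 2 * (n : ℝ) ^ 2 := by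
        rw [div_pow]
        ring
      rw [e]
      gcongr
      norm_num
    have hsq : 0 < √(N : ℝ) := Real.sqrt_pos.mpr hNpos
    rw [div_le_div_iff₀ hsq (by positivity)]
    rw [div_le_iff₀ ha0] at h1
    linarith
  have e2 : B ^ 2 / N ≤ a / (1000 * n) := by
    rw [div_le_div_iff₀ hNpos (by positivity)]
    have h1 : B ^ 2 * (1000 * n) ≤ a * (1000 * B ^ 4 / a ^ 2 * (n : ℝ) ^ 2) := by
      have e : a * (1000 * B ^ 4 / a ^ 2 * (n : ℝ) ^ 2)
          = (B ^ 2 * (1000 * n)) * (B ^ 2 * n / a) := by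
        field_simp
      rw [e]
      refine le_mul_of_one_le_right (by positivity) ?_
      rw [le_div_iff₀ ha0]
      nlinarith [mul_le_mul hB2 hn1 zero_le_one (by positivity)]
    exact h1.trans (mul_le_mul_of_nonneg_left hN ha0.le)
  have e3 : B ^ 2 / √N + B ^ 2 / N ≤ 5 * a * (1 / (150 * n)) := by
    have h1 : a / (31 * n) + a / (1000 * n) = a / n * (1031 / 31000) := by
      field_simp
      norm_num
    have h2 : 5 * a * (1 / (150 * n)) = a / n * (1 / 30) := by
      field_simp
      norm_num
    rw [h2]
    have : 0 ≤ a / n := by positivity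
    nlinarith
  have hthr : ε ^ 2 / (k : ℝ) ^ 2 / 2 = 5 * a := by
    rw [ha]
    field_simp
    norm_num
  have hmk := mul_meas_ge_le_lintegral (μ := estimateHSq k ε (algH k ε A I V))
    (f := fun σ => ENNReal.ofReal |σ - meanSq (residual k ε f I V)|) (by fun_prop)
    (ENNReal.ofReal (5 * a))
  have hset : {σ : ℝ | ε ^ 2 / (k : ℝ) ^ 2 / 2 ≤ |σ - meanSq (residual k ε f I V)|}
      = {σ | ENNReal.ofReal (5 * a) ≤ ENNReal.ofReal |σ - meanSq (residual k ε f I V)|} := by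
    ext σ
    rw [Set.mem_ofPred_eq, Set.mem_ofPred_eq, hthr, ENNReal.ofReal_le_ofReal_iff (abs_nonneg _)]
  rw [hset]
  have h5 : ENNReal.ofReal (5 * a) ≠ 0 := by
    rw [ne_eq, ENNReal.ofReal_eq_zero, not_le]
    positivity
  have hfin := (hmk.trans herr).trans (ENNReal.ofReal_le_ofReal e3)
  rw [ENNReal.ofReal_mul (by positivity : 0 ≤ 5 * a)] at hfin
  exact (ENNReal.mul_le_mul_iff_right h5 ENNReal.ofReal_ne_top).mp hfin

end Step

/-! ### The inner loop -/

section InnerLoop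

variable {n k : ℕ} {ε c : ℝ}

/-- The Fourier weight of `f_ave^I` on the sets with many elements in `C ∖ D`. -/
noncomputable def tailWeight (k : ℕ) (ε : ℝ) (f : Cube n → ℝ) (C I D : Finset (Fin n)) : ℝ :=
  ∑ S : Finset (Fin n) with paramKappa n ε * paramEll k n ε ≤ ((S ∩ C) \ D).card,
    fourierCoef (aveOver I f) S ^ 2

/-- With V = C ∖ D every set of the tail has |S ∩ V| ≥ κℓ, where the squared sharp factor is at
least 1/2. A small norm of h therefore certifies a light tail. -/
lemma tailWeight_le (h : Regime k n ε) (f : Cube n → ℝ) (C I D : Finset (Fin n)) :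
    tailWeight k ε f C I D ≤ 2 * meanSq (residual k ε f I (C \ D)) := by
  rw [meanSq, parseval, Finset.mul_sum, tailWeight]
  refine le_trans (Finset.sum_le_sum fun S hS => ?_)
    (Finset.sum_le_sum_of_subset_of_nonneg (Finset.filter_subset _ _)
      fun _ _ _ => mul_nonneg zero_le_two (sq_nonneg _))
  have hS : paramKappa n ε * paramEll k n ε ≤ ((S ∩ C) \ D).card := by simpa using hS
  rw [Finset.inter_sdiff_assoc] at hS
  have h1 := half_le_sharpFactor_sq (Δ := paramDelta) h.ell_ne h.kappa_ge_nat hS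
    (by norm_num [paramDelta])
  rw [residual, fourierCoef_sharpDiff, mul_pow]
  nlinarith [sq_nonneg (fourierCoef (aveOver I f) S)]

open scoped Classical in
/-- The cost of leaving the inner loop with the set `D`. -/
noncomputable def exitCost (k : ℕ) (ε : ℝ) (f : Cube n → ℝ) (C I Q D : Finset (Fin n)) : ℝ :=
  (if 4 * ε ^ 2 / (k : ℝ) ^ 2 < tailWeight k ε f C I D then 1 else 0)
    + 2 / Q.card * (D ∩ Q).card

lemma exitCost_nonneg (k : ℕ) (ε : ℝ) (f : Cube n → ℝ) (C I Q D : Finset (Fin n)) :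
    0 ≤ exitCost k ε f C I Q D := by
  unfold exitCost
  split_ifs <;> positivity

lemma exitCost_le (k : ℕ) (ε : ℝ) (f : Cube n → ℝ) (C I Q D : Finset (Fin n)) :
    exitCost k ε f C I Q D ≤ 1 + 2 / Q.card * (D ∩ Q).card := by
  unfold exitCost
  split_ifs <;> linarith

lemma exitCost_le_three (k : ℕ) (ε : ℝ) (f : Cube n → ℝ) (C I Q D : Finset (Fin n)) :
    exitCost k ε f C I Q D ≤ 3 := by
  have h1 := exitCost_le k ε f C I Q D
  have h2 : (2 : ℝ) / Q.card * (D ∩ Q).card ≤ 2 := by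
    rcases Nat.eq_zero_or_pos Q.card with h0 | h0
    · simp [h0]
    · have h0' : (0 : ℝ) < Q.card := by exact_mod_cast h0
      have : ((D ∩ Q).card : ℝ) ≤ Q.card := by
        exact_mod_cast Finset.card_le_card Finset.inter_subset_right
      rw [div_mul_eq_mul_div, div_le_iff₀ h0']
      linarith
  linarith

lemma exitCost_eq_of_small (h : Regime k n ε) {f : Cube n → ℝ} {C I Q D : Finset (Fin n)}
    (hs : meanSq (residual k ε f I (C \ D)) ≤ 2 * (ε ^ 2 / (k : ℝ) ^ 2)) :
    exitCost k ε f C I Q D = 2 / Q.card * (D ∩ Q).card := by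
  have h1 := tailWeight_le h f C I D
  unfold exitCost
  rw [if_neg, zero_add]
  rw [not_lt, mul_div_assoc]
  linarith

/-- The set after one more step of the inner loop, for a given sample `T`. -/
noncomputable def afterSample (c : ℝ) (k : ℕ) (ε : ℝ) (A : Cube n → Measure ℝ)
    (C I D T : Finset (Fin n)) : Measure (Finset (Fin n)) :=
  if T ∩ C ⊆ D then Measure.dirac D else innerLoop c k ε A C I (D ∪ (T ∩ C))

lemma innerLoop_eq (A : Cube n → Measure ℝ) (C I D : Finset (Fin n)) :
    innerLoop c k ε A C I D = (estimateHSq k ε (algH k ε A I (C \ D))).bind fun σ =>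
      if σ ≤ ε ^ 2 / (k : ℝ) ^ 2 then Measure.dirac D
      else (sampleT c k ε (algH k ε A I (C \ D))).bind (afterSample c k ε A C I D) := by
  rw [innerLoop]
  simp only [dite_eq_ite]
  rfl

lemma card_sdiff_afterSample_lt {C D T : Finset (Fin n)} (hT : ¬T ∩ C ⊆ D) :
    (C \ (D ∪ (T ∩ C))).card < (C \ D).card := by
  obtain ⟨a, ha, hD⟩ := Finset.not_subset.mp hT
  refine Finset.card_lt_card ((Finset.ssubset_iff_of_subset
    (Finset.sdiff_subset_sdiff Finset.Subset.rfl Finset.subset_union_left)).mpr ⟨a, ?_, ?_⟩)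
  · exact Finset.mem_sdiff.mpr ⟨(Finset.mem_inter.mp ha).2, hD⟩
  · exact fun hm => (Finset.mem_sdiff.mp hm).2 (Finset.mem_union_right _ ha)

/-- The error per step of the inner loop. -/
noncomputable def stepError (n : ℕ) : ℝ := 2 / (n : ℝ) ^ 2 + 1 / (50 * n)

/-- The bound on the expected cost of the inner loop that is started from `D`. -/
noncomputable def potential (C R D : Finset (Fin n)) (θ : ℝ) : ℝ :=
  2 / ((C ∩ Rᶜ).card : ℝ) * (D ∩ (C ∩ Rᶜ)).card + θ * ((C ∩ R) \ D).card
    + stepError n * ((C \ D).card + 1)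

lemma stepError_nonneg (n : ℕ) : 0 ≤ stepError n := by
  unfold stepError
  positivity

/-- A continuing step removes at least one element from C ∖ D. This releases one `stepError`, which
is why the right-hand side has no `+ 1`. -/
lemma potential_afterSample_le (C R D T : Finset (Fin n)) (θ : ℝ) (hT : ¬T ∩ C ⊆ D) :
    potential C R (D ∪ (T ∩ C)) θ ≤
      (2 / ((C ∩ Rᶜ).card : ℝ) * (D ∩ (C ∩ Rᶜ)).card + θ * ((C ∩ R) \ D).card
        + stepError n * (C \ D).card)
      + 2 / ((C ∩ Rᶜ).card : ℝ) * (T ∩ ((C ∩ Rᶜ) \ D)).card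
      - θ * (T ∩ ((C ∩ R) \ D)).card := by
  have h1 : ((D ∪ (T ∩ C)) ∩ (C ∩ Rᶜ)).card
      ≤ (D ∩ (C ∩ Rᶜ)).card + (T ∩ ((C ∩ Rᶜ) \ D)).card := by
    refine le_trans (Finset.card_le_card ?_) (Finset.card_union_le _ _)
    intro i
    simp only [Finset.mem_inter, Finset.mem_union, Finset.mem_sdiff]
    tauto
  have h2 : ((C ∩ R) \ (D ∪ (T ∩ C))).card + (T ∩ ((C ∩ R) \ D)).card = ((C ∩ R) \ D).card := by
    have e : (C ∩ R) \ (D ∪ (T ∩ C)) = ((C ∩ R) \ D) \ T := by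
      ext i
      simp only [Finset.mem_inter, Finset.mem_union, Finset.mem_sdiff]
      tauto
    rw [e, Finset.inter_comm T, Finset.card_sdiff_add_card_inter]
  have h3 := card_sdiff_afterSample_lt hT
  have h1' : (((D ∪ (T ∩ C)) ∩ (C ∩ Rᶜ)).card : ℝ)
      ≤ (D ∩ (C ∩ Rᶜ)).card + (T ∩ ((C ∩ Rᶜ) \ D)).card := by exact_mod_cast h1
  have h2' : (((C ∩ R) \ (D ∪ (T ∩ C))).card : ℝ)
      = ((C ∩ R) \ D).card - (T ∩ ((C ∩ R) \ D)).card := by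
    rw [eq_sub_iff_add_eq]
    exact_mod_cast h2
  have h3' : ((C \ (D ∪ (T ∩ C))).card : ℝ) + 1 ≤ (C \ D).card := by exact_mod_cast h3
  have e1 := mul_le_mul_of_nonneg_left h1'
    (by positivity : (0 : ℝ) ≤ 2 / ((C ∩ Rᶜ).card : ℝ))
  have e3 := mul_le_mul_of_nonneg_left h3' (stepError_nonneg n)
  rw [potential, h2']
  linarith

lemma innerLoop_isProb_subset (h : Regime k n ε) {f : Cube n → ℝ} {A : Cube n → Measure ℝ}
    (hA : ∀ x, BoundedLaw 1 (A x) (f x)) {C : Finset (Fin n)} (I : Finset (Fin n))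
    {D : Finset (Fin n)} (hD : D ⊆ C) :
    IsProbabilityMeasure (innerLoop c k ε A C I D) ∧
      innerLoop c k ε A C I D {E | ¬E ⊆ C} = 0 := by
  induction hm : (C \ D).card using Nat.strong_induction_on generalizing D with
  | _ m ih =>
    have hS : IsProbabilityMeasure (sampleT c k ε (algH k ε A I (C \ D))) :=
      isProb_sampleT (algH_law h hA I (C \ D)) h.eps_pos h.eps_lt h.n_ne h.gamma_ne
    have hE := (estimateHSq_far_le h hA I (C \ D)).1
    have hT : ∀ T, IsProbabilityMeasure (afterSample c k ε A C I D T) ∧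
        afterSample c k ε A C I D T {E | ¬E ⊆ C} = 0 := by
      intro T
      unfold afterSample
      split_ifs with hTD
      · refine ⟨inferInstance, ?_⟩
        rw [Measure.dirac_apply' _ (MeasurableSet.of_discrete)]
        simp [hD]
      · exact ih _ (hm ▸ card_sdiff_afterSample_lt hTD)
          (Finset.union_subset hD Finset.inter_subset_right) rfl
    have hmeas : Measurable fun σ : ℝ => if σ ≤ ε ^ 2 / (k : ℝ) ^ 2 then Measure.dirac D
        else (sampleT c k ε (algH k ε A I (C \ D))).bind (afterSample c k ε A C I D) :=
      Measurable.ite measurableSet_Iic measurable_const measurable_const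
    rw [innerLoop_eq]
    refine ⟨BoundedLaw.isProb_bind hmeas.aemeasurable (ae_of_all _ fun σ => ?_), ?_⟩
    · split_ifs
      · infer_instance
      · exact BoundedLaw.isProb_bind (Measurable.of_discrete).aemeasurable
          (ae_of_all _ fun T => (hT T).1)
    · rw [Measure.bind_apply (MeasurableSet.of_discrete) hmeas.aemeasurable]
      refine lintegral_eq_zero_of_ae_eq_zero (ae_of_all _ fun σ => ?_)
      simp only [Pi.zero_apply]
      split_ifs
      · rw [Measure.dirac_apply' _ (MeasurableSet.of_discrete)]
        simp [hD]
      · rw [Measure.bind_apply (MeasurableSet.of_discrete)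
          (Measurable.of_discrete).aemeasurable]
        exact lintegral_eq_zero_of_ae_eq_zero (ae_of_all _ fun T => (hT T).2)

/-- The expected cost of the inner loop. -/
lemma lintegral_innerLoop_exitCost_le (h : Regime k n ε) {f : Cube n → ℝ}
    {A : Cube n → Measure ℝ} (hA : ∀ x, BoundedLaw 1 (A x) (f x))
    (hf : ∀ x, f x ∈ Set.Icc (-1 : ℝ) 1)
    (hfw : weightGE f (100 * (k : ℝ) * logRatio n ε) ≤ (ε / n) ^ 5)
    {C R I : Finset (Fin n)} {t θ : ℝ}
    (hω : ∑ S with t ≤ ((S ∩ (C ∩ Rᶜ)).card : ℝ), fourierCoef (aveOver I f) S ^ 2 ≤ (ε / n) ^ 5)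
    (hθ0 : 0 ≤ θ) (hθ : 2 / ((C ∩ Rᶜ).card : ℝ) * t ≤ θ * (paramEll k n ε - t))
    {D : Finset (Fin n)} (hD : D ⊆ C) :
    ∫⁻ E, ENNReal.ofReal (exitCost k ε f C I (C ∩ Rᶜ) E) ∂(innerLoop c k ε A C I D)
      ≤ ENNReal.ofReal (potential C R D θ) := by
  induction hm : (C \ D).card using Nat.strong_induction_on generalizing D with
  | _ m ih =>
    set Q := C ∩ Rᶜ with hQ
    set cost : Finset (Fin n) → ENNReal := fun E => ENNReal.ofReal (exitCost k ε f C I Q E)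
      with hcost
    have hmc : Measurable cost := Measurable.of_discrete
    have hcost3 : ∀ E, cost E ≤ ENNReal.ofReal 3 := fun E =>
      ENNReal.ofReal_le_ofReal (exitCost_le_three _ _ _ _ _ _ _)
    set τ := ε ^ 2 / (k : ℝ) ^ 2 with hτ
    set ν := meanSq (residual k ε f I (C \ D)) with hν
    -- The potential at `D` without one `stepError`; that remainder is the error budget of the
    -- present step.
    set a := 2 / (Q.card : ℝ) * (D ∩ Q).card + θ * ((C ∩ R) \ D).card
        + stepError n * (C \ D).card with ha
    have hη := stepError_nonneg n
    have ha0 : 0 ≤ a := by positivity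
    obtain ⟨hE, hfar⟩ := estimateHSq_far_le h hA I (C \ D)
    have hS : IsProbabilityMeasure (sampleT c k ε (algH k ε A I (C \ D))) :=
      isProb_sampleT (algH_law h hA I (C \ D)) h.eps_pos h.eps_lt h.n_ne h.gamma_ne
    have hTp : ∀ T, IsProbabilityMeasure (afterSample c k ε A C I D T) := by
      intro T
      unfold afterSample
      split_ifs with hTD
      · infer_instance
      · exact (innerLoop_isProb_subset h hA I
          (Finset.union_subset hD Finset.inter_subset_right)).1
    have hj3 : ∀ T, ∫⁻ E, cost E ∂(afterSample c k ε A C I D T) ≤ ENNReal.ofReal 3 := by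
      intro T
      have := hTp T
      calc _ ≤ ∫⁻ _E, ENNReal.ofReal 3 ∂(afterSample c k ε A C I D T) := lintegral_mono hcost3
        _ = ENNReal.ofReal 3 := by simp
    set J : Finset (Fin n) → ℝ := fun T => (∫⁻ E, cost E ∂(afterSample c k ε A C I D T)).toReal
      with hJ
    have hJof : ∀ T, ENNReal.ofReal (J T) = ∫⁻ E, cost E ∂(afterSample c k ε A C I D T) :=
      fun T => ENNReal.ofReal_toReal ((hj3 T).trans_lt ENNReal.ofReal_lt_top).ne
    have hJ0 : ∀ T, 0 ≤ J T := fun T => ENNReal.toReal_nonneg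
    have hJ3 : ∀ T, J T ≤ 3 := fun T =>
      ENNReal.toReal_le_of_le_ofReal (by norm_num) (hj3 T)
    have hJle : ∀ T, J T ≤ a + (if Disjoint T (C \ D) then 1 else 0)
        + 2 / (Q.card : ℝ) * (T ∩ (Q \ D)).card - θ * (T ∩ ((C ∩ R) \ D)).card := by
      intro T
      by_cases hTD : T ∩ C ⊆ D
      -- The loop stops because `T` brings nothing new. Then `T` misses C ∖ D, and the indicator
      -- pays for a possibly heavy tail.
      · have hdis : Disjoint T (C \ D) := by
          rw [Finset.disjoint_left]
          intro i hi hi2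
          have h2 := Finset.mem_sdiff.mp hi2
          exact h2.2 (hTD (Finset.mem_inter.mpr ⟨hi, h2.1⟩))
        have hP : T ∩ ((C ∩ R) \ D) = ∅ := by
          refine Finset.disjoint_iff_inter_eq_empty.mp (hdis.mono_right ?_)
          exact Finset.sdiff_subset_sdiff Finset.inter_subset_left Finset.Subset.rfl
        have e : J T = exitCost k ε f C I Q D := by
          simp only [hJ]
          rw [afterSample, if_pos hTD, lintegral_dirac,
            ENNReal.toReal_ofReal (exitCost_nonneg _ _ _ _ _ _ _)]
        have h1 := exitCost_le k ε f C I Q D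
        have h2 : 0 ≤ 2 / (Q.card : ℝ) * (T ∩ (Q \ D)).card := by positivity
        have h3 : 0 ≤ θ * (((C ∩ R) \ D).card : ℝ) := by positivity
        have h4 : 0 ≤ stepError n * ((C \ D).card : ℝ) := by positivity
        rw [e, if_pos hdis, hP, Finset.card_empty, Nat.cast_zero, mul_zero, sub_zero]
        linarith
      · have hi := ih _ (hm ▸ card_sdiff_afterSample_lt hTD)
          (Finset.union_subset hD Finset.inter_subset_right) rfl
        have hp := potential_afterSample_le C R D T θ hTD
        have hp0 : 0 ≤ potential C R (D ∪ (T ∩ C)) θ := by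
          unfold potential
          positivity
        have e : J T ≤ potential C R (D ∪ (T ∩ C)) θ := by
          simp only [hJ]
          rw [afterSample, if_neg hTD]
          exact ENNReal.toReal_le_of_le_ofReal hp0 hi
        have h5 : (0 : ℝ) ≤ if Disjoint T (C \ D) then 1 else 0 := by split_ifs <;> norm_num
        linarith
    have hV : ∀ S, (S ∩ (C \ D)).card = (S ∩ (Q \ D)).card + (S ∩ ((C ∩ R) \ D)).card := by
      intro S
      rw [← Finset.card_union_of_disjoint]
      · congr 1
        ext i
        simp only [hQ, Finset.mem_inter, Finset.mem_union, Finset.mem_sdiff, Finset.mem_compl]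
        tauto
      · rw [Finset.disjoint_left]
        intro i
        simp only [hQ, Finset.mem_inter, Finset.mem_sdiff, Finset.mem_compl]
        tauto
    set Y := ∫⁻ T, ENNReal.ofReal (J T) ∂(sampleT c k ε (algH k ε A I (C \ D))) with hY
    have hY3 : Y ≤ ENNReal.ofReal 3 := by
      calc Y ≤ ∫⁻ _T, ENNReal.ofReal 3 ∂(sampleT c k ε (algH k ε A I (C \ D))) :=
            lintegral_mono fun T => ENNReal.ofReal_le_ofReal (hJ3 T)
        _ = ENNReal.ofReal 3 := by simp
    have hYle : τ / 2 < ν → Y ≤ ENNReal.ofReal (a + 2 / (n : ℝ) ^ 2) := fun hn =>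
      lintegral_sampleT_residual_le h hA hf hfw hω Finset.sdiff_subset hV hn ha0
        (by positivity) hθ0 hθ hJ0 hJ3 hJle
    have hmeas : Measurable fun σ : ℝ => if σ ≤ τ then Measure.dirac D
        else (sampleT c k ε (algH k ε A I (C \ D))).bind (afterSample c k ε A C I D) :=
      Measurable.ite measurableSet_Iic measurable_const measurable_const
    have hfarm : MeasurableSet {σ : ℝ | τ / 2 ≤ |σ - ν|} :=
      measurableSet_le measurable_const (by fun_prop)
    rw [innerLoop_eq, Measure.lintegral_bind hmeas.aemeasurable hmc.aemeasurable]
    have hτ0 : 0 < τ := by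
      have := h.k_pos
      have := h.eps_pos
      positivity
    -- Unless σ is off by τ/2 or more, exiting at σ ≤ τ forces ν ≤ 3τ/2 and hence a light tail, and
    -- continuing forces ν > τ/2, so that the one-step bound applies. On the exceptional event the
    -- cost is at most 3.
    calc _ ≤ ∫⁻ σ, (ENNReal.ofReal (a + 2 / (n : ℝ) ^ 2)
            + {σ : ℝ | τ / 2 ≤ |σ - ν|}.indicator (fun _ => ENNReal.ofReal 3) σ)
            ∂(estimateHSq k ε (algH k ε A I (C \ D))) := by
          refine lintegral_mono fun σ => ?_
          have hval : ∫⁻ E, cost E ∂(if σ ≤ τ then Measure.dirac D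
              else (sampleT c k ε (algH k ε A I (C \ D))).bind (afterSample c k ε A C I D))
              = if σ ≤ τ then cost D else Y := by
            split_ifs
            · rw [lintegral_dirac]
            · rw [Measure.lintegral_bind (Measurable.of_discrete).aemeasurable hmc.aemeasurable,
                hY]
              simp only [hJof]
          simp only [hval]
          by_cases hσ : τ / 2 ≤ |σ - ν|
          · rw [Set.indicator_of_mem (by exact hσ)]
            refine le_trans ?_ le_add_self
            split_ifs
            · exact hcost3 D
            · exact hY3
          · have hlt := abs_lt.mp (not_le.mp hσ)
            refine le_trans ?_ le_self_add
            split_ifs with hle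
            · have hc : cost D = ENNReal.ofReal (2 / Q.card * (D ∩ Q).card) := by
                simp only [hcost]
                rw [exitCost_eq_of_small h (by rw [← hν, ← hτ]; linarith)]
              rw [hc]
              refine ENNReal.ofReal_le_ofReal ?_
              have h3 : 0 ≤ θ * (((C ∩ R) \ D).card : ℝ) := by positivity
              have h4 : 0 ≤ stepError n * ((C \ D).card : ℝ) := by positivity
              have h5 : 0 ≤ 2 / (n : ℝ) ^ 2 := by positivity
              linarith
            · exact hYle (by linarith)
      _ ≤ ENNReal.ofReal (a + 2 / (n : ℝ) ^ 2)
            + ENNReal.ofReal 3 * ENNReal.ofReal (1 / (150 * n)) := by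
          rw [lintegral_add_left measurable_const, lintegral_const, measure_univ, mul_one,
            lintegral_indicator_const hfarm]
          gcongr
      _ = ENNReal.ofReal (potential C R D θ) := by
          have h5 : 0 ≤ 2 / (n : ℝ) ^ 2 := by positivity
          rw [← ENNReal.ofReal_mul (by norm_num), ← ENNReal.ofReal_add (by linarith)
            (by positivity), potential, ← hQ]
          congr 1
          have e : stepError n = 2 / (n : ℝ) ^ 2 + 3 * (1 / (150 * n)) := by
            rw [stepError]
            have := h.n_pos
            field_simp
            ring
          rw [mul_add, mul_one]
          nth_rewrite 2 [e]
          rw [ha]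
          ring

end InnerLoop

/-! ### One repetition of the outer loop -/

section OuterLoop

variable {n k : ℕ} {ε c : ℝ}

/-- The threshold for `|S ∩ C ∖ R|` above which `S` is likely to be hit by the random set `I`. -/
noncomputable def hitThreshold (k : ℕ) (C R : Finset (Fin n)) : ℝ :=
  (k : ℝ) ^ (2 / 3 : ℝ) * (C ∩ Rᶜ).card / (max C.card k : ℕ)

lemma max_pos (h : Regime k n ε) (C : Finset (Fin n)) : (0 : ℝ) < (max C.card k : ℕ) :=
  h.k_pos.trans_le (by exact_mod_cast le_max_right _ _)

/-- The drift of the potential of the inner loop. -/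
noncomputable def drift (k : ℕ) (ε : ℝ) (C R : Finset (Fin n)) : ℝ :=
  2 / ((C ∩ Rᶜ).card : ℝ) * hitThreshold k C R / (paramEll k n ε - hitThreshold k C R)

lemma hitThreshold_le (h : Regime k n ε) (C R : Finset (Fin n)) :
    hitThreshold k C R ≤ (k : ℝ) ^ (2 / 3 : ℝ) := by
  have hb : ((C ∩ Rᶜ).card : ℝ) ≤ (max C.card k : ℕ) := by
    exact_mod_cast (Finset.card_le_card Finset.inter_subset_left).trans (le_max_left _ _)
  rw [hitThreshold, div_le_iff₀ (max_pos h C)]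
  exact mul_le_mul_of_nonneg_left hb (by positivity)

lemma ell_sub_hitThreshold_ge (h : Regime k n ε) (C R : Finset (Fin n)) :
    (k : ℝ) ^ (2 / 3 : ℝ) * 1000 ≤ paramEll k n ε - hitThreshold k C R := by
  have h1 := hitThreshold_le h C R
  have h2 := le_paramEll k n ε
  have h3 := h.logRatio_ge
  have h4 : (100 : ℝ) ^ 3 ≤ logRatio n ε ^ 3 := pow_le_pow_left₀ (by norm_num) h3 3
  have h5 : (0 : ℝ) ≤ (k : ℝ) ^ (2 / 3 : ℝ) := by positivity
  nlinarith [mul_le_mul_of_nonneg_left h4 h5]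

lemma hitThreshold_nonneg (k : ℕ) (C R : Finset (Fin n)) : 0 ≤ hitThreshold k C R := by
  unfold hitThreshold
  positivity

lemma ell_sub_pos (h : Regime k n ε) (C R : Finset (Fin n)) :
    0 < (paramEll k n ε : ℝ) - hitThreshold k C R := by
  have := h.one_le_rpow (p := 2 / 3) (by norm_num)
  linarith [ell_sub_hitThreshold_ge h C R]

lemma drift_nonneg (h : Regime k n ε) (C R : Finset (Fin n)) : 0 ≤ drift k ε C R :=
  div_nonneg (mul_nonneg (by positivity) (hitThreshold_nonneg k C R)) (ell_sub_pos h C R).le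

/-- This is the drift reward available over the whole loop. The bound |C ∩ R| ≤ k ≤ β cancels β in
the threshold t and leaves 2k^{2/3}/(ℓ - t), where ℓ - t ≥ 1000k^{2/3}. -/
lemma drift_mul_card_le (h : Regime k n ε) {C R : Finset (Fin n)} (hR : R.card = k)
    (hC : (C ∩ Rᶜ).Nonempty) : drift k ε C R * (C ∩ R).card ≤ 1 / 100 := by
  have hb : (0 : ℝ) < (C ∩ Rᶜ).card := by exact_mod_cast Finset.card_pos.mpr hC
  have hβ := max_pos h C
  have hr : ((C ∩ R).card : ℝ) ≤ (max C.card k : ℕ) := by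
    exact_mod_cast ((Finset.card_le_card Finset.inter_subset_right).trans_eq hR).trans
      (le_max_right _ _)
  have hk := h.one_le_rpow (p := 2 / 3) (by norm_num)
  have h1 := ell_sub_hitThreshold_ge h C R
  have h2 := ell_sub_pos h C R
  have e : 2 / ((C ∩ Rᶜ).card : ℝ) * hitThreshold k C R * (C ∩ R).card
      = 2 * (k : ℝ) ^ (2 / 3 : ℝ) * ((C ∩ R).card / (max C.card k : ℕ)) := by
    rw [hitThreshold]
    field_simp
  have h3 : ((C ∩ R).card : ℝ) / (max C.card k : ℕ) ≤ 1 := (div_le_one hβ).mpr hr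
  rw [drift, div_mul_eq_mul_div, e, div_le_iff₀ h2]
  have h4 : 2 * (k : ℝ) ^ (2 / 3 : ℝ) * ((C ∩ R).card / (max C.card k : ℕ))
      ≤ 2 * (k : ℝ) ^ (2 / 3 : ℝ) := mul_le_of_le_one_right (by positivity) h3
  linarith

/-- The drift contributes at most 1/100, and the errors of at most |C| + 1 ≤ 2n steps add at most
1/10. -/
lemma potential_empty_le (h : Regime k n ε) {C R : Finset (Fin n)} (hR : R.card = k)
    (hC : (C ∩ Rᶜ).Nonempty) : potential C R ∅ (drift k ε C R) ≤ 1 / 4 := by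
  have h1 := drift_mul_card_le h hR hC
  have hn := h.n_pos
  have hn1 : (100 : ℝ) ≤ n := by
    have := h.k_large
    have := h.k_le_real
    linarith [show (100 : ℝ) ≤ 2 ^ 100 by norm_num]
  have h2 : (C.card : ℝ) + 1 ≤ 2 * n := by
    have : (C.card : ℝ) ≤ n := by
      exact_mod_cast (Finset.card_le_univ C).trans_eq (Fintype.card_fin n)
    linarith
  have h3 : stepError n * ((C.card : ℝ) + 1) ≤ 1 / 10 := by
    refine (mul_le_mul_of_nonneg_left h2 (stepError_nonneg n)).trans ?_
    have e : stepError n * (2 * n) = 4 / n + 1 / 25 := by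
      rw [stepError]
      field_simp
      ring
    have : (4 : ℝ) / n ≤ 4 / 100 := div_le_div_of_nonneg_left (by norm_num) (by norm_num) hn1
    rw [e]
    linarith
  rw [potential]
  simp only [Finset.empty_inter, Finset.card_empty, Nat.cast_zero, mul_zero, zero_add,
    Finset.sdiff_empty]
  linarith

/-- The property of a set `D` on exit from the inner loop that Refine-Coordinates aims at. -/
def GoodExit (k : ℕ) (ε : ℝ) (f : Cube n → ℝ) (C R I D : Finset (Fin n)) : Prop :=
  ((D ∩ Rᶜ).card : ℝ) ≤ ((C ∩ Rᶜ).card : ℝ) / 2 ∧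
    tailWeight k ε f C I D ≤ 4 * ε ^ 2 / (k : ℝ) ^ 2

/-- The inner loop succeeds with constant probability if `I` hits the sets `S` that have many
elements in `C ∖ R`. -/
lemma innerLoop_good (h : Regime k n ε) {f : Cube n → ℝ} {A : Cube n → Measure ℝ}
    (hA : ∀ x, BoundedLaw 1 (A x) (f x)) (hf : ∀ x, f x ∈ Set.Icc (-1 : ℝ) 1)
    (hfw : weightGE f (100 * (k : ℝ) * logRatio n ε) ≤ (ε / n) ^ 5)
    {C R I : Finset (Fin n)} (hR : R.card = k) (hC : (C ∩ Rᶜ).Nonempty)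
    (hω : ∑ S with hitThreshold k C R ≤ ((S ∩ (C ∩ Rᶜ)).card : ℝ),
      fourierCoef (aveOver I f) S ^ 2 ≤ (ε / n) ^ 5) :
    ENNReal.ofReal (3 / 4) ≤ innerLoop c k ε A C I ∅ {D | D ⊆ C ∧ GoodExit k ε f C R I D} := by
  obtain ⟨hp, hsub⟩ := innerLoop_isProb_subset (c := c) h hA I (Finset.empty_subset C)
  have hcost := lintegral_innerLoop_exitCost_le (c := c) h hA hf hfw hω (drift_nonneg h C R)
    (by rw [drift, div_mul_cancel₀ _ (ell_sub_pos h C R).ne']) (Finset.empty_subset C)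
  have hpot := potential_empty_le h hR hC
  have hb : (0 : ℝ) < (C ∩ Rᶜ).card := by exact_mod_cast Finset.card_pos.mpr hC
  set ν := innerLoop c k ε A C I ∅
  set G := {D | D ⊆ C ∧ GoodExit k ε f C R I D} with hG
  -- Markov's inequality: either way of being a bad exit makes the exit cost at least 1.
  have hbad : ν Gᶜ ≤ ENNReal.ofReal (1 / 4) := by
    calc ν Gᶜ = ∫⁻ D, Gᶜ.indicator 1 D ∂ν :=
          (lintegral_indicator_one (MeasurableSet.of_discrete)).symm
      _ ≤ ∫⁻ D, ENNReal.ofReal (exitCost k ε f C I (C ∩ Rᶜ) D) ∂ν := by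
          refine lintegral_mono_ae ?_
          have hae : ∀ᵐ D ∂ν, D ⊆ C := ae_iff.mpr hsub
          filter_upwards [hae] with D hD
          by_cases hDG : D ∈ G
          · rw [Set.indicator_of_notMem (Set.notMem_compl_iff.mpr hDG)]
            exact zero_le
          · rw [Set.indicator_of_mem (Set.mem_compl hDG), Pi.one_apply, ← ENNReal.ofReal_one]
            refine ENNReal.ofReal_le_ofReal ?_
            have hng : ¬GoodExit k ε f C R I D := fun hc => hDG ⟨hD, hc⟩
            rw [GoodExit, not_and_or, not_le, not_le] at hng
            have hDC : D ∩ (C ∩ Rᶜ) = D ∩ Rᶜ := by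
              rw [← Finset.inter_assoc, Finset.inter_eq_left.mpr hD]
            unfold exitCost
            rw [hDC]
            rcases hng with hng | hng
            · have h1 : 1 ≤ 2 / ((C ∩ Rᶜ).card : ℝ) * (D ∩ Rᶜ).card := by
                rw [div_mul_eq_mul_div, le_div_iff₀ hb]
                linarith
              split_ifs <;> linarith
            · rw [if_pos hng]
              have : 0 ≤ 2 / ((C ∩ Rᶜ).card : ℝ) * (D ∩ Rᶜ).card := by positivity
              linarith
      _ ≤ _ := hcost.trans (ENNReal.ofReal_le_ofReal hpot)
  have hadd := prob_add_prob_compl (μ := ν) (s := G) (MeasurableSet.of_discrete)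
  have hge : ENNReal.ofReal (3 / 4) + ENNReal.ofReal (1 / 4) ≤ ν G + ENNReal.ofReal (1 / 4) := by
    rw [← ENNReal.ofReal_add (by norm_num) (by norm_num)]
    norm_num
    rw [← hadd]
    refine add_le_add le_rfl (hbad.trans_eq ?_)
    norm_num
  exact (ENNReal.add_le_add_iff_right ENNReal.ofReal_ne_top).mp hge

/-- The law of `m` independent uniform elements of `C`. -/
noncomputable def draws (C : Finset (Fin n)) (m : ℕ) : Measure (Fin m → Fin n) :=
  Measure.pi fun _ : Fin m => uniformOn (C : Set (Fin n))

lemma isProb_draws {C : Finset (Fin n)} (hC : C.Nonempty) (m : ℕ) :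
    IsProbabilityMeasure (draws C m) := by
  have := isProb_uniformOn hC
  unfold draws
  infer_instance

lemma draws_forall_mem {C T : Finset (Fin n)} (hC : C.Nonempty) (m : ℕ) :
    draws C m {i | ∀ j, i j ∈ T} = ENNReal.ofReal ((((C ∩ T).card : ℝ) / C.card) ^ m) := by
  have := isProb_uniformOn hC
  have e : {i : Fin m → Fin n | ∀ j, i j ∈ T} = Set.univ.pi fun _ => (T : Set (Fin n)) := by
    ext i
    simp
  have hc : (0 : ℝ) < C.card := by exact_mod_cast Finset.card_pos.mpr hC
  rw [e, draws, Measure.pi_pi, uniformOn_apply_finset, Finset.prod_const, Finset.card_univ,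
    Fintype.card_fin, ENNReal.ofReal_pow (by positivity), ENNReal.ofReal_div_of_pos hc,
    ENNReal.ofReal_natCast, ENNReal.ofReal_natCast]

/-- The weight of `f_ave^I` on the sets that have many elements in `C ∖ R`. -/
noncomputable def missedWeight (k : ℕ) (f : Cube n → ℝ) (C R I : Finset (Fin n)) : ℝ :=
  ∑ S with hitThreshold k C R ≤ ((S ∩ (C ∩ Rᶜ)).card : ℝ), fourierCoef (aveOver I f) S ^ 2

lemma le_paramM (k n : ℕ) (ε : ℝ) (C : Finset (Fin n)) :
    10 * (max C.card k : ℕ) / (k : ℝ) ^ (2 / 3 : ℝ) * logRatio n ε ^ 4 ≤ paramM k n ε C :=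
  Nat.le_ceil _

/-- With b = |Q| and s = |S ∩ Q|, the fraction b - s ≤ b·e^{-s/b} of each draw compounds to
e^{-ms/b}. The size of m is chosen so that mt/b ≥ 10Λ⁴. -/
lemma draws_avoid_le (h : Regime k n ε) {C R S : Finset (Fin n)} (hC : (C ∩ Rᶜ).Nonempty)
    (hS : hitThreshold k C R ≤ ((S ∩ (C ∩ Rᶜ)).card : ℝ)) :
    (((C ∩ ((C ∩ Rᶜ) \ S)).card : ℝ) / C.card) ^ paramM k n ε C
      ≤ (((C ∩ Rᶜ).card : ℝ) / C.card) ^ paramM k n ε C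
        * Real.exp (-(10 * logRatio n ε ^ 4)) := by
  set m := paramM k n ε C
  set b : ℝ := ((C ∩ Rᶜ).card : ℝ) with hb
  have hb0 : 0 < b := by
    rw [hb]
    exact_mod_cast Finset.card_pos.mpr hC
  have hcard : ((C ∩ ((C ∩ Rᶜ) \ S)).card : ℝ) = b - (S ∩ (C ∩ Rᶜ)).card := by
    have e : C ∩ ((C ∩ Rᶜ) \ S) = (C ∩ Rᶜ) \ S := by
      ext i
      simp only [Finset.mem_inter, Finset.mem_sdiff]
      tauto
    rw [e, eq_sub_iff_add_eq, hb, Finset.inter_comm S]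
    exact_mod_cast Finset.card_sdiff_add_card_inter (C ∩ Rᶜ) S
  set s : ℝ := ((S ∩ (C ∩ Rᶜ)).card : ℝ) with hs
  have hle : ((C ∩ ((C ∩ Rᶜ) \ S)).card : ℝ) ≤ b * Real.exp (-(s / b)) := by
    have h1 := Real.add_one_le_exp (-(s / b))
    have h2 := mul_le_mul_of_nonneg_left h1 hb0.le
    have e : b * (-(s / b) + 1) = b - s := by
      field_simp
      ring
    rw [hcard]
    linarith
  have h1 : (((C ∩ ((C ∩ Rᶜ) \ S)).card : ℝ) / C.card) ^ m
      ≤ (b / C.card * Real.exp (-(s / b))) ^ m := by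
    refine pow_le_pow_left₀ (by positivity) ?_ m
    rw [div_mul_eq_mul_div]
    exact div_le_div_of_nonneg_right hle (Nat.cast_nonneg _)
  refine h1.trans ?_
  rw [mul_pow, ← Real.exp_nat_mul]
  refine mul_le_mul_of_nonneg_left (Real.exp_le_exp.mpr ?_) (by positivity)
  have hβ := max_pos h C
  have hk := h.one_le_rpow (p := 2 / 3) (by norm_num)
  have hΛ := h.logRatio_ge
  have h2 : 10 * logRatio n ε ^ 4
      = (10 * (max C.card k : ℕ) / (k : ℝ) ^ (2 / 3 : ℝ) * logRatio n ε ^ 4)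
        * (hitThreshold k C R / b) := by
    rw [hitThreshold, ← hb]
    have : (k : ℝ) ^ (2 / 3 : ℝ) ≠ 0 := by positivity
    field_simp
  have h3 : (10 * (max C.card k : ℕ) / (k : ℝ) ^ (2 / 3 : ℝ) * logRatio n ε ^ 4)
        * (hitThreshold k C R / b) ≤ m * (s / b) := by
    refine mul_le_mul (le_paramM k n ε C) (div_le_div_of_nonneg_right hS hb0.le)
      (div_nonneg (hitThreshold_nonneg k C R) hb0.le) (Nat.cast_nonneg _)
  linarith

/-- The coefficient at S survives averaging only if I misses S, that is, if all the draws lie in Q ∖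
S. Linearity over S and total weight at most 1 finish the estimate. -/
lemma lintegral_missedWeight_le (h : Regime k n ε) {f : Cube n → ℝ}
    (hf : ∀ x, f x ∈ Set.Icc (-1 : ℝ) 1) {C R : Finset (Fin n)} (hC : (C ∩ Rᶜ).Nonempty) :
    ∫⁻ i in {i | ∀ j, i j ∈ C ∩ Rᶜ}, ENNReal.ofReal (missedWeight k f C R (Finset.univ.image i))
        ∂(draws C (paramM k n ε C))
      ≤ ENNReal.ofReal ((((C ∩ Rᶜ).card : ℝ) / C.card) ^ paramM k n ε C
        * Real.exp (-(10 * logRatio n ε ^ 4))) := by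
  have hC' : C.Nonempty := hC.mono Finset.inter_subset_left
  set m := paramM k n ε C
  set q := (((C ∩ Rᶜ).card : ℝ) / C.card) ^ m * Real.exp (-(10 * logRatio n ε ^ 4)) with hq
  have hq0 : 0 ≤ q := by positivity
  rw [← lintegral_indicator (MeasurableSet.of_discrete)]
  calc _ ≤ ∫⁻ i, ∑ S with hitThreshold k C R ≤ ((S ∩ (C ∩ Rᶜ)).card : ℝ),
            ENNReal.ofReal (fourierCoef f S ^ 2)
              * {i : Fin m → Fin n | ∀ j, i j ∈ (C ∩ Rᶜ) \ S}.indicator 1 i ∂(draws C m) := by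
        refine lintegral_mono fun i => ?_
        by_cases hi : ∀ j, i j ∈ C ∩ Rᶜ
        · rw [Set.indicator_of_mem (by exact hi), missedWeight,
            ENNReal.ofReal_sum_of_nonneg fun _ _ => sq_nonneg _]
          refine Finset.sum_le_sum fun S _ => ?_
          rw [fourierCoef_aveOver]
          split_ifs with hd
          · rw [Set.indicator_of_mem, one_mul, Pi.one_apply, mul_one]
            intro j
            refine Finset.mem_sdiff.mpr ⟨hi j, fun hj => ?_⟩
            exact Finset.disjoint_left.mp hd hj (Finset.mem_image_of_mem i (Finset.mem_univ j))
          · simp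
        · rw [Set.indicator_of_notMem (by exact hi)]
          exact zero_le
    _ = ∑ S with hitThreshold k C R ≤ ((S ∩ (C ∩ Rᶜ)).card : ℝ),
          ENNReal.ofReal (fourierCoef f S ^ 2)
            * draws C m {i : Fin m → Fin n | ∀ j, i j ∈ (C ∩ Rᶜ) \ S} := by
        rw [lintegral_finsetSum _ fun _ _ => Measurable.of_discrete]
        refine Finset.sum_congr rfl fun S _ => ?_
        rw [lintegral_const_mul _ Measurable.of_discrete,
          lintegral_indicator_one (MeasurableSet.of_discrete)]
    _ ≤ ∑ S with hitThreshold k C R ≤ ((S ∩ (C ∩ Rᶜ)).card : ℝ),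
          ENNReal.ofReal (fourierCoef f S ^ 2) * ENNReal.ofReal q := by
        refine Finset.sum_le_sum fun S hS => ?_
        rw [draws_forall_mem hC']
        have hS' : hitThreshold k C R ≤ ((S ∩ (C ∩ Rᶜ)).card : ℝ) := by simpa using hS
        gcongr
        exact draws_avoid_le h hC hS'
    _ ≤ ENNReal.ofReal q := by
        rw [← Finset.sum_mul, ← ENNReal.ofReal_sum_of_nonneg fun _ _ => sq_nonneg _,
          ← ENNReal.ofReal_mul (Finset.sum_nonneg fun _ _ => sq_nonneg _)]
        refine ENNReal.ofReal_le_ofReal (mul_le_of_le_one_left hq0 ?_)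
        refine le_trans (Finset.sum_le_sum_of_subset_of_nonneg (Finset.filter_subset _ _)
          fun _ _ _ => sq_nonneg _) (sum_fourierCoef_sq_le_one hf)

/-- Since 2^{-Λ} = ε/n and e^{-Λ} ≤ 2^{-Λ}, it is enough that 10Λ⁴ ≥ 5Λ + 1. -/
lemma exp_neg_le_half_pow (h : Regime k n ε) :
    Real.exp (-(10 * logRatio n ε ^ 4)) ≤ 1 / 2 * (ε / n) ^ 5 := by
  have hΛ := h.logRatio_ge
  set Λ := logRatio n ε with hL
  have e : ε / n = (2 : ℝ) ^ (-Λ) := by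
    rw [Real.rpow_neg (by norm_num), hL, h.two_rpow_logRatio, inv_div]
  have hle : Real.exp (-Λ) ≤ ε / n := by
    rw [e, Real.rpow_def_of_pos (by norm_num), Real.exp_le_exp]
    have : Real.log 2 ≤ 1 := by linarith [Real.log_two_lt_d9]
    nlinarith
  have h5 := pow_le_pow_left₀ (Real.exp_pos _).le hle 5
  rw [← Real.exp_nat_mul] at h5
  have hhalf : Real.exp (-1) ≤ 1 / 2 := by
    rw [Real.exp_neg, one_div]
    refine inv_anti₀ (by norm_num) ?_
    linarith [Real.add_one_le_exp 1]
  have hΛ4 : 6 * Λ ≤ 10 * Λ ^ 4 := by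
    have : (1 : ℝ) ≤ Λ ^ 3 := one_le_pow₀ (by linarith)
    nlinarith
  calc Real.exp (-(10 * Λ ^ 4)) ≤ Real.exp (-1 + (5 : ℕ) * -Λ) := by
        rw [Real.exp_le_exp]
        push_cast
        linarith
    _ = Real.exp (-1) * Real.exp ((5 : ℕ) * -Λ) := Real.exp_add _ _
    _ ≤ 1 / 2 * (ε / n) ^ 5 := mul_le_mul hhalf h5 (Real.exp_pos _).le (by norm_num)

/-- Markov's inequality on the event that all draws avoid R: at most half of its probability p is
lost to a large missed weight. -/
lemma draws_good (h : Regime k n ε) {f : Cube n → ℝ} (hf : ∀ x, f x ∈ Set.Icc (-1 : ℝ) 1)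
    {C R : Finset (Fin n)} (hC : (C ∩ Rᶜ).Nonempty) :
    ENNReal.ofReal (1 / 2 * (((C ∩ Rᶜ).card : ℝ) / C.card) ^ paramM k n ε C)
      ≤ draws C (paramM k n ε C) {i | (∀ j, i j ∈ C ∩ Rᶜ) ∧
        missedWeight k f C R (Finset.univ.image i) ≤ (ε / n) ^ 5} := by
  have hC' : C.Nonempty := hC.mono Finset.inter_subset_left
  have hx := h.x_pos
  set m := paramM k n ε C
  set p := (((C ∩ Rᶜ).card : ℝ) / C.card) ^ m
  have hp0 : 0 ≤ p := by positivity
  set P := draws C m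
  set G := {i : Fin m → Fin n | (∀ j, i j ∈ C ∩ Rᶜ) ∧
        missedWeight k f C R (Finset.univ.image i) ≤ (ε / n) ^ 5}
  set E := {i : Fin m → Fin n | ∀ j, i j ∈ C ∩ Rᶜ}
  set B := {i : Fin m → Fin n | ENNReal.ofReal ((ε / n) ^ 5)
    ≤ ENNReal.ofReal (missedWeight k f C R (Finset.univ.image i))}
  have hE : P E = ENNReal.ofReal p := by
    have := draws_forall_mem (T := C ∩ Rᶜ) hC' m
    rwa [← Finset.inter_assoc, Finset.inter_self] at this
  have hB : P (E ∩ B) ≤ ENNReal.ofReal (1 / 2 * p) := by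
    have hmk := mul_meas_ge_le_lintegral (μ := P.restrict E)
      (f := fun i => ENNReal.ofReal (missedWeight k f C R (Finset.univ.image i)))
      (Measurable.of_discrete) (ENNReal.ofReal ((ε / n) ^ 5))
    have hmk2 := hmk.trans (lintegral_missedWeight_le h hf hC)
    have h1 : p * Real.exp (-(10 * logRatio n ε ^ 4)) ≤ (ε / n) ^ 5 * (1 / 2 * p) := by
      have := mul_le_mul_of_nonneg_left (exp_neg_le_half_pow h) hp0
      linarith
    have hmk3 := hmk2.trans (ENNReal.ofReal_le_ofReal h1)
    rw [ENNReal.ofReal_mul (by positivity),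
      Measure.restrict_apply (MeasurableSet.of_discrete)] at hmk3
    have hne : ENNReal.ofReal ((ε / n) ^ 5) ≠ 0 := by
      rw [ne_eq, ENNReal.ofReal_eq_zero, not_le]
      positivity
    have := (ENNReal.mul_le_mul_iff_right hne ENNReal.ofReal_ne_top).mp hmk3
    rwa [Set.inter_comm]
  have hcover : E ⊆ G ∪ (E ∩ B) := by
    intro i hi
    by_cases hw : missedWeight k f C R (Finset.univ.image i) ≤ (ε / n) ^ 5
    · exact Or.inl ⟨hi, hw⟩
    · exact Or.inr ⟨hi, ENNReal.ofReal_le_ofReal (not_le.mp hw).le⟩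
  have h2 : ENNReal.ofReal (1 / 2 * p) + ENNReal.ofReal (1 / 2 * p)
      ≤ P G + ENNReal.ofReal (1 / 2 * p) := by
    rw [← ENNReal.ofReal_add (by positivity) (by positivity)]
    have e : 1 / 2 * p + 1 / 2 * p = p := by ring
    rw [e, ← hE]
    exact (measure_mono hcover).trans ((measure_union_le _ _).trans (add_le_add le_rfl hB))
  exact (ENNReal.add_le_add_iff_right ENNReal.ofReal_ne_top).mp h2

/-- The probability that all the draws lie outside `R`. -/
lemma draws_prob_ge (h : Regime k n ε) {C R : Finset (Fin n)} (hR : R.card = k)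
    (hC : (C ∩ Rᶜ).Nonempty) :
    Real.exp (-(42 * ((k : ℝ) ^ (1 / 3 : ℝ) * logRatio n ε ^ 5)))
      ≤ (((C ∩ Rᶜ).card : ℝ) / C.card) ^ paramM k n ε C := by
  have hΛ := h.logRatio_ge
  have hk0 := h.k_pos
  have hk1 := h.one_le_rpow (p := 1 / 3) (by norm_num)
  have hk2 := h.one_le_rpow (p := 2 / 3) (by norm_num)
  have hkk := h.rpow_mul_rpow
  have hlogn := h.log_n_le
  set Λ := logRatio n ε with hLdef
  set u := (k : ℝ) ^ (1 / 3 : ℝ)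
  set v := (k : ℝ) ^ (2 / 3 : ℝ)
  have hC' : C.Nonempty := hC.mono Finset.inter_subset_left
  have hc0 : (0 : ℝ) < C.card := by exact_mod_cast Finset.card_pos.mpr hC'
  have hb1 : (1 : ℝ) ≤ (C ∩ Rᶜ).card := by exact_mod_cast Finset.card_pos.mpr hC
  have hm : (paramM k n ε C : ℝ) ≤ 10 * (max C.card k : ℕ) / v * Λ ^ 4 + 1 :=
    (Nat.ceil_lt_add_one (by positivity)).le
  have hΛ4 : (1 : ℝ) ≤ Λ ^ 4 := one_le_pow₀ (by linarith)
  have huΛ : 1 ≤ u * Λ ^ 4 := one_le_mul_of_one_le_of_one_le hk1 hΛ4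
  have hΛ5 : u * Λ ^ 4 ≤ u * Λ ^ 5 := by
    refine mul_le_mul_of_nonneg_left ?_ (by linarith)
    exact pow_le_pow_right₀ (by linarith) (by norm_num)
  have hkv : (k : ℝ) / v = u := by
    rw [div_eq_iff (by linarith), hkk]
  set m := paramM k n ε C
  have hm0 : (0 : ℝ) ≤ m := Nat.cast_nonneg _
  -- For |C| ≥ 2k a draw misses R with probability at least 1 - k/|C| ≥ e^{-2k/|C|}, and mk/|C| ≤
  -- 11k^{1/3}Λ⁴. Otherwise only 1/|C| ≥ 1/(2k) ≥ e^{-2Λ} is available, with m ≤ 21k^{1/3}Λ⁴; this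
  -- case yields both the 42 and the fifth power of Λ.
  by_cases hcase : 2 * k ≤ C.card
  · have hcase' : 2 * (k : ℝ) ≤ C.card := by exact_mod_cast hcase
    have hmax : max C.card k = C.card := max_eq_left (by omega)
    rw [hmax] at hm
    have hy : (k : ℝ) / C.card ≤ 1 / 2 := by
      rw [div_le_div_iff₀ hc0 (by norm_num)]
      linarith
    set y := (k : ℝ) / C.card with hydef
    have hy0 : 0 ≤ y := by positivity
    have hfrac : 1 - y ≤ ((C ∩ Rᶜ).card : ℝ) / C.card := by
      have h1 : ((C ∩ Rᶜ).card : ℝ) + (C ∩ R).card = C.card := by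
        have := Finset.card_sdiff_add_card_inter C R
        rw [Finset.sdiff_eq_inter_compl] at this
        exact_mod_cast this
      have h2 : ((C ∩ R).card : ℝ) ≤ k := by
        exact_mod_cast (Finset.card_le_card Finset.inter_subset_right).trans_eq hR
      rw [hydef, le_div_iff₀ hc0, sub_mul, div_mul_cancel₀ _ hc0.ne']
      linarith
    have hexp : Real.exp (-(2 * y)) ≤ 1 - y := by
      rw [Real.exp_neg]
      have h1 := Real.add_one_le_exp (2 * y)
      rw [inv_le_iff_one_le_mul₀ (Real.exp_pos _)]
      nlinarith
    refine le_trans ?_ (pow_le_pow_left₀ (Real.exp_pos _).le (hexp.trans hfrac) m)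
    rw [← Real.exp_nat_mul, Real.exp_le_exp]
    have h3 : y * m ≤ 11 * (u * Λ ^ 4) := by
      calc y * m ≤ y * (10 * (C.card : ℕ) / v * Λ ^ 4 + 1) := mul_le_mul_of_nonneg_left hm hy0
        _ = 10 * (u * Λ ^ 4) + y := by
            rw [← hkv, hydef]
            field_simp
        _ ≤ _ := by linarith
    nlinarith
  · have hcase' : (C.card : ℝ) ≤ 2 * k := by exact_mod_cast (not_le.mp hcase).le
    have hmax : ((max C.card k : ℕ) : ℝ) ≤ 2 * k := by
      rw [Nat.cast_max, max_le_iff]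
      exact ⟨hcase', by linarith⟩
    have hm2 : (m : ℝ) ≤ 21 * (u * Λ ^ 4) := by
      have h1 : 10 * ((max C.card k : ℕ) : ℝ) / v * Λ ^ 4 ≤ 10 * (2 * k) / v * Λ ^ 4 := by
        gcongr
      have h2 : 10 * (2 * k) / v * Λ ^ 4 = 20 * (u * Λ ^ 4) := by
        rw [← hkv]
        ring
      linarith
    have hfrac : Real.exp (-(2 * Λ)) ≤ ((C ∩ Rᶜ).card : ℝ) / C.card := by
      have h1 : 1 / (2 * (k : ℝ)) ≤ ((C ∩ Rᶜ).card : ℝ) / C.card :=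
        div_le_div₀ (by linarith) hb1 hc0 hcase'
      refine le_trans ?_ h1
      rw [Real.exp_neg, one_div]
      refine inv_anti₀ (by positivity) ?_
      have h2 : 2 * (k : ℝ) = Real.exp (Real.log 2 + Real.log k) := by
        rw [Real.exp_add, Real.exp_log (by norm_num), Real.exp_log hk0]
      rw [h2, Real.exp_le_exp]
      have h3 : Real.log k ≤ Real.log n := Real.log_le_log hk0 h.k_le_real
      linarith [Real.log_two_lt_d9]
    refine le_trans ?_ (pow_le_pow_left₀ (Real.exp_pos _).le hfrac m)
    rw [← Real.exp_nat_mul, Real.exp_le_exp]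
    have h4 : (m : ℝ) * (2 * Λ) ≤ 21 * (u * Λ ^ 4) * (2 * Λ) :=
      mul_le_mul_of_nonneg_right hm2 (by linarith)
    have h5 : 21 * (u * Λ ^ 4) * (2 * Λ) = 42 * (u * Λ ^ 5) := by ring
    linarith

/-- The pairs that Refine-Coordinates looks for. -/
def goodPairs (k : ℕ) (ε : ℝ) (f : Cube n → ℝ) (C R : Finset (Fin n)) :
    Set (Finset (Fin n) × Finset (Fin n)) :=
  {p | p.2 ⊆ Rᶜ ∧ GoodExit k ε f C R p.2 p.1}

lemma oneRep_eq (A : Cube n → Measure ℝ) (C : Finset (Fin n)) :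
    oneRep c k ε A C = (draws C (paramM k n ε C)).bind fun i =>
      (innerLoop c k ε A C (Finset.univ.image i) ∅).map fun D => (D, Finset.univ.image i) := rfl

lemma oneRep_apply (A : Cube n → Measure ℝ) (C : Finset (Fin n))
    (s : Set (Finset (Fin n) × Finset (Fin n))) :
    oneRep c k ε A C s = ∫⁻ i, innerLoop c k ε A C (Finset.univ.image i) ∅
      {D | (D, Finset.univ.image i) ∈ s} ∂(draws C (paramM k n ε C)) := by
  rw [oneRep_eq, Measure.bind_apply (MeasurableSet.of_discrete)
    (Measurable.of_discrete).aemeasurable]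
  refine lintegral_congr fun i => ?_
  rw [Measure.map_apply (Measurable.of_discrete) (MeasurableSet.of_discrete)]
  rfl

lemma isProb_oneRep (h : Regime k n ε) {f : Cube n → ℝ} {A : Cube n → Measure ℝ}
    (hA : ∀ x, BoundedLaw 1 (A x) (f x)) {C : Finset (Fin n)} (hC : C.Nonempty) :
    IsProbabilityMeasure (oneRep c k ε A C) := by
  have := isProb_draws hC (paramM k n ε C)
  rw [oneRep_eq]
  refine BoundedLaw.isProb_bind (Measurable.of_discrete).aemeasurable (ae_of_all _ fun i => ?_)
  have := (innerLoop_isProb_subset (c := c) h hA (Finset.univ.image i)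
    (Finset.empty_subset C)).1
  exact Measure.isProbabilityMeasure_map (Measurable.of_discrete).aemeasurable

lemma oneRep_subset (h : Regime k n ε) {f : Cube n → ℝ} {A : Cube n → Measure ℝ}
    (hA : ∀ x, BoundedLaw 1 (A x) (f x)) {C : Finset (Fin n)} (hC : C.Nonempty) :
    ∀ᵐ p ∂(oneRep c k ε A C), p.1 ⊆ C ∧ p.2 ⊆ C := by
  rw [ae_iff, oneRep_apply]
  have := isProb_draws hC (paramM k n ε C)
  have hmem : ∀ᵐ i ∂(draws C (paramM k n ε C)), ∀ j, i j ∈ C := by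
    have h1 := draws_forall_mem (T := C) hC (paramM k n ε C)
    have hc : (C.card : ℝ) ≠ 0 := by exact_mod_cast (Finset.card_pos.mpr hC).ne'
    rw [Finset.inter_self, div_self hc, one_pow, ENNReal.ofReal_one] at h1
    exact (prob_compl_eq_zero_iff (MeasurableSet.of_discrete)).mpr h1
  refine lintegral_eq_zero_of_ae_eq_zero ?_
  filter_upwards [hmem] with i hi
  have hI : Finset.univ.image i ⊆ C := by
    intro a ha
    obtain ⟨j, -, rfl⟩ := Finset.mem_image.mp ha
    exact hi j
  refine measure_mono_null (fun D hD => ?_) (innerLoop_isProb_subset (c := c) h hA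
    (Finset.univ.image i) (Finset.empty_subset C)).2
  exact fun hDC => hD ⟨hDC, hI⟩

/-- A suitable I has probability at least p/2, and given it the inner loop succeeds with probability
at least 3/4; the product 3/8 is rounded down to 1/4. -/
lemma oneRep_good (h : Regime k n ε) {f : Cube n → ℝ} {A : Cube n → Measure ℝ}
    (hA : ∀ x, BoundedLaw 1 (A x) (f x)) (hf : ∀ x, f x ∈ Set.Icc (-1 : ℝ) 1)
    (hfw : weightGE f (100 * (k : ℝ) * logRatio n ε) ≤ (ε / n) ^ 5)
    {C R : Finset (Fin n)} (hR : R.card = k) (hC : (C ∩ Rᶜ).Nonempty) :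
    ENNReal.ofReal (1 / 4 * Real.exp (-(42 * ((k : ℝ) ^ (1 / 3 : ℝ) * logRatio n ε ^ 5))))
      ≤ oneRep c k ε A C (goodPairs k ε f C R) := by
  set m := paramM k n ε C with hm
  have hp := draws_prob_ge h hR hC
  have hgood := draws_good h hf hC
  set G := {i : Fin m → Fin n | (∀ j, i j ∈ C ∩ Rᶜ) ∧
        missedWeight k f C R (Finset.univ.image i) ≤ (ε / n) ^ 5}
  rw [oneRep_apply]
  calc _ ≤ ENNReal.ofReal (3 / 4) * draws C m G := by
        refine le_trans ?_ (mul_le_mul_right hgood _)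
        rw [← ENNReal.ofReal_mul (by norm_num)]
        refine ENNReal.ofReal_le_ofReal ?_
        have := Real.exp_pos (-(42 * ((k : ℝ) ^ (1 / 3 : ℝ) * logRatio n ε ^ 5)))
        linarith
    _ = ∫⁻ i, G.indicator (fun _ => ENNReal.ofReal (3 / 4)) i ∂(draws C m) := by
        rw [lintegral_indicator_const (MeasurableSet.of_discrete)]
    _ ≤ _ := by
        refine lintegral_mono fun i => ?_
        by_cases hi : i ∈ G
        · rw [Set.indicator_of_mem hi]
          refine (innerLoop_good (c := c) h hA hf hfw hR hC hi.2).trans (measure_mono ?_)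
          intro D hD
          refine ⟨?_, hD.2⟩
          intro a ha
          obtain ⟨j, -, rfl⟩ := Finset.mem_image.mp ha
          exact (Finset.mem_inter.mp (hi.1 j)).2
        · rw [Set.indicator_of_notMem hi]
          exact zero_le

lemma refineCoordinates_eq (A : Cube n → Measure ℝ) (C : Finset (Fin n)) :
    refineCoordinates c k ε A C =
      (Measure.pi fun _ : Fin (numReps c k n ε) => oneRep c k ε A C).map
        fun w => Finset.univ.image w := rfl

/-- With X = k^{1/3}Λ⁵ ≥ 1, the rounding is absorbed by e^{cX} + 1 ≤ e^{cX+1}, and ln 2 ≥ 1/2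
changes the base. -/
lemma numReps_le (h : Regime k n ε) (hc : 0 ≤ c) :
    (numReps c k n ε : ℝ)
      ≤ (2 : ℝ) ^ ((k : ℝ) ^ (1 / 3 : ℝ) * ((2 * c + 2) * logRatio n ε ^ 5)) := by
  have hΛ := h.logRatio_ge
  have hk1 := h.one_le_rpow (p := 1 / 3) (by norm_num)
  set X := (k : ℝ) ^ (1 / 3 : ℝ) * logRatio n ε ^ 5 with hX
  have hX1 : 1 ≤ X := one_le_mul_of_one_le_of_one_le hk1 (one_le_pow₀ (by linarith))
  have h1 : (numReps c k n ε : ℝ) ≤ Real.exp (c * X) + 1 :=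
    (Nat.ceil_lt_add_one (Real.exp_pos _).le).le
  have e : (k : ℝ) ^ (1 / 3 : ℝ) * ((2 * c + 2) * logRatio n ε ^ 5) = (2 * c + 2) * X := by
    rw [hX]
    ring
  rw [e, Real.rpow_def_of_pos (by norm_num)]
  refine h1.trans ?_
  have hlog : 1 / 2 ≤ Real.log 2 := by linarith [Real.log_two_gt_d9]
  have hcX : 0 ≤ c * X := by positivity
  have h2 : c * X + 1 ≤ Real.log 2 * ((2 * c + 2) * X) := by
    have : 1 / 2 * ((2 * c + 2) * X) ≤ Real.log 2 * ((2 * c + 2) * X) :=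
      mul_le_mul_of_nonneg_right hlog (by positivity)
    linarith
  refine le_trans ?_ (Real.exp_le_exp.mpr h2)
  rw [Real.exp_add]
  have h3 : 2 ≤ Real.exp 1 := by linarith [Real.add_one_le_exp 1]
  have h4 : 1 ≤ Real.exp (c * X) := Real.one_le_exp hcX
  nlinarith

/-- With q the success probability, N the number of repetitions and X = k^{1/3}Λ⁵, (1 - q)^N ≤
e^{-Nq} and Nq ≥ ¼e^{(c-42)X} ≥ ¼·8X ≥ 2Λ. The 8 is the excess of c ≥ 50 over 42. -/
lemma pow_numReps_le (h : Regime k n ε) (hc : 50 ≤ c) :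
    (1 - 1 / 4 * Real.exp (-(42 * ((k : ℝ) ^ (1 / 3 : ℝ) * logRatio n ε ^ 5))))
      ^ numReps c k n ε ≤ 3 / (n : ℝ) ^ 2 := by
  have hΛ := h.logRatio_ge
  have hk1 := h.one_le_rpow (p := 1 / 3) (by norm_num)
  have hn := h.n_pos
  set Λ := logRatio n ε
  set X := (k : ℝ) ^ (1 / 3 : ℝ) * Λ ^ 5 with hX
  have hXΛ : Λ ≤ X := by
    have h1 : Λ ≤ Λ ^ 5 := le_self_pow₀ (by linarith) (by norm_num)
    have h2 : Λ ^ 5 ≤ X := le_mul_of_one_le_left (by positivity) hk1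
    linarith
  set q := 1 / 4 * Real.exp (-(42 * X)) with hq
  have hq1 : q ≤ 1 := by
    have : Real.exp (-(42 * X)) ≤ 1 := Real.exp_le_one_iff.mpr (by linarith)
    linarith
  have hN : Real.exp (c * X) ≤ numReps c k n ε := Nat.le_ceil _
  have h1 : 1 - q ≤ Real.exp (-q) := by linarith [Real.add_one_le_exp (-q)]
  refine (pow_le_pow_left₀ (by linarith) h1 _).trans ?_
  rw [← Real.exp_nat_mul]
  have h2 : 2 * Λ ≤ numReps c k n ε * q := by
    have h3 : Real.exp (c * X) * q ≤ numReps c k n ε * q :=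
      mul_le_mul_of_nonneg_right hN (by positivity)
    have h4 : Real.exp (c * X) * q = 1 / 4 * Real.exp ((c - 42) * X) := by
      rw [hq, mul_left_comm, ← Real.exp_add]
      congr 2
      ring
    have h5 := Real.add_one_le_exp ((c - 42) * X)
    have h6 : 8 * X ≤ (c - 42) * X := mul_le_mul_of_nonneg_right (by linarith) (by linarith)
    linarith
  have h7 : Real.exp (-(2 * Real.log n)) = 1 / (n : ℝ) ^ 2 := by
    rw [Real.exp_neg, one_div, two_mul, Real.exp_add, Real.exp_log hn, sq]
  calc Real.exp (numReps c k n ε * -q) ≤ Real.exp (-(2 * Real.log n)) := by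
        rw [Real.exp_le_exp]
        linarith [h.log_n_le]
    _ = 1 / (n : ℝ) ^ 2 := h7
    _ ≤ 3 / (n : ℝ) ^ 2 := div_le_div_of_nonneg_right (by norm_num) (by positivity)

/-- Refine-Coordinates finds a good pair with high probability. -/
lemma refineCoordinates_good (h : Regime k n ε) (hc : 50 ≤ c) {f : Cube n → ℝ}
    {A : Cube n → Measure ℝ} (hA : ∀ x, BoundedLaw 1 (A x) (f x))
    (hf : ∀ x, f x ∈ Set.Icc (-1 : ℝ) 1)
    (hfw : weightGE f (100 * (k : ℝ) * logRatio n ε) ≤ (ε / n) ^ 5)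
    {C R : Finset (Fin n)} (hR : R.card = k) (hC : (C ∩ Rᶜ).Nonempty) :
    IsProbabilityMeasure (refineCoordinates c k ε A C) ∧
      ENNReal.ofReal (1 - 3 / (n : ℝ) ^ 2) ≤ refineCoordinates c k ε A C
        {F | F.card ≤ numReps c k n ε ∧ (∀ p ∈ F, p.1 ⊆ C ∧ p.2 ⊆ C) ∧
          ∃ p ∈ F, p ∈ goodPairs k ε f C R} := by
  have hC' : C.Nonempty := hC.mono Finset.inter_subset_left
  have hp := isProb_oneRep (c := c) h hA hC'
  set N := numReps c k n ε with hN
  set ν := oneRep c k ε A C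
  have hm : Measurable fun w : Fin N → Finset (Fin n) × Finset (Fin n) => Finset.univ.image w :=
    Measurable.of_discrete
  rw [refineCoordinates_eq]
  refine ⟨Measure.isProbabilityMeasure_map hm.aemeasurable, ?_⟩
  rw [Measure.map_apply hm (MeasurableSet.of_discrete)]
  set P := Measure.pi fun _ : Fin N => ν
  set q := 1 / 4 * Real.exp (-(42 * ((k : ℝ) ^ (1 / 3 : ℝ) * logRatio n ε ^ 5))) with hq
  have hq0 : 0 ≤ q := by positivity
  have hsub : ∀ᵐ w ∂P, ∀ j, (w j).1 ⊆ C ∧ (w j).2 ⊆ C :=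
    ae_all_iff.mpr fun j => (measurePreserving_eval (fun _ : Fin N => ν)
      j).quasiMeasurePreserving.ae (oneRep_subset h hA hC')
  set bad := {w : Fin N → Finset (Fin n) × Finset (Fin n) | ∀ j, w j ∈ (goodPairs k ε f C R)ᶜ}
    with hbaddef
  have hbad : P bad ≤ ENNReal.ofReal (3 / (n : ℝ) ^ 2) := by
    have e : bad = Set.univ.pi fun _ => (goodPairs k ε f C R)ᶜ := by
      ext w
      simp [hbaddef]
    rw [e, Measure.pi_pi, Finset.prod_const, Finset.card_univ, Fintype.card_fin]
    have hg := oneRep_good (c := c) h hA hf hfw hR hC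
    rw [prob_compl_eq_one_sub (MeasurableSet.of_discrete)]
    have h1 : 1 - ν (goodPairs k ε f C R) ≤ ENNReal.ofReal (1 - q) := by
      rw [ENNReal.ofReal_sub _ hq0, ENNReal.ofReal_one]
      exact tsub_le_tsub_left hg 1
    have hq1 : 0 ≤ 1 - q := by
      have hΛ := h.logRatio_ge
      have : Real.exp (-(42 * ((k : ℝ) ^ (1 / 3 : ℝ) * logRatio n ε ^ 5))) ≤ 1 :=
        Real.exp_le_one_iff.mpr (by
          have : 0 ≤ 42 * ((k : ℝ) ^ (1 / 3 : ℝ) * logRatio n ε ^ 5) := by positivity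
          linarith)
      linarith
    refine (pow_le_pow_left₀ zero_le h1 N).trans ?_
    rw [← ENNReal.ofReal_pow hq1]
    exact ENNReal.ofReal_le_ofReal (pow_numReps_le h hc)
  have hcompl : ENNReal.ofReal (1 - 3 / (n : ℝ) ^ 2) ≤ P badᶜ := by
    rw [prob_compl_eq_one_sub (MeasurableSet.of_discrete),
      ENNReal.ofReal_sub _ (by positivity), ENNReal.ofReal_one]
    exact tsub_le_tsub_left hbad 1
  refine hcompl.trans (measure_mono_ae ?_)
  filter_upwards [hsub] with w hw hwb
  refine ⟨?_, ?_, ?_⟩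
  · exact Finset.card_image_le.trans (by simp)
  · intro p hp
    obtain ⟨j, -, rfl⟩ := Finset.mem_image.mp hp
    exact hw j
  · by_contra hcon
    refine hwb fun j hj => hcon ⟨w j, Finset.mem_image_of_mem w (Finset.mem_univ j), hj⟩

end OuterLoop

end JuntaTest


theorem mainTheorem4 :
    ∃ c₀ : ℝ, 0 < c₀ ∧ ∀ c : ℝ, c₀ ≤ c →
      ∃ (K : ℝ) (d k₀ : ℕ), ∀ (k n : ℕ) (ε : ℝ), k₀ ≤ k →
        (2 : ℝ) ^ (-((k : ℝ) ^ (0.001 : ℝ))) ≤ ε → ε < 1 →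
        ∀ (f : Cube n → ℝ) (A : Cube n → Measure ℝ) (R C : Finset (Fin n)),
          (∀ x, f x ∈ Set.Icc (-1 : ℝ) 1) →
          IsBoundedRandAlg 1 A f →
          weightGE f (100 * (k : ℝ) * logRatio n ε) ≤ (ε / (n : ℝ)) ^ 5 →
          R.card = k →
          (C ∩ Rᶜ).Nonempty →
          IsProbabilityMeasure (refineCoordinates c k ε A C) ∧
          ENNReal.ofReal (1 - 3 / (n : ℝ) ^ 2) ≤
            refineCoordinates c k ε A C
              {F | (F.card : ℝ) ≤ (2 : ℝ) ^ ((k : ℝ) ^ (1 / 3 : ℝ) * (K * logRatio n ε ^ d)) ∧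
                (∀ p ∈ F, p.1 ⊆ C ∧ p.2 ⊆ C) ∧
                ∃ p ∈ F,
                  p.2 ⊆ Rᶜ ∧
                  ((p.1 ∩ Rᶜ).card : ℝ) ≤ ((C ∩ Rᶜ).card : ℝ) / 2 ∧
                  ∑ S : Finset (Fin n) with
                      paramKappa n ε * paramEll k n ε ≤ ((S ∩ C) \ p.1).card,
                    fourierCoef (aveOver p.2 f) S ^ 2 ≤ 4 * ε ^ 2 / (k : ℝ) ^ 2} := by
  -- The value 50 is 42 + 8 from `pow_numReps_le`, 2c + 2 and 5 come from `numReps_le`, and k ≥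
  -- 2^100 ensures Λ ≥ 100.
  refine ⟨50, by norm_num, fun c hc => ⟨2 * c + 2, 5, 2 ^ 100, ?_⟩⟩
  intro k n ε hk hε0 hε1 f A R C hf hA hfw hR hC
  have hkn : k ≤ n := by
    rw [← hR]
    exact (Finset.card_le_univ R).trans_eq (Fintype.card_fin n)
  have h : Regime k n ε := ⟨hk, hkn, lt_of_lt_of_le (by positivity) hε0, hε1⟩
  obtain ⟨h1, h2⟩ := refineCoordinates_good h hc hA.law hf hfw hR hC
  refine ⟨h1, h2.trans (measure_mono ?_)⟩
  rintro F ⟨hF1, hF2, p, hp, hp1, hp2⟩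
  refine ⟨?_, hF2, p, hp, hp1, hp2⟩
  have : (F.card : ℝ) ≤ numReps c k n ε := by exact_mod_cast hF1
  exact this.trans (numReps_le h (by linarith))
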